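/- **Setting.** Let $E$ and $H\neq\{0\}$ be finite-dimensional real vector spaces with duals $E^*,H^*$, let $K\subset E$ be a regular cone (closed, convex, pointed, with nonempty interior) and $K^*\subset E^*$ its dual cone. Let $F$ be a $\nu$-normal barrier for $K$: a $C^3$ convex function on $\operatorname{int}K$ that tends to $+\infty$ at the boundary of $K$, is self-concordant ($|\nabla^3F(x)[h,h,h]|\le 2\langle\nabla^2F(x)h,h\rangle^{3/2}$), and satisfies $F(\tau x)=F(x)-\nu\ln\tau$ for $\tau>0$. Let $F_*(s)=\max_{x\in\operatorname{int}K}\{-\langle s,x\rangle-F(x)\}$, $s\in\operatorname{int}K^*$, be the dual barrier. Let $A:E\to H^*$ be linear and surjective, with adjoint $A^*:H\to E^*$, and let $b\in H^*$, $c\in E^*$. Consider the conic problems $$\min\{\langle c,x\rangle: Ax=b,\ x\in K\},\qquad \max\{\langle b,y\rangle: y\in Q\},$$ where $s(y)=c-A^*y$ and $Q=\{y\in H: s(y)\in K^*\}$. Assume that both are strictly feasible: there are $x_0\in\operatorname{int}K$ with $Ax_0=b$ and $y_0\in H$ with $s(y_0)\in\operatorname{int}K^*$. Let $(x_\mu,s_\mu,y_\mu)$,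 $\mu>0$, be the primal-dual central path: $x_\mu\in\operatorname{int}K$, $Ax_\mu=b$, $c+\mu\nabla F(x_\mu)=A^*y_\mu$, $s_\mu=-\mu\nabla F(x_\mu)$. Put $f(y)=F_*(s(y))$ for $y\in\operatorname{int}Q$, $B=\nabla^2F(x_\mu)|_{\mu=1}$, $G=AB^{-1}A^*$, $\|x\|_B=\langle Bx,x\rangle^{1/2}$ for $x\in E$, $\|y\|_G=\langle Gy,y\rangle^{1/2}$ for $y\in H$, and $\|g\|_y=\langle g,[\nabla^2f(y)]^{-1}g\rangle^{1/2}$ for $y\in\operatorname{int}Q$, $g\in H^*$. Let $y_*$ be an optimal solution of the dual problem, $s_*=s(y_*)$, $f^*=\langle b,y_*\rangle$, and assume that there are constants $\gamma_d>0$ and $\sigma_d$ with $$f^*-\langle b,y\rangle\ \ge\ \gamma_d\|y-y_*\|_G\quad(y\in Q),\qquad \|\nabla^2F_*(s_\mu)s_*\|_B\le\sigma_d\quad(0<\mu\le1).$$ For $y\in\operatorname{int}Q$ let $\gamma(y,\mu)=\|\nabla f(y)-\tfrac1\mu b\|_y$, let $\mathcal N(\mu,\beta)=\{y\in\operatorname{int}Q:\gamma(y,\mu)\le\beta\}$,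 and let $$v(y)=[\nabla^2f(y)]^{-1}\nabla f(y),\qquad y(\alpha)=y+\alpha v(y),\qquad \bar\alpha=\bar\alpha(y)=\max\{\alpha\ge0:y(\alpha)\in Q\},$$ $$\xi_{\bar\alpha}(\alpha)=1+\frac{\alpha\bar\alpha}{\bar\alpha-\alpha},\qquad \sigma_s(h)=\min\{\rho\ge0:\rho s-h\in K^*\}\quad(s\in\operatorname{int}K^*,\ h\in E^*),$$ $$\kappa_1=\nu+\frac{\beta(\beta+\sqrt\nu)}{1-\beta},\qquad \kappa_2=\frac{2}{\gamma_d}\Bigl(\sigma_d+\frac{6\nu^2}{\mu}\beta\Bigr),\qquad \kappa=\kappa_1\kappa_2 .$$ **Theorem.** Suppose that $F_*$ has negative curvature, that is, $\nabla^3F_*(s)[h]\preceq0$ for all $s\in\operatorname{int}K^*$ and $h\in K^*$. Let $\mu\in(0,1]$, $\beta\in[0,\tfrac19]$ and $y\in\mathcal N(\mu,\beta)$, and suppose that $\kappa\mu<1-2\beta$. Then the maximum $\bar\alpha(y)$ exists and, for every $\alpha\in(0,\bar\alpha)$, $y(\alpha)\in\operatorname{int}Q$ and $$\gamma\Bigl(y(\alpha),\frac{\mu}{\xi_{\bar\alpha}(\alpha)}\Bigr)\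 \le\ \Gamma_\mu(y,\alpha):=\bigl(1+\alpha\,\sigma_{s(y)}(-A^*v(y))\bigr)\Bigl\|\nabla f(y(\alpha))-\frac{\xi_{\bar\alpha}(\alpha)}{\mu}b\Bigr\|_y$$ $$\le\ \bigl(1+\alpha\,\sigma_{s(y)}(-A^*v(y))\bigr)\Bigl[\gamma_1(\alpha)+\beta\Bigl(1+\frac{\alpha\bar\alpha}{\bar\alpha-\alpha}\Bigr)\Bigr],$$ where $\gamma_1(\alpha):=\|\nabla f(y(\alpha))-\xi_{\bar\alpha}(\alpha)\nabla f(y)\|_y$ satisfies $$\gamma_1(\alpha)\ \le\ \frac{\alpha\bar\alpha\mu}{(\bar\alpha-\alpha)^2}\left(\Bigl(1-\frac{\alpha}{\bar\alpha}\Bigr)\kappa\sqrt\nu+\frac{2\kappa_1}{\gamma_d}\left[\sigma_d+\frac{6\nu^2\beta}{\mu}+2\kappa\nu\Bigl(1+\frac{\sqrt\nu}{1-\kappa\mu-2\beta}\Bigr)\frac{1-\beta}{1-2\beta}\right]\right).$$ -/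

import Mathlib

open Set Filter Topology

noncomputable section

namespace ConicIPM

section Calculus

variable {V : Type*} [NormedAddCommGroup V] [NormedSpace ℝ V]

/-- The gradient `∇Φ(x) ∈ V*`. -/
def grad (Φ : V → ℝ) (x : V) : StrongDual ℝ V :=
  fderiv ℝ Φ x

/-- The Hessian `∇²Φ(x) : V → V*`. -/
def hess (Φ : V → ℝ) (x : V) : V →L[ℝ] StrongDual ℝ V :=
  fderiv ℝ (fderiv ℝ Φ) x

/-- The third differential `∇³Φ(x)[h₁, h₂, h₃]`. -/
def third (Φ : V → ℝ) (x h₁ h₂ h₃ : V) : ℝ :=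
  fderiv ℝ (fderiv ℝ (fderiv ℝ Φ)) x h₁ h₂ h₃

/-- `‖h‖_B = ⟨B h, h⟩^{1/2}` for `h ∈ V` and a self-adjoint positive definite `B : V → V*`. -/
def opNorm (B : V →L[ℝ] StrongDual ℝ V) (h : V) : ℝ :=
  Real.sqrt (B h h)

/-- `‖s‖_B = ⟨s, B⁻¹ s⟩^{1/2}` for `s ∈ V*` and a self-adjoint positive definite `B : V → V*`. -/
def opDualNorm (B : V →L[ℝ] StrongDual ℝ V) (s : StrongDual ℝ V) : ℝ :=
  Real.sqrt (s (B.inverse s))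

/-- `Φ` is a `ν`-normal barrier for the closed convex cone `C`: a three times continuously
differentiable convex function on `int C`, tending to `+∞` at the boundary of `C`,
self-concordant, and `ν`-logarithmically homogeneous. -/
structure IsNormalBarrier (C : Set V) (Φ : V → ℝ) (ν : ℝ) : Prop where
  contDiffOn : ContDiffOn ℝ 3 Φ (interior C)
  convexOn : ConvexOn ℝ (interior C) Φ
  tendsto_atTop : ∀ x ∈ frontier C, Tendsto Φ (𝓝[interior C] x) atTop
  selfConcordant : ∀ x ∈ interior C, ∀ h : V,
    |third Φ x h h h| ≤ 2 * (hess Φ x h h) ^ (3 / 2 : ℝ)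
  logHomogeneous : ∀ x ∈ interior C, ∀ τ : ℝ, 0 < τ → Φ (τ • x) = Φ x - ν * Real.log τ

/-- The barrier `Φ` of the cone `C` has negative curvature: the quadratic form `∇³Φ(x)[h]` is
negative semidefinite for all `x ∈ int C` and `h ∈ C`. -/
def HasNegativeCurvature (C : Set V) (Φ : V → ℝ) : Prop :=
  ∀ x ∈ interior C, ∀ h ∈ C, ∀ u : V, third Φ x h u u ≤ 0

/-- `σ_x(h) = min {ρ ≥ 0 : ρ x - h ∈ C}`, for `x ∈ int C`. -/
def relMeasure (C : Set V) (x h : V) : ℝ :=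
  sInf {ρ : ℝ | 0 ≤ ρ ∧ ρ • x - h ∈ C}

end Calculus

/-- `ξ_ᾱ(α) = 1 + α ᾱ / (ᾱ - α)`. -/
def ξ (αbar α : ℝ) : ℝ :=
  1 + α * αbar / (αbar - α)

/-- The data of the primal-dual pair of conic problems
`min {⟨c, x⟩ : A x = b, x ∈ K}` and `max {⟨b, y⟩ : s + A* y = c, s ∈ K*}`,
with `A : E → H*`, together with a function `F` (the primal barrier) and its parameter `ν`. -/
structure ConicProblem (E H : Type*) [NormedAddCommGroup E] [NormedSpace ℝ E]
    [NormedAddCommGroup H] [NormedSpace ℝ H] where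
  K : ProperCone ℝ E
  F : E → ℝ
  ν : ℝ
  A : E →L[ℝ] StrongDual ℝ H
  b : StrongDual ℝ H
  c : StrongDual ℝ E

namespace ConicProblem

variable {E H : Type*} [NormedAddCommGroup E] [NormedSpace ℝ E]
  [NormedAddCommGroup H] [NormedSpace ℝ H] (P : ConicProblem E H)

/-- The (closed convex) cone `K` is regular: it is pointed, i.e. it contains no line,
and it has nonempty interior. -/
def IsRegular : Prop :=
  (∀ x ∈ P.K, -x ∈ P.K → x = 0) ∧ (interior (P.K : Set E)).Nonempty

/-- The dual cone `K*`. -/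
def dualCone : Set (StrongDual ℝ E) :=
  {s | ∀ x ∈ P.K, 0 ≤ s x}

/-- The dual barrier `F_*(s) = max {-⟨s, x⟩ - F(x) : x ∈ int K}`. -/
def dualBarrier (s : StrongDual ℝ E) : ℝ :=
  sSup ((fun x : E => -(s x) - P.F x) '' interior (P.K : Set E))

/-- The adjoint `A* : H → E*`, `⟨A* y, x⟩ = ⟨A x, y⟩`. -/
def adj : H →L[ℝ] StrongDual ℝ E :=
  P.A.flip

/-- The slack `s(y) = c - A* y`. -/
def slack (y : H) : StrongDual ℝ E :=
  P.c - P.adj y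

/-- The dual feasible set `Q = {y : c - A* y ∈ K*}`. -/
def Q : Set H :=
  {y | P.slack y ∈ P.dualCone}

/-- The barrier `f(y) = F_*(c - A* y)` of `Q`. -/
def f (y : H) : ℝ :=
  P.dualBarrier (P.slack y)

/-- Strict feasibility of the primal and of the dual problem. -/
def StrictlyFeasible : Prop :=
  (∃ x ∈ interior (P.K : Set E), P.A x = P.b) ∧ ∃ y : H, P.slack y ∈ interior P.dualCone

/-- `y` is an optimal solution of the dual problem `max {⟨b, y⟩ : y ∈ Q}`. -/
def IsDualOptimal (y : H) : Prop :=
  y ∈ P.Q ∧ ∀ y' ∈ P.Q, P.b y' ≤ P.b y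

/-- The system that defines the point `(x_μ, s_μ, y_μ)` of the primal-dual central path. -/
def IsCentralPoint (μ : ℝ) (z : E × StrongDual ℝ E × H) : Prop :=
  z.1 ∈ interior (P.K : Set E) ∧ P.A z.1 = P.b ∧
    P.c + μ • grad P.F z.1 = P.adj z.2.2 ∧ z.2.1 = -(μ • grad P.F z.1)

/-- The primal-dual central path `μ ↦ (x_μ, s_μ, y_μ)`, `μ > 0`. -/
def centralPath (μ : ℝ) : E × StrongDual ℝ E × H :=
  Classical.epsilon (P.IsCentralPoint μ)

/-- The `s`-component `s_μ` of the central path. -/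
def sCentral (μ : ℝ) : StrongDual ℝ E :=
  (P.centralPath μ).2.1

/-- `B = ∇²F(x_μ)` with `μ = 1`: the operator defining the fixed Euclidean norms on `E`, `E*`. -/
def B : E →L[ℝ] StrongDual ℝ E :=
  hess P.F (P.centralPath 1).1

/-- `G = A B⁻¹ A* : H → H*`: the operator defining the fixed Euclidean norms on `H`, `H*`. -/
def G : H →L[ℝ] StrongDual ℝ H :=
  P.A ∘L P.B.inverse ∘L P.adj

/-- The Hessian `∇²F_*(s)`, as an operator `E* → E` (via the canonical identification of
the finite-dimensional space `E` with its bidual). -/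
def dualHess (s : StrongDual ℝ E) : StrongDual ℝ E →L[ℝ] E :=
  (NormedSpace.inclusionInDoubleDual ℝ E).inverse ∘L hess P.dualBarrier s

/-- The dual problem has the sharp optimal solution `yStar`, with constant `γd > 0`. -/
def IsSharp (yStar : H) (γd : ℝ) : Prop :=
  0 < γd ∧ ∀ y ∈ P.Q, γd * opNorm P.G (y - yStar) ≤ P.b yStar - P.b y

/-- The vectors `∇²F_*(s_μ) s_*`, `μ ∈ (0, 1]`, are bounded by `σd` in the norm `‖·‖_B`. -/
def IsHessBounded (yStar : H) (σd : ℝ) : Prop :=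
  ∀ μ : ℝ, 0 < μ → μ ≤ 1 → opNorm P.B (P.dualHess (P.sCentral μ) (P.slack yStar)) ≤ σd

/-- The local norm `‖g‖_y = ⟨g, [∇²f(y)]⁻¹ g⟩^{1/2}` of `g ∈ H*`. -/
def localNorm (y : H) (g : StrongDual ℝ H) : ℝ :=
  opDualNorm (hess P.f y) g

/-- The local gradient proximity measure `γ(y, μ) = ‖∇f(y) - (1/μ) b‖_y`. -/
def proximity (y : H) (μ : ℝ) : ℝ :=
  P.localNorm y (grad P.f y - (1 / μ) • P.b)

/-- The neighborhood `N(μ, β)` of the central path. -/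
def nbhd (μ β : ℝ) : Set H :=
  {y | y ∈ interior P.Q ∧ P.proximity y μ ≤ β}

/-- The predictor direction `v(y) = [∇²f(y)]⁻¹ ∇f(y)`. -/
def v (y : H) : H :=
  (hess P.f y).inverse (grad P.f y)

/-- The predicted point `y(α) = y + α v(y)`. -/
def step (y : H) (α : ℝ) : H :=
  y + α • P.v y

/-- The maximal feasible step size `ᾱ(y) = max {α ≥ 0 : y + α v(y) ∈ Q}`. -/
def maxStep (y : H) : ℝ :=
  sSup {α : ℝ | 0 ≤ α ∧ P.step y α ∈ P.Q}

/-- `κ₁ = ν + β (β + √ν) / (1 - β)`. -/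
def κ₁ (β : ℝ) : ℝ :=
  P.ν + β * (β + Real.sqrt P.ν) / (1 - β)

/-- `κ₂ = (2 / γ_d) (σ_d + 6 ν² β / μ)`. -/
def κ₂ (γd σd μ β : ℝ) : ℝ :=
  2 / γd * (σd + 6 * P.ν ^ 2 / μ * β)

/-- `κ = κ₁ κ₂`. -/
def κ (γd σd μ β : ℝ) : ℝ :=
  P.κ₁ β * P.κ₂ γd σd μ β

/-- `Γ_μ(y, α) = (1 + α σ_{s(y)}(-A* v(y))) ‖∇f(y(α)) - (ξ_ᾱ(α) / μ) b‖_y`, `ᾱ = ᾱ(y)`. -/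
def Γ (μ : ℝ) (y : H) (α : ℝ) : ℝ :=
  (1 + α * relMeasure P.dualCone (P.slack y) (-(P.adj (P.v y)))) *
    P.localNorm y (grad P.f (P.step y α) - (ξ (P.maxStep y) α / μ) • P.b)

/-- `γ₁(α) = ‖∇f(y(α)) - ξ_ᾱ(α) ∇f(y)‖_y`, `ᾱ = ᾱ(y)`. -/
def γ₁ (y : H) (α : ℝ) : ℝ :=
  P.localNorm y (grad P.f (P.step y α) - ξ (P.maxStep y) α • grad P.f y)

end ConicProblem

end ConicIPM

end

/-! The predictor direction almost points at the optimum. Write `e = v(y) - (y_* - y)`. Logarithmic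
homogeneity gives `∇f(y) = A ∇²F_*(s) s`, and `A*(y_* - y) = s - s_*`, so `∇²f(y) e = A ∇²F_*(s)
s_*`. The hypothesis on `∇²F_*(s_μ) s_*` is carried over to `s = s(y)` by comparing Hessians
(`opNorm_B_dualHess_le`). Sharpness makes the fixed norm small relative to the local one: the Dikin
ellipsoid at `y` lies in `Q`, whence `‖·‖_G ≤ (κ₁ μ / γ_d) ‖·‖` in the norm of `∇²f(y)`.
Cauchy-Schwarz then yields `‖e‖ ≤ κμ/2` in that norm (`opNorm_v_sub_le`), and from it `ᾱ` exists and
is close to `1` (`abs_maxStep_sub_one_le`).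

With `t = α/ᾱ`, the new slack is `(1 - t) s + t s(ᾱ)`. If the second summand were absent, its
gradient would be exactly `(1 - t)⁻¹ ∇f(y)` by homogeneity. The error `γ₁` is therefore split into
three: replacing `s(ᾱ)` by `s_*`, dropping `t s_*`, and replacing `(1 - t)⁻¹` by `ξ`, which differ
by `t(ᾱ - 1)/(1 - t)`. The first is a Lipschitz estimate (`abs_grad_sub_le`), the second is
`abs_grad_sub_slack_optimal_le`, and the third follows from the bound on `|ᾱ - 1|`.

Negative curvature enters through the cone order: it makes the Hessian of `F_*` antitone, its first
derivatives along cone directions concave, and its gradient monotone. Thus `ρ s - s' ∈ K*` implies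
`∇²F_*(s) ≼ ρ² ∇²F_*(s')`, which gives every comparison of local norms, including the factor `1 + α
σ_s` in `localNorm_step_le`. The rest of the theory of normal barriers (Dikin ellipsoid, conjugate
barrier, central path) is developed from the definitions. -/

namespace ConicIPM

/-! ### The scalar differential inequality behind self-concordance. -/

/-- Two-sided comparison of the values of a nonnegative function `q` with `|q'| ≤ 2 q ^ (3 / 2)`. -/
theorem sqrt_le_of_abs_deriv_le {q q' : ℝ → ℝ} {T : ℝ} (hT : 0 ≤ T)
    (hq : ∀ t ∈ Icc 0 T, HasDerivAt q (q' t) t) (h0 : ∀ t ∈ Icc 0 T, 0 ≤ q t)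
    (hb : ∀ t ∈ Icc 0 T, |q' t| ≤ 2 * q t ^ (3 / 2 : ℝ)) :
    √(q 0) ≤ √(q T) * (1 + T * √(q 0)) ∧ √(q T) * (1 - T * √(q 0)) ≤ √(q 0) := by
  -- Where `q > 0` the hypothesis says that `q ^ (-1/2)` has derivative at most `1` in absolute
  -- value. Since `q` may vanish, the argument is run for `q + ε` and `ε → 0` at the end.
  have key : ∀ ε : ℝ, 0 < ε → √(q 0 + ε) ≤ √(q T + ε) * (1 + T * √(q 0 + ε)) ∧
      √(q T + ε) * (1 - T * √(q 0 + ε)) ≤ √(q 0 + ε) := by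
    intro ε hε
    have hpos : ∀ t ∈ Icc 0 T, 0 < q t + ε := fun t ht => by linarith [h0 t ht]
    have hder : ∀ t ∈ Icc 0 T, HasDerivWithinAt (fun t => (√(q t + ε))⁻¹)
        (-(q' t / (2 * √(q t + ε))) / √(q t + ε) ^ 2) (Icc 0 T) t := by
      intro t ht
      have h1 : HasDerivAt (fun t => q t + ε) (q' t) t := (hq t ht).add_const ε
      exact ((h1.sqrt (hpos t ht).ne').inv (Real.sqrt_pos.2 (hpos t ht)).ne').hasDerivWithinAt
    have hbd : ∀ t ∈ Ico 0 T, ‖-(q' t / (2 * √(q t + ε))) / √(q t + ε) ^ 2‖ ≤ 1 := by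
      intro t ht'
      have ht : t ∈ Icc 0 T := Ico_subset_Icc_self ht'
      have hp := hpos t ht
      have hs := Real.sqrt_pos.2 hp
      have h32 : (q t + ε) ^ (3 / 2 : ℝ) = √(q t + ε) ^ 2 * √(q t + ε) := by
        rw [Real.sq_sqrt hp.le, Real.sqrt_eq_rpow]
        nth_rw 2 [← Real.rpow_one (q t + ε)]
        rw [← Real.rpow_add hp]
        norm_num
      have h1 : |q' t| ≤ 2 * (√(q t + ε) ^ 2 * √(q t + ε)) := by
        rw [← h32]
        refine (hb t ht).trans ?_
        have := Real.rpow_le_rpow (h0 t ht) (by linarith : q t ≤ q t + ε)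
          (by norm_num : (0 : ℝ) ≤ 3 / 2)
        linarith
      rw [norm_div, norm_neg, norm_div, Real.norm_eq_abs, Real.norm_eq_abs, Real.norm_eq_abs,
        abs_of_pos (by positivity : 0 < 2 * √(q t + ε)),
        abs_of_pos (by positivity : 0 < √(q t + ε) ^ 2), div_div, div_le_one (by positivity)]
      linarith
    have := norm_image_sub_le_of_norm_deriv_le_segment' hder hbd T (right_mem_Icc.2 hT)
    have ha := Real.sqrt_pos.2 (hpos T (right_mem_Icc.2 hT))
    have hb' := Real.sqrt_pos.2 (hpos 0 (left_mem_Icc.2 hT))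
    set a := √(q T + ε)
    set b := √(q 0 + ε)
    rw [one_mul, sub_zero, Real.norm_eq_abs, abs_le] at this
    obtain ⟨h1, h2⟩ := this
    have e1 : (a⁻¹ - b⁻¹) * (a * b) = b - a := by field_simp
    have hab : 0 < a * b := by positivity
    constructor
    · nlinarith [mul_le_mul_of_nonneg_right h2 hab.le]
    · nlinarith [mul_le_mul_of_nonneg_right h1 hab.le]
  have hlim : ∀ c : ℝ, Tendsto (fun ε => √(c + ε)) (𝓝[>] 0) (𝓝 √c) := by
    intro c
    have : Continuous fun ε : ℝ => √(c + ε) := by fun_prop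
    simpa using (this.tendsto 0).mono_left nhdsWithin_le_nhds
  have hev : ∀ᶠ ε : ℝ in 𝓝[>] 0, 0 < ε := self_mem_nhdsWithin
  constructor
  · refine le_of_tendsto_of_tendsto (hlim _)
      ((hlim (q T)).mul (((hlim (q 0)).const_mul T).const_add 1)) ?_
    filter_upwards [hev] with ε hε using (key ε hε).1
  · refine le_of_tendsto_of_tendsto
      ((hlim (q T)).mul (((hlim (q 0)).const_mul T).const_sub 1)) (hlim _) ?_
    filter_upwards [hev] with ε hε using (key ε hε).2

/-! ### Regular cones, and derivatives of a normal barrier along lines. -/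

section Barrier

variable {V : Type*} [NormedAddCommGroup V] [NormedSpace ℝ V]

/-- A regular cone: closed, convex, pointed, with nonempty interior. -/
structure IsRegularCone (C : Set V) : Prop where
  isClosed : IsClosed C
  convex : Convex ℝ C
  smul_mem : ∀ x ∈ C, ∀ t : ℝ, 0 ≤ t → t • x ∈ C
  pointed : ∀ x ∈ C, -x ∈ C → x = 0
  nonempty_interior : (interior C).Nonempty

namespace IsRegularCone

variable {C : Set V} (hC : IsRegularCone C)
include hC

theorem zero_mem : (0 : V) ∈ C := by
  obtain ⟨x, hx⟩ := hC.nonempty_interior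
  simpa using hC.smul_mem x (interior_subset hx) 0 le_rfl

theorem add_mem {x y : V} (hx : x ∈ C) (hy : y ∈ C) : x + y ∈ C := by
  have h := hC.convex hx hy (by norm_num : (0 : ℝ) ≤ 1 / 2) (by norm_num : (0 : ℝ) ≤ 1 / 2)
    (by norm_num)
  have h2 := hC.smul_mem _ h 2 (by norm_num)
  rwa [← smul_add, smul_smul, show (2 : ℝ) * (1 / 2) = 1 by norm_num, one_smul] at h2

theorem smul_mem_interior {x : V} (hx : x ∈ interior C) {t : ℝ} (ht : 0 < t) :
    t • x ∈ interior C := by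
  have h1 : ((fun z => t • z) '' interior C) ⊆ C := by
    rintro _ ⟨z, hz, rfl⟩
    exact hC.smul_mem z (interior_subset hz) t ht.le
  have h2 : IsOpen ((fun z => t • z) '' interior C) :=
    (Homeomorph.smulOfNeZero t ht.ne').isOpenMap _ isOpen_interior
  exact interior_maximal h1 h2 ⟨x, hx, rfl⟩

theorem add_mem_interior {x h : V} (hx : x ∈ interior C) (hh : h ∈ C) : x + h ∈ interior C := by
  have h1 : ((fun z => z + h) '' interior C) ⊆ C := by
    rintro _ ⟨z, hz, rfl⟩
    exact hC.add_mem (interior_subset hz) hh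
  have h2 : IsOpen ((fun z => z + h) '' interior C) :=
    (Homeomorph.addRight h).isOpenMap _ isOpen_interior
  exact interior_maximal h1 h2 ⟨x, hx, rfl⟩

/-- Recession directions of a closed cone belong to it: rescale by `t⁻¹` and let `t → ∞`. -/
theorem mem_of_forall_add_smul_mem {x h : V} (hx : ∀ t : ℝ, 0 < t → x + t • h ∈ C) : h ∈ C := by
  have h1 : Tendsto (fun t : ℝ => t⁻¹ • x + h) atTop (𝓝 ((0 : ℝ) • x + h)) :=
    (tendsto_inv_atTop_zero.smul_const x).add_const h
  rw [zero_smul, zero_add] at h1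
  refine hC.isClosed.mem_of_tendsto h1 ?_
  filter_upwards [eventually_gt_atTop 0] with t ht
  have := hC.smul_mem _ (hx t ht) t⁻¹ (inv_nonneg.2 ht.le)
  rwa [smul_add, smul_smul, inv_mul_cancel₀ ht.ne', one_smul] at this

end IsRegularCone

theorem hasFDerivAt_hess_of_contDiffOn {U : Set V} (hU : IsOpen U) {Φ : V → ℝ}
    (h : ContDiffOn ℝ 3 Φ U) {x : V} (hx : x ∈ U) :
    HasFDerivAt (hess Φ) (fderiv ℝ (fderiv ℝ (fderiv ℝ Φ)) x) x := by
  rw [show (3 : WithTop ℕ∞) = 1 + 1 + 1 by norm_num, contDiffOn_succ_iff_fderiv_of_isOpen hU,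
    contDiffOn_succ_iff_fderiv_of_isOpen hU] at h
  exact ((h.2.2.2.2.contDiffAt (hU.mem_nhds hx)).differentiableAt (by norm_num)).hasFDerivAt

theorem hasDerivAt_hess_line_of_contDiffOn {U : Set V} (hU : IsOpen U) {Φ : V → ℝ}
    (hΦ : ContDiffOn ℝ 3 Φ U) {x h : V} (u w : V) {t : ℝ} (ht : x + t • h ∈ U) :
    HasDerivAt (fun t : ℝ => hess Φ (x + t • h) u w) (third Φ (x + t • h) h u w) t := by
  have hl : HasDerivAt (fun t : ℝ => x + t • h) h t := by
    simpa using ((hasDerivAt_id t).smul_const h).const_add x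
  have h1 : HasFDerivAt (fun z => hess Φ z) (fderiv ℝ (fderiv ℝ (fderiv ℝ Φ)) (x + t • h))
    (x + t • h) := hasFDerivAt_hess_of_contDiffOn hU hΦ ht
  have : HasDerivAt (fun t : ℝ => hess Φ (x + t • h))
      (fderiv ℝ (fderiv ℝ (fderiv ℝ Φ)) (x + t • h) h) t :=
    HasFDerivAt.comp_hasDerivAt (F := V) (E := V →L[ℝ] StrongDual ℝ V) (f := fun t => x + t • h)
      (l := fun z => hess Φ z) t h1 hl
  simpa [third] using (this.clm_apply (hasDerivAt_const t u)).clm_apply (hasDerivAt_const t w)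

namespace IsNormalBarrier

variable {C : Set V} {Φ : V → ℝ} {ν : ℝ} (hΦ : IsNormalBarrier C Φ ν)
include hΦ

theorem contDiffAt {x : V} (hx : x ∈ interior C) : ContDiffAt ℝ 3 Φ x :=
  hΦ.contDiffOn.contDiffAt (isOpen_interior.mem_nhds hx)

theorem contDiffOn_grad : ContDiffOn ℝ 2 (grad Φ) (interior C) := by
  have h := hΦ.contDiffOn
  rw [show (3 : WithTop ℕ∞) = 2 + 1 by norm_num,
    contDiffOn_succ_iff_fderiv_of_isOpen isOpen_interior] at h
  exact h.2.2

theorem hasFDerivAt {x : V} (hx : x ∈ interior C) : HasFDerivAt Φ (grad Φ x) x :=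
  ((hΦ.contDiffAt hx).differentiableAt (by norm_num)).hasFDerivAt

theorem hasFDerivAt_grad {x : V} (hx : x ∈ interior C) : HasFDerivAt (grad Φ) (hess Φ x) x :=
  ((hΦ.contDiffOn_grad.contDiffAt (isOpen_interior.mem_nhds hx)).differentiableAt
    (by norm_num)).hasFDerivAt

theorem hasFDerivAt_hess {x : V} (hx : x ∈ interior C) :
    HasFDerivAt (hess Φ) (fderiv ℝ (fderiv ℝ (fderiv ℝ Φ)) x) x :=
  hasFDerivAt_hess_of_contDiffOn isOpen_interior hΦ.contDiffOn hx

theorem hess_symm {x : V} (hx : x ∈ interior C) (u w : V) : hess Φ x u w = hess Φ x w u :=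
  ((hΦ.contDiffAt hx).isSymmSndFDerivAt (by simp; norm_num)) u w

theorem third_swap_left {x : V} (hx : x ∈ interior C) (u v w : V) :
    third Φ x u v w = third Φ x v u w := by
  have := ((hΦ.contDiffOn_grad.contDiffAt (isOpen_interior.mem_nhds hx)).isSymmSndFDerivAt
    (by simp)) u v
  exact congrArg (fun l : StrongDual ℝ V => l w) this

theorem hasDerivAt_line {x h : V} {t : ℝ} (ht : x + t • h ∈ interior C) :
    HasDerivAt (fun t : ℝ => Φ (x + t • h)) (grad Φ (x + t • h) h) t := by
  have hl : HasDerivAt (fun t : ℝ => x + t • h) h t := by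
    simpa using ((hasDerivAt_id t).smul_const h).const_add x
  exact (hΦ.hasFDerivAt ht).comp_hasDerivAt t hl

theorem hasDerivAt_grad_line {x h : V} (u : V) {t : ℝ} (ht : x + t • h ∈ interior C) :
    HasDerivAt (fun t : ℝ => grad Φ (x + t • h) u) (hess Φ (x + t • h) h u) t := by
  have hl : HasDerivAt (fun t : ℝ => x + t • h) h t := by
    simpa using ((hasDerivAt_id t).smul_const h).const_add x
  have := (hΦ.hasFDerivAt_grad ht).comp_hasDerivAt t hl
  simpa using this.clm_apply (hasDerivAt_const t u)

theorem hasDerivAt_hess_line {x h : V} (u w : V) {t : ℝ} (ht : x + t • h ∈ interior C) :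
    HasDerivAt (fun t : ℝ => hess Φ (x + t • h) u w) (third Φ (x + t • h) h u w) t :=
  hasDerivAt_hess_line_of_contDiffOn isOpen_interior hΦ.contDiffOn u w ht

theorem third_swap_right {x : V} (hx : x ∈ interior C) (u v w : V) :
    third Φ x u v w = third Φ x u w v := by
  have hx' : x + (0 : ℝ) • u ∈ interior C := by simpa using hx
  have h1 := hΦ.hasDerivAt_hess_line (h := u) v w hx'
  have h2 := hΦ.hasDerivAt_hess_line (h := u) w v hx'
  have hev : (fun t : ℝ => hess Φ (x + t • u) v w) =ᶠ[𝓝 0] fun t => hess Φ (x + t • u) w v := by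
    have hc : ContinuousAt (fun t : ℝ => x + t • u) 0 := by fun_prop
    filter_upwards [hc.preimage_mem_nhds (isOpen_interior.mem_nhds hx')] with t ht
    exact hΦ.hess_symm ht v w
  have := (h2.congr_of_eventuallyEq hev).unique h1
  simpa using this.symm

theorem add_grad_le {x x' : V} (hx : x ∈ interior C) (hx' : x' ∈ interior C) :
    Φ x + grad Φ x (x' - x) ≤ Φ x' := by
  have hc : ConvexOn ℝ (Icc (0 : ℝ) 1) (fun t : ℝ => Φ (x + t • (x' - x))) := by
    have h1 := hΦ.convexOn.comp_affineMap (AffineMap.lineMap x x' : ℝ →ᵃ[ℝ] V)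
    have h2 : Φ ∘ (AffineMap.lineMap x x' : ℝ →ᵃ[ℝ] V) = fun t : ℝ => Φ (x + t • (x' - x)) := by
      ext t
      simp [AffineMap.lineMap_apply, add_comm]
    rw [h2] at h1
    refine h1.subset ?_ (convex_Icc 0 1)
    intro t ht
    exact hΦ.convexOn.1.lineMap_mem hx hx' ht
  have hd := hΦ.hasDerivAt_line (x := x) (h := x' - x) (t := 0) (by simpa using hx)
  have := hc.le_slope_of_hasDerivAt (left_mem_Icc.2 zero_le_one) (right_mem_Icc.2 zero_le_one)
    zero_lt_one hd
  simp [slope_def_field] at this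
  simp only [map_sub]
  linarith

theorem hess_self_nonneg {x : V} (hx : x ∈ interior C) (h : V) : 0 ≤ hess Φ x h h := by
  have hx' : x + (0 : ℝ) • h ∈ interior C := by simpa using hx
  have h1 := (hΦ.hasDerivAt_grad_line (h := h) h hx').tendsto_slope_zero_right
  have hc : ContinuousAt (fun t : ℝ => x + t • h) 0 := by fun_prop
  have hev : ∀ᶠ t : ℝ in 𝓝[>] 0, x + t • h ∈ interior C :=
    nhdsWithin_le_nhds (hc.preimage_mem_nhds (isOpen_interior.mem_nhds hx'))
  have := ge_of_tendsto (b := 0) h1 ?_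
  · simpa using this
  filter_upwards [hev, self_mem_nhdsWithin] with t ht htp
  have htp : 0 < t := htp
  have e1 := hΦ.add_grad_le hx ht
  have e2 := hΦ.add_grad_le ht hx
  simp only [add_sub_cancel_left, sub_add_cancel_left, map_neg, map_smul, smul_eq_mul] at e1 e2
  have e3 : 0 ≤ t * (grad Φ (x + t • h) h - grad Φ x h) := by linarith
  have := nonneg_of_mul_nonneg_right e3 htp
  simpa using mul_nonneg (inv_nonneg.2 htp.le) this

theorem sqrt_hess_line {x h : V} {T : ℝ} (hT : 0 ≤ T)
    (hl : ∀ t ∈ Icc 0 T, x + t • h ∈ interior C) :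
    √(hess Φ x h h) ≤ √(hess Φ (x + T • h) h h) * (1 + T * √(hess Φ x h h)) ∧
    √(hess Φ (x + T • h) h h) * (1 - T * √(hess Φ x h h)) ≤ √(hess Φ x h h) := by
  have := sqrt_le_of_abs_deriv_le (q := fun t => hess Φ (x + t • h) h h)
    (q' := fun t => third Φ (x + t • h) h h h) hT
    (fun t ht => hΦ.hasDerivAt_hess_line h h (hl t ht))
    (fun t ht => hΦ.hess_self_nonneg (hl t ht) h)
    (fun t ht => hΦ.selfConcordant _ (hl t ht) h)
  simpa using this

end IsNormalBarrier

end Barrier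

theorem le_of_hasDerivAt_nonpos {f f' : ℝ → ℝ} {T : ℝ} (hT : 0 ≤ T)
    (hf : ∀ t ∈ Icc 0 T, HasDerivAt f (f' t) t) (h : ∀ t ∈ Icc 0 T, f' t ≤ 0) : f T ≤ f 0 := by
  refine antitoneOn_of_deriv_nonpos (convex_Icc 0 T)
    (fun t ht => (hf t ht).continuousAt.continuousWithinAt)
    (fun t ht => (hf t (interior_subset ht)).differentiableAt.differentiableWithinAt)
    (fun t ht => ?_) (left_mem_Icc.2 hT) (right_mem_Icc.2 hT) hT
  rw [(hf t (interior_subset ht)).deriv]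
  exact h t (interior_subset ht)

/-! ### Dikin ellipsoid, logarithmic homogeneity and negative curvature. -/

section Barrier

variable {V : Type*} [NormedAddCommGroup V] [NormedSpace ℝ V]

namespace IsRegularCone

variable {C : Set V} (hC : IsRegularCone C)
include hC

theorem exists_smul_sub_mem {x : V} (hx : x ∈ interior C) (u : V) :
    ∃ c : ℝ, 0 < c ∧ c • x - u ∈ C := by
  have hc : Continuous fun t : ℝ => x - t • u := by fun_prop
  have h0 : ∀ᶠ t : ℝ in 𝓝[>] 0, x - t • u ∈ interior C :=
    nhdsWithin_le_nhds (hc.continuousAt.preimage_mem_nhds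
      (isOpen_interior.mem_nhds (by simpa using hx)))
  obtain ⟨t, ht, htp⟩ := (h0.and self_mem_nhdsWithin).exists
  have htp : 0 < t := htp
  refine ⟨t⁻¹, inv_pos.2 htp, ?_⟩
  have := hC.smul_mem _ (interior_subset ht) t⁻¹ (inv_nonneg.2 htp.le)
  rwa [smul_sub, smul_smul, inv_mul_cancel₀ htp.ne', one_smul] at this

theorem line_mem_interior {x h : V} (hx : x ∈ interior C) (hh : h ∈ C) {t : ℝ} (ht : 0 ≤ t) :
    x + t • h ∈ interior C :=
  hC.add_mem_interior hx (hC.smul_mem h hh t ht)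

theorem segment_mem_interior {x x' : V} (hx : x ∈ interior C) (hx' : x' ∈ interior C) {t : ℝ}
    (ht : t ∈ Icc (0 : ℝ) 1) : x + t • (x' - x) ∈ interior C :=
  hC.convex.interior.add_smul_sub_mem hx hx' ht

end IsRegularCone

namespace IsNormalBarrier

variable {C : Set V} {Φ : V → ℝ} {ν : ℝ} (hΦ : IsNormalBarrier C Φ ν)
include hΦ

/-- The open unit ball of the local norm (the Dikin ellipsoid) stays in the domain. -/
theorem add_mem_interior_of_hess_lt_one {x h : V} (hx : x ∈ interior C)
    (hh : hess Φ x h h < 1) : x + h ∈ interior C := by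
  by_contra hcon
  set S : Set ℝ := {t | t ∈ Icc (0 : ℝ) 1 ∧ x + t • h ∈ interior C} with hS
  have h0S : (0 : ℝ) ∈ S := ⟨left_mem_Icc.2 zero_le_one, by simpa using hx⟩
  have hSb : BddAbove S := ⟨1, fun t ht => ht.1.2⟩
  -- `T` is the exit time of the segment from `int C`. The plan is to bound `Φ` on the segment
  -- before `T`, against its blow-up at the boundary point `x + T • h`.
  set T := sSup S with hTdef
  have hT0 : 0 ≤ T := le_csSup hSb h0S
  have hT1 : T ≤ 1 := csSup_le ⟨0, h0S⟩ fun t ht => ht.1.2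
  have hcont : Continuous fun t : ℝ => x + t • h := by fun_prop
  have hlt : ∀ t, 0 ≤ t → t < T → x + t • h ∈ interior C := by
    intro t ht htT
    obtain ⟨t', ht', htt'⟩ := exists_lt_of_lt_csSup ⟨0, h0S⟩ htT
    have hp : 0 < t' := ht.trans_lt htt'
    have := hΦ.convexOn.1.add_smul_mem hx ht'.2
      (t := t / t') ⟨by positivity, (div_le_one hp).2 htt'.le⟩
    rwa [smul_smul, div_mul_cancel₀ _ hp.ne'] at this
  have hTn : x + T • h ∉ interior C := by
    intro hmem
    have hT1' : T < 1 := lt_of_le_of_ne hT1 (by rintro h1; rw [h1, one_smul] at hmem; exact hcon hmem)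
    have hev : ∀ᶠ t in 𝓝[>] T, x + t • h ∈ interior C :=
      nhdsWithin_le_nhds (hcont.continuousAt.preimage_mem_nhds (isOpen_interior.mem_nhds hmem))
    obtain ⟨t, ht, htT⟩ := (hev.and (Ioo_mem_nhdsGT hT1')).exists
    exact (le_csSup hSb ⟨⟨hT0.trans htT.1.le, htT.2.le⟩, ht⟩).not_gt htT.1
  have hTpos : 0 < T := lt_of_le_of_ne hT0 (by rintro h1; rw [← h1] at hTn; simp [hx] at hTn)
  have hev1 : ∀ᶠ t in 𝓝[<] T, x + t • h ∈ interior C := by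
    filter_upwards [Ioo_mem_nhdsLT hTpos] with t ht using hlt t ht.1.le ht.2
  have htend : Tendsto (fun t : ℝ => x + t • h) (𝓝[<] T) (𝓝[interior C] (x + T • h)) :=
    tendsto_nhdsWithin_iff.2 ⟨(hcont.tendsto T).mono_left nhdsWithin_le_nhds, hev1⟩
  have hfr : x + T • h ∈ frontier C := by
    refine ⟨?_, hTn⟩
    have h1 : Tendsto (fun t : ℝ => x + t • h) (𝓝[<] T) (𝓝 (x + T • h)) :=
      htend.mono_right nhdsWithin_le_nhds
    exact mem_closure_of_tendsto h1 (hev1.mono fun t ht => interior_subset ht)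
  set r := √(hess Φ x h h) with hr
  have hr0 : 0 ≤ r := Real.sqrt_nonneg _
  have hr1 : r < 1 := by
    rw [hr, Real.sqrt_lt' one_pos]
    simpa using hh
  -- This bound is uniform in `t` because `t < T ≤ 1` and `r < 1`.
  have hq : ∀ t ∈ Ico 0 T, hess Φ (x + t • h) h h ≤ (1 / (1 - r)) ^ 2 := by
    intro t ht
    have h1 := (hΦ.sqrt_hess_line ht.1 (fun τ hτ => hlt τ hτ.1 (hτ.2.trans_lt ht.2))).2
    rw [← hr] at h1
    have h2 : √(hess Φ (x + t • h) h h) ≤ 1 / (1 - r) := by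
      rw [le_div_iff₀ (by linarith)]
      have : √(hess Φ (x + t • h) h h) * (1 - r) ≤ √(hess Φ (x + t • h) h h) * (1 - t * r) := by
        refine mul_le_mul_of_nonneg_left ?_ (Real.sqrt_nonneg _)
        nlinarith [ht.1, ht.2]
      linarith
    have h3 := hΦ.hess_self_nonneg (hlt t ht.1 ht.2) h
    calc hess Φ (x + t • h) h h = √(hess Φ (x + t • h) h h) ^ 2 := (Real.sq_sqrt h3).symm
      _ ≤ _ := by gcongr
  have hφ : ∀ t ∈ Ico 0 T, Φ (x + t • h) ≤ Φ x + (|grad Φ x h| + (1 / (1 - r)) ^ 2) := by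
    intro t ht
    have h1 := norm_image_sub_le_of_norm_deriv_le_segment' (a := 0) (b := t)
      (f := fun t => grad Φ (x + t • h) h) (f' := fun t => hess Φ (x + t • h) h h)
      (C := (1 / (1 - r)) ^ 2)
      (fun τ hτ => (hΦ.hasDerivAt_grad_line h
        (hlt τ hτ.1 (hτ.2.trans_lt ht.2))).hasDerivWithinAt)
      (fun τ hτ => by
        rw [Real.norm_eq_abs, abs_of_nonneg (hΦ.hess_self_nonneg
          (hlt τ hτ.1 (hτ.2.trans ht.2)) h)]
        exact hq τ ⟨hτ.1, hτ.2.trans ht.2⟩) t (right_mem_Icc.2 ht.1)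
    simp only [zero_smul, add_zero, sub_zero, Real.norm_eq_abs] at h1
    have h2 := hΦ.add_grad_le (hlt t ht.1 ht.2) hx
    simp only [sub_add_cancel_left, map_neg, map_smul, smul_eq_mul] at h2
    have ht1 : t ≤ 1 := ht.2.le.trans hT1
    have hM : 0 ≤ (1 / (1 - r)) ^ 2 := by positivity
    have h3 : grad Φ (x + t • h) h ≤ |grad Φ x h| + (1 / (1 - r)) ^ 2 := by
      have := (abs_le.1 h1).2
      have := le_abs_self (grad Φ x h)
      nlinarith [ht.1]
    have h4 : 0 ≤ |grad Φ x h| + (1 / (1 - r)) ^ 2 := by positivity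
    nlinarith [ht.1, mul_le_mul_of_nonneg_left h3 ht.1, mul_le_mul_of_nonneg_right ht1 h4]
  have hfin := ((hΦ.tendsto_atTop _ hfr).comp htend).eventually_gt_atTop
    (Φ x + (|grad Φ x h| + (1 / (1 - r)) ^ 2))
  obtain ⟨t, ht, htT⟩ := (hfin.and (Ioo_mem_nhdsLT hTpos)).exists
  exact (hφ t ⟨htT.1.le, htT.2⟩).not_gt ht

theorem add_mem_of_hess_le_one (hcl : IsClosed C) {x h : V} (hx : x ∈ interior C)
    (hh : hess Φ x h h ≤ 1) : x + h ∈ C := by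
  have hcont : Continuous fun t : ℝ => x + t • h := by fun_prop
  have h1 : Tendsto (fun t : ℝ => x + t • h) (𝓝[<] 1) (𝓝 (x + (1 : ℝ) • h)) :=
    (hcont.tendsto 1).mono_left nhdsWithin_le_nhds
  rw [one_smul] at h1
  refine hcl.mem_of_tendsto h1 ?_
  filter_upwards [Ioo_mem_nhdsLT zero_lt_one] with t ht
  refine interior_subset (hΦ.add_mem_interior_of_hess_lt_one hx ?_)
  simp only [map_smul, smul_apply, smul_eq_mul]
  have := hΦ.hess_self_nonneg hx h
  have h3 : t * t < 1 := by nlinarith [ht.1, ht.2]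
  nlinarith

/-- A direction of zero local norm would put a whole line into the Dikin ellipsoid, hence into the
pointed cone. -/
theorem hess_pos (hC : IsRegularCone C) {x h : V} (hx : x ∈ interior C) (hh : h ≠ 0) :
    0 < hess Φ x h h := by
  refine lt_of_le_of_ne (hΦ.hess_self_nonneg hx h) fun h0 => hh ?_
  have hmem : ∀ t : ℝ, x + t • h ∈ C := by
    intro t
    refine interior_subset (hΦ.add_mem_interior_of_hess_lt_one hx ?_)
    simp [← h0]
  refine hC.pointed h (hC.mem_of_forall_add_smul_mem fun t _ => hmem t)
    (hC.mem_of_forall_add_smul_mem (x := x) fun t _ => ?_)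
  simpa using hmem (-t)

theorem grad_smul (hC : IsRegularCone C) {x : V} (hx : x ∈ interior C) {τ : ℝ} (hτ : 0 < τ) :
    grad Φ (τ • x) = τ⁻¹ • grad Φ x := by
  have h1 : HasFDerivAt (fun z : V => Φ (τ • z))
      ((grad Φ (τ • x)).comp (τ • ContinuousLinearMap.id ℝ V)) x :=
    (hΦ.hasFDerivAt (hC.smul_mem_interior hx hτ)).comp x
      ((hasFDerivAt_id x).const_smul τ)
  have h2 : HasFDerivAt (fun z : V => Φ z - ν * Real.log τ) (grad Φ x) x :=
    (hΦ.hasFDerivAt hx).sub_const _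
  have hev : (fun z : V => Φ (τ • z)) =ᶠ[𝓝 x] fun z => Φ z - ν * Real.log τ := by
    filter_upwards [isOpen_interior.mem_nhds hx] with z hz using hΦ.logHomogeneous z hz τ hτ
  have h3 := (h2.congr_of_eventuallyEq hev).unique h1
  rw [h3]
  ext u
  simp [hτ.ne']

theorem hess_smul (hC : IsRegularCone C) {x : V} (hx : x ∈ interior C) {τ : ℝ} (hτ : 0 < τ) :
    hess Φ (τ • x) = (τ⁻¹ ^ 2) • hess Φ x := by
  have h1 : HasFDerivAt (fun z : V => grad Φ (τ • z))
      ((hess Φ (τ • x)).comp (τ • ContinuousLinearMap.id ℝ V)) x :=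
    HasFDerivAt.comp x (hΦ.hasFDerivAt_grad (hC.smul_mem_interior hx hτ))
      ((hasFDerivAt_id x).const_smul τ)
  have h2 : HasFDerivAt (fun z : V => τ⁻¹ • grad Φ z) (τ⁻¹ • hess Φ x) x :=
    HasFDerivAt.const_smul (f := fun z => grad Φ z) (hΦ.hasFDerivAt_grad hx) τ⁻¹
  have hev : (fun z : V => grad Φ (τ • z)) =ᶠ[𝓝 x] fun z => τ⁻¹ • grad Φ z := by
    filter_upwards [isOpen_interior.mem_nhds hx] with z hz using hΦ.grad_smul hC hz hτ
  have h3 := (h2.congr_of_eventuallyEq hev).unique h1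
  rw [pow_two, mul_smul, h3]
  ext u w
  simp [hτ.ne']

theorem grad_self {x : V} (hx : x ∈ interior C) : grad Φ x x = -ν := by
  have h1 := hΦ.hasDerivAt_line (x := x) (h := x) (t := 0) (by simpa using hx)
  have h2 : HasDerivAt (fun t : ℝ => Φ x - ν * Real.log (1 + t)) (-ν) 0 := by
    have : HasDerivAt (fun t : ℝ => Real.log (1 + t)) (1 / (1 + 0)) 0 :=
      ((hasDerivAt_id (0 : ℝ)).const_add 1).log (by norm_num)
    simpa using (this.const_mul ν).const_sub (Φ x)
  have hev : (fun t : ℝ => Φ (x + t • x)) =ᶠ[𝓝 0] fun t => Φ x - ν * Real.log (1 + t) := by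
    filter_upwards [Ioi_mem_nhds (show (-1 : ℝ) < 0 by norm_num)] with t ht
    have : 0 < 1 + t := by linarith [mem_Ioi.1 ht]
    rw [← hΦ.logHomogeneous x hx _ this, add_smul, one_smul]
  simpa using h1.unique (h2.congr_of_eventuallyEq hev)

theorem hess_self (hC : IsRegularCone C) {x : V} (hx : x ∈ interior C) (u : V) :
    hess Φ x x u = -grad Φ x u := by
  have h1 := hΦ.hasDerivAt_grad_line (x := x) (h := x) u (t := 0) (by simpa using hx)
  have h2 : HasDerivAt (fun t : ℝ => (1 + t)⁻¹ * grad Φ x u) (-grad Φ x u) 0 := by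
    have : HasDerivAt (fun t : ℝ => (1 + t)⁻¹) (-1 / (1 + 0) ^ 2) 0 :=
      ((hasDerivAt_id (0 : ℝ)).const_add 1).inv (by norm_num)
    simpa using this.mul_const (grad Φ x u)
  have hev : (fun t : ℝ => grad Φ (x + t • x) u) =ᶠ[𝓝 0] fun t => (1 + t)⁻¹ * grad Φ x u := by
    filter_upwards [Ioi_mem_nhds (show (-1 : ℝ) < 0 by norm_num)] with t ht
    have : 0 < 1 + t := by linarith [mem_Ioi.1 ht]
    have h := hΦ.grad_smul hC hx this
    rw [add_smul, one_smul] at h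
    rw [h]
    simp
  simpa using h1.unique (h2.congr_of_eventuallyEq hev)

theorem hess_self_self (hC : IsRegularCone C) {x : V} (hx : x ∈ interior C) :
    hess Φ x x x = ν := by
  rw [hΦ.hess_self hC hx, hΦ.grad_self hx, neg_neg]

theorem parameter_nonneg (hC : IsRegularCone C) : 0 ≤ ν := by
  obtain ⟨x, hx⟩ := hC.nonempty_interior
  rw [← hΦ.hess_self_self hC hx]
  exact hΦ.hess_self_nonneg hx x

theorem third_self (hC : IsRegularCone C) {x : V} (hx : x ∈ interior C) :
    third Φ x x x x = -(2 * ν) := by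
  have h1 := hΦ.hasDerivAt_hess_line (x := x) (h := x) x x (t := 0) (by simpa using hx)
  have h2 : HasDerivAt (fun t : ℝ => (1 + t)⁻¹ ^ 2 * ν) (-(2 * ν)) 0 := by
    have : HasDerivAt (fun t : ℝ => (1 + t)⁻¹) (-1 / (1 + 0) ^ 2) 0 :=
      ((hasDerivAt_id (0 : ℝ)).const_add 1).inv (by norm_num)
    simpa using (this.pow 2).mul_const ν
  have hev : (fun t : ℝ => hess Φ (x + t • x) x x) =ᶠ[𝓝 0] fun t => (1 + t)⁻¹ ^ 2 * ν := by
    filter_upwards [Ioi_mem_nhds (show (-1 : ℝ) < 0 by norm_num)] with t ht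
    have : 0 < 1 + t := by linarith [mem_Ioi.1 ht]
    have h := hΦ.hess_smul hC hx this
    rw [add_smul, one_smul] at h
    rw [h, ← hΦ.hess_self_self hC hx]
    simp
  simpa using h1.unique (h2.congr_of_eventuallyEq hev)

/-- Self-concordance at `x` in the direction `x` reads `2ν ≤ 2ν^(3/2)`. -/
theorem one_le_parameter [Nontrivial V] (hC : IsRegularCone C) : 1 ≤ ν := by
  obtain ⟨x, hx⟩ := hC.nonempty_interior
  have hx0 : x ≠ 0 := by
    -- If `0` were interior, the cone would be the whole space, which is not pointed.
    rintro rfl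
    obtain ⟨u, hu⟩ := exists_ne (0 : V)
    obtain ⟨c, -, hc⟩ := hC.exists_smul_sub_mem hx u
    obtain ⟨c', -, hc'⟩ := hC.exists_smul_sub_mem hx (-u)
    simp only [smul_zero, zero_sub, neg_neg] at hc hc'
    exact hu (hC.pointed u hc' hc)
  have hν : 0 < ν := by
    rw [← hΦ.hess_self_self hC hx]
    exact hΦ.hess_pos hC hx hx0
  have h1 := hΦ.selfConcordant x hx x
  rw [hΦ.third_self hC hx, hΦ.hess_self_self hC hx, abs_neg, abs_of_pos (by positivity)] at h1
  by_contra hlt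
  have h2 : ν ^ (3 / 2 : ℝ) < ν ^ (1 : ℝ) :=
    Real.rpow_lt_rpow_of_exponent_gt hν (by linarith) (by norm_num)
  rw [Real.rpow_one] at h2
  linarith

theorem grad_nonpos (hC : IsRegularCone C) {x h : V} (hx : x ∈ interior C) (hh : h ∈ C) :
    grad Φ x h ≤ 0 := by
  have hν := hΦ.parameter_nonneg hC
  have hint : ∀ z ∈ interior C, grad Φ x z ≤ 0 := by
    intro z hz
    by_contra! hpos
    -- Convexity between `x` and `τ z`: homogeneity makes `Φ(τ z)` nonincreasing for `τ ≥ 1`, so the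
    -- linear term cannot grow with `τ`.
    have key : ∀ τ : ℝ, 1 ≤ τ → τ * grad Φ x z ≤ Φ z - Φ x - ν := by
      intro τ hτ
      have h1 := hΦ.add_grad_le hx (hC.smul_mem_interior hz (by linarith : 0 < τ))
      rw [hΦ.logHomogeneous z hz τ (by linarith), map_sub, map_smul, smul_eq_mul,
        hΦ.grad_self hx] at h1
      have := mul_nonneg hν (Real.log_nonneg hτ)
      linarith
    have h1 := key (max 1 ((Φ z - Φ x - ν + 1) / grad Φ x z)) (le_max_left _ _)
    have h2 := mul_le_mul_of_nonneg_right
      (le_max_right 1 ((Φ z - Φ x - ν + 1) / grad Φ x z)) hpos.le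
    rw [div_mul_cancel₀ _ hpos.ne'] at h2
    linarith
  have hε : ∀ ε : ℝ, 0 < ε → grad Φ x h ≤ 0 + ε * ν := by
    intro ε hε
    have := hint (ε • x + h) (hC.add_mem_interior (hC.smul_mem_interior hx hε) hh)
    rw [map_add, map_smul, smul_eq_mul, hΦ.grad_self hx] at this
    linarith
  by_contra! hpos
  have := hε (grad Φ x h / (ν + 1)) (by positivity)
  rw [zero_add, div_mul_eq_mul_div, le_div_iff₀ (by positivity)] at this
  nlinarith

/-- Integrates the lower bound `(r / (1 + t r))²` for the Hessian along the line, whose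
antiderivative is `-r / (1 + t r)`. -/
theorem le_grad_line_sub {x h : V} {T : ℝ} (hT : 0 ≤ T)
    (hl : ∀ t ∈ Icc 0 T, x + t • h ∈ interior C) :
    √(hess Φ x h h) - √(hess Φ x h h) / (1 + T * √(hess Φ x h h)) ≤
      grad Φ (x + T • h) h - grad Φ x h := by
  set r := √(hess Φ x h h) with hr
  have hr0 : 0 ≤ r := Real.sqrt_nonneg _
  have hpos : ∀ t ∈ Icc 0 T, 0 < 1 + t * r := fun t ht => by
    have := mul_nonneg ht.1 hr0
    linarith
  have := le_of_hasDerivAt_nonpos hT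
    (f := fun t => -r / (1 + t * r) - grad Φ (x + t • h) h)
    (f' := fun t => r ^ 2 / (1 + t * r) ^ 2 - hess Φ (x + t • h) h h) ?_ ?_
  · simp at this
    rw [neg_div] at this
    linarith
  · intro t ht
    refine HasDerivAt.sub ?_ (hΦ.hasDerivAt_grad_line h (hl t ht))
    have h1 : HasDerivAt (fun t : ℝ => 1 + t * r) r t := by
      simpa using ((hasDerivAt_id t).mul_const r).const_add 1
    have h2 := (hasDerivAt_const t (-r)).div h1 (hpos t ht).ne'
    refine h2.congr_deriv ?_
    congr 1
    ring
  · intro t ht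
    have h1 := (hΦ.sqrt_hess_line ht.1 (fun τ hτ => hl τ ⟨hτ.1, hτ.2.trans ht.2⟩)).1
    rw [← hr] at h1
    have h2 : r / (1 + t * r) ≤ √(hess Φ (x + t • h) h h) := (div_le_iff₀ (hpos t ht)).2 h1
    have h3 : (r / (1 + t * r)) ^ 2 ≤ √(hess Φ (x + t • h) h h) ^ 2 := by
      have := hpos t ht
      gcongr
    rw [Real.sq_sqrt (hΦ.hess_self_nonneg (hl t ht) h), div_pow] at h3
    linarith

/-- A cone direction can be followed forever while the directional derivative stays nonpositive.
Letting `T → ∞` in `le_grad_line_sub`, the derivative must already be at most `-r` at the start. -/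
theorem sqrt_hess_le_neg_grad (hC : IsRegularCone C) {x h : V} (hx : x ∈ interior C)
    (hh : h ∈ C) : √(hess Φ x h h) ≤ -grad Φ x h := by
  set r := √(hess Φ x h h) with hr
  have hr0 : 0 ≤ r := Real.sqrt_nonneg _
  have key : ∀ T : ℝ, 0 ≤ T → r - r / (1 + T * r) ≤ -grad Φ x h := by
    intro T hT
    have h1 := hΦ.le_grad_line_sub hT (fun t ht => hC.line_mem_interior hx hh ht.1)
    have h2 := hΦ.grad_nonpos hC (hC.line_mem_interior hx hh hT) hh
    linarith
  rcases hr0.eq_or_lt with h0 | hpos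
  · rw [← h0]
    linarith [hΦ.grad_nonpos hC hx hh]
  · have hlim : Tendsto (fun T : ℝ => r - r / (1 + T * r)) atTop (𝓝 (r - 0)) := by
      refine tendsto_const_nhds.sub (Tendsto.div_atTop tendsto_const_nhds ?_)
      exact tendsto_atTop_add_const_left _ _ (tendsto_id.atTop_mul_const hpos)
    rw [sub_zero] at hlim
    exact le_of_tendsto hlim ((eventually_ge_atTop 0).mono key)

theorem div_le_grad_sub (hC : IsRegularCone C) {x x' : V} (hx : x ∈ interior C)
    (hx' : x' ∈ interior C) :
    hess Φ x (x' - x) (x' - x) / (1 + √(hess Φ x (x' - x) (x' - x))) ≤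
      grad Φ x' (x' - x) - grad Φ x (x' - x) := by
  have h1 := hΦ.le_grad_line_sub zero_le_one (fun t ht => hC.segment_mem_interior hx hx' ht)
  simp only [one_mul, one_smul, add_sub_cancel] at h1
  refine le_trans (le_of_eq ?_) h1
  have h2 := Real.sq_sqrt (hΦ.hess_self_nonneg hx (x' - x))
  have h3 := Real.sqrt_nonneg (hess Φ x (x' - x) (x' - x))
  nth_rw 1 [← h2]
  field_simp
  ring

theorem grad_injOn (hC : IsRegularCone C) : InjOn (grad Φ) (interior C) := by
  intro x hx x' hx' heq
  have h1 := hΦ.div_le_grad_sub hC hx hx'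
  rw [heq, sub_self] at h1
  by_contra hne
  have h2 := hΦ.hess_pos hC hx (sub_ne_zero.2 (Ne.symm hne))
  have h3 : 0 < hess Φ x (x' - x) (x' - x) / (1 + √(hess Φ x (x' - x) (x' - x))) := by positivity
  linarith

section NegativeCurvature

variable (hC : IsRegularCone C) (hN : HasNegativeCurvature C Φ)
include hC hN

theorem hess_add_le {x h : V} (hx : x ∈ interior C) (hh : h ∈ C) (u : V) :
    hess Φ (x + h) u u ≤ hess Φ x u u := by
  have := le_of_hasDerivAt_nonpos zero_le_one
    (f := fun t => hess Φ (x + t • h) u u) (f' := fun t => third Φ (x + t • h) h u u)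
    (fun t ht => hΦ.hasDerivAt_hess_line u u (hC.line_mem_interior hx hh ht.1))
    (fun t ht => hN _ (hC.line_mem_interior hx hh ht.1) h hh u)
  simpa using this

/-- Adding the cone element `ρ x - x'` to `x'` gives `ρ x`; antitonicity of the Hessian and its
homogeneity of degree `-2` do the rest. All later comparisons of local norms come from here. -/
theorem hess_le_of_smul_sub_mem {x x' : V} (hx : x ∈ interior C) (hx' : x' ∈ interior C) {ρ : ℝ}
    (hρ : 0 < ρ) (h : ρ • x - x' ∈ C) (u : V) : hess Φ x u u ≤ ρ ^ 2 * hess Φ x' u u := by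
  have h1 := hΦ.hess_add_le hC hN hx' h u
  rw [add_sub_cancel, hΦ.hess_smul hC hx hρ] at h1
  simp only [smul_apply, smul_eq_mul, inv_pow] at h1
  rwa [inv_mul_le_iff₀ (by positivity)] at h1

/-- The partial derivatives `⟨∇Φ, u⟩`, `u ∈ C`, are concave. -/
theorem grad_le_add_hess {x x' u : V} (hx : x ∈ interior C) (hx' : x' ∈ interior C) (hu : u ∈ C) :
    grad Φ x' u ≤ grad Φ x u + hess Φ x (x' - x) u := by
  set h := x' - x with hh
  have hl : ∀ t ∈ Icc (0 : ℝ) 1, x + t • h ∈ interior C := fun t ht =>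
    hC.segment_mem_interior hx hx' ht
  have h1 : ∀ t ∈ Icc (0 : ℝ) 1, hess Φ (x + t • h) h u ≤ hess Φ x h u := by
    intro t ht
    have := le_of_hasDerivAt_nonpos ht.1
      (f := fun t => hess Φ (x + t • h) h u) (f' := fun t => third Φ (x + t • h) h h u)
      (fun τ hτ => hΦ.hasDerivAt_hess_line h u (hl τ ⟨hτ.1, hτ.2.trans ht.2⟩))
      (fun τ hτ => by
        have hm := hl τ ⟨hτ.1, hτ.2.trans ht.2⟩
        -- Symmetry of the third differential moves the cone direction `u` to the front, where
        -- negative curvature applies.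
        rw [hΦ.third_swap_right hm, hΦ.third_swap_left hm]
        exact hN _ hm u hu h)
    simpa using this
  have := le_of_hasDerivAt_nonpos zero_le_one
    (f := fun t => grad Φ (x + t • h) u - t * hess Φ x h u)
    (f' := fun t => hess Φ (x + t • h) h u - 1 * hess Φ x h u)
    (fun t ht => (hΦ.hasDerivAt_grad_line u (hl t ht)).sub ((hasDerivAt_id t).mul_const _))
    (fun t ht => by linarith [h1 t ht])
  simp only [one_smul, one_mul, zero_smul, add_zero, zero_mul, sub_zero] at this
  rw [hh, add_sub_cancel, ← hh] at this
  linarith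

/-- Along the ray `x + τ h` the function `⟨∇Φ, u⟩` is concave but bounded below by `-cν`, with `c x
- u ∈ C`. Its initial slope therefore cannot be negative. -/
theorem hess_nonneg_of_mem {x h u : V} (hx : x ∈ interior C) (hh : h ∈ C) (hu : u ∈ C) :
    0 ≤ hess Φ x h u := by
  obtain ⟨c, hc, hcu⟩ := hC.exists_smul_sub_mem hx u
  have key : ∀ τ : ℝ, 0 < τ → -(c * ν) - grad Φ x u ≤ τ * hess Φ x h u := by
    intro τ hτ
    have hm := hC.line_mem_interior hx hh hτ.le
    have h1 := hΦ.grad_le_add_hess hC hN hx hm hu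
    rw [add_sub_cancel_left, map_smul, smul_apply, smul_eq_mul] at h1
    have h2 : c • (x + τ • h) - u ∈ C := by
      have := hC.add_mem hcu (hC.smul_mem _ (hC.smul_mem h hh τ hτ.le) c hc.le)
      convert this using 1
      module
    have h3 := hΦ.grad_nonpos hC hm h2
    rw [map_sub, map_smul, hΦ.grad_self hm, smul_eq_mul] at h3
    linarith
  by_contra! hneg
  have h1 := key ((|-(c * ν) - grad Φ x u| + 1) / -hess Φ x h u)
    (div_pos (by positivity) (by linarith))
  have h2 : (|-(c * ν) - grad Φ x u| + 1) / -hess Φ x h u * hess Φ x h u =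
      -(|-(c * ν) - grad Φ x u| + 1) := by
    rw [div_neg, neg_mul, div_mul_cancel₀ _ hneg.ne]
  rw [h2] at h1
  linarith [neg_abs_le (-(c * ν) - grad Φ x u)]

theorem grad_le_grad_add {x h u : V} (hx : x ∈ interior C) (hh : h ∈ C) (hu : u ∈ C) :
    grad Φ x u ≤ grad Φ (x + h) u := by
  have := le_of_hasDerivAt_nonpos zero_le_one
    (f := fun t => -grad Φ (x + t • h) u) (f' := fun t => -hess Φ (x + t • h) h u)
    (fun t ht => (hΦ.hasDerivAt_grad_line u (hC.line_mem_interior hx hh ht.1)).neg)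
    (fun t ht => by
      linarith [hΦ.hess_nonneg_of_mem hC hN (hC.line_mem_interior hx hh ht.1) hh hu])
  simp at this
  linarith

end NegativeCurvature

end IsNormalBarrier

end Barrier

/-! ### Primal and dual norms of a positive definite operator. -/

section PosDef

variable {V : Type*} [NormedAddCommGroup V] [NormedSpace ℝ V]

/-- Self-adjoint positive definite operators `V → V*`. -/
structure IsPosDef (B : V →L[ℝ] StrongDual ℝ V) : Prop where
  symm : ∀ u w, B u w = B w u
  pos : ∀ u, u ≠ 0 → 0 < B u u

theorem opNorm_nonneg (B : V →L[ℝ] StrongDual ℝ V) (h : V) : 0 ≤ opNorm B h :=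
  Real.sqrt_nonneg _

theorem opDualNorm_nonneg (B : V →L[ℝ] StrongDual ℝ V) (s : StrongDual ℝ V) :
    0 ≤ opDualNorm B s :=
  Real.sqrt_nonneg _

theorem opNorm_smul (B : V →L[ℝ] StrongDual ℝ V) (t : ℝ) (h : V) :
    opNorm B (t • h) = |t| * opNorm B h := by
  simp only [opNorm, map_smul, smul_apply, smul_eq_mul]
  rw [← mul_assoc, Real.sqrt_mul (mul_self_nonneg t), Real.sqrt_mul_self_eq_abs]

theorem opNorm_neg (B : V →L[ℝ] StrongDual ℝ V) (h : V) : opNorm B (-h) = opNorm B h := by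
  simp [opNorm]

theorem isInvertible_of_injective [FiniteDimensional ℝ V] {B : V →L[ℝ] StrongDual ℝ V}
    (hB : Function.Injective B) : B.IsInvertible := by
  have hrank : Module.finrank ℝ V = Module.finrank ℝ (StrongDual ℝ V) := by
    rw [← (LinearMap.toContinuousLinearMap : (V →ₗ[ℝ] ℝ) ≃ₗ[ℝ] (V →L[ℝ] ℝ)).finrank_eq]
    exact (Subspace.dual_finrank_eq (K := ℝ) (V := V)).symm
  let e : V ≃ₗ[ℝ] StrongDual ℝ V := LinearEquiv.ofInjectiveOfFinrankEq (B : V →ₗ[ℝ] StrongDual ℝ V) hB hrank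
  exact ⟨e.toContinuousLinearEquiv, by ext x y; rfl⟩

namespace IsPosDef

variable {B : V →L[ℝ] StrongDual ℝ V} (hB : IsPosDef B)
include hB

theorem nonneg (u : V) : 0 ≤ B u u := by
  by_cases h : u = 0
  · simp [h]
  · exact (hB.pos u h).le

theorem sq_opNorm (u : V) : opNorm B u ^ 2 = B u u := Real.sq_sqrt (hB.nonneg u)

theorem opNorm_pos {u : V} (hu : u ≠ 0) : 0 < opNorm B u := Real.sqrt_pos.2 (hB.pos u hu)

theorem cauchy_schwarz (u w : V) : |B u w| ≤ opNorm B u * opNorm B w := by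
  have hu := hB.nonneg u
  rw [opNorm, opNorm, ← Real.sqrt_mul hu]
  refine Real.le_sqrt_of_sq_le ?_
  rw [sq_abs]
  have key : ∀ t : ℝ, 0 ≤ B w w * (t * t) + 2 * B u w * t + B u u := by
    intro t
    have := hB.nonneg (u + t • w)
    simp only [map_add, map_smul, add_apply, smul_apply, smul_eq_mul, hB.symm w u] at this
    linarith
  have := discrim_le_zero key
  rw [discrim] at this
  linarith

theorem opNorm_add_le (u w : V) : opNorm B (u + w) ≤ opNorm B u + opNorm B w := by
  refine Real.sqrt_le_iff.2 ⟨add_nonneg (opNorm_nonneg _ _) (opNorm_nonneg _ _), ?_⟩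
  have h1 := (abs_le.1 (hB.cauchy_schwarz u w)).2
  have h2 := hB.sq_opNorm u
  have h3 := hB.sq_opNorm w
  simp only [map_add, add_apply, hB.symm w u]
  nlinarith

variable [FiniteDimensional ℝ V]

theorem isInvertible : B.IsInvertible := by
  refine isInvertible_of_injective ((injective_iff_map_eq_zero B).2 fun u hu => ?_)
  by_contra h
  have := hB.pos u h
  simp [hu] at this

theorem apply_inverse (s : StrongDual ℝ V) : B (B.inverse s) = s :=
  hB.isInvertible.self_apply_inverse s

theorem opDualNorm_eq (s : StrongDual ℝ V) : opDualNorm B s = opNorm B (B.inverse s) := by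
  rw [opDualNorm, opNorm, hB.apply_inverse]

theorem opDualNorm_apply (u : V) : opDualNorm B (B u) = opNorm B u := by
  rw [hB.opDualNorm_eq, hB.isInvertible.inverse_apply_self]

theorem abs_apply_le (s : StrongDual ℝ V) (h : V) : |s h| ≤ opDualNorm B s * opNorm B h := by
  have := hB.cauchy_schwarz (B.inverse s) h
  rwa [hB.apply_inverse, ← hB.opDualNorm_eq] at this

/-- It suffices to test at `u = B⁻¹ s`, where the dual norm is attained. -/
theorem opDualNorm_le {s : StrongDual ℝ V} {M : ℝ} (hM : 0 ≤ M)
    (h : ∀ u, s u ≤ M * opNorm B u) : opDualNorm B s ≤ M := by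
  have h1 := h (B.inverse s)
  have h2 := hB.sq_opNorm (B.inverse s)
  rw [hB.apply_inverse, ← hB.opDualNorm_eq] at h2
  rw [← hB.opDualNorm_eq, ← h2] at h1
  have h3 := opDualNorm_nonneg B s
  rcases h3.eq_or_lt with h0 | hpos
  · rwa [← h0]
  · nlinarith

theorem opDualNorm_add_le (s t : StrongDual ℝ V) :
    opDualNorm B (s + t) ≤ opDualNorm B s + opDualNorm B t := by
  simp only [hB.opDualNorm_eq, map_add]
  exact hB.opNorm_add_le _ _

theorem opDualNorm_smul (c : ℝ) (s : StrongDual ℝ V) :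
    opDualNorm B (c • s) = |c| * opDualNorm B s := by
  simp only [hB.opDualNorm_eq, map_smul]
  exact opNorm_smul _ _ _

end IsPosDef

theorem IsNormalBarrier.isPosDef_hess {C : Set V} {Φ : V → ℝ} {ν : ℝ}
    (hΦ : IsNormalBarrier C Φ ν) (hC : IsRegularCone C) {x : V} (hx : x ∈ interior C) :
    IsPosDef (hess Φ x) :=
  ⟨hΦ.hess_symm hx, fun _ hu => hΦ.hess_pos hC hx hu⟩

end PosDef

/-! ### Dual cones, and attainment of minima of a linear functional plus a barrier. -/

section Dual

variable {V : Type*} [NormedAddCommGroup V] [NormedSpace ℝ V]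

/-- The dual cone of a set. -/
def coneDual (C : Set V) : Set (StrongDual ℝ V) :=
  {s | ∀ x ∈ C, 0 ≤ s x}

/-- The conjugate barrier `s ↦ max {-⟨s, x⟩ - F(x) : x ∈ int C}`. -/
noncomputable def conjBarrier (C : Set V) (F : V → ℝ) (s : StrongDual ℝ V) : ℝ :=
  sSup ((fun x : V => -(s x) - F x) '' interior C)

theorem isClosed_coneDual (C : Set V) : IsClosed (coneDual C) := by
  have : coneDual C = ⋂ x ∈ C, {s : StrongDual ℝ V | 0 ≤ s x} := by
    ext s
    simp [coneDual]
  rw [this]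
  exact isClosed_biInter fun x _ => isClosed_le continuous_const (by fun_prop)

theorem convex_coneDual (C : Set V) : Convex ℝ (coneDual C) := by
  intro s hs t ht a b ha hb _ x hx
  have h1 := mul_nonneg ha (hs x hx)
  have h2 := mul_nonneg hb (ht x hx)
  simpa using add_nonneg h1 h2

theorem exists_mul_norm_le_of_mem_interior {C : Set V} {s : StrongDual ℝ V}
    (hs : s ∈ interior (coneDual C)) : ∃ δ : ℝ, 0 < δ ∧ ∀ h ∈ C, δ * ‖h‖ ≤ s h := by
  obtain ⟨ε, hε, hball⟩ := Metric.isOpen_iff.1 isOpen_interior s hs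
  refine ⟨ε / 2, by positivity, fun h hh => ?_⟩
  -- Moving `s` a distance `ε / 2` against a norming functional of `h` stays in the dual cone.
  obtain ⟨g, hg1, hg2⟩ := exists_dual_vector'' ℝ h
  have hmem : s - (ε / 2) • g ∈ Metric.ball s ε := by
    rw [mem_ball_iff_norm, sub_sub_cancel_left, norm_neg, norm_smul, Real.norm_eq_abs,
      abs_of_pos (by positivity)]
    nlinarith
  have := interior_subset (hball hmem) h hh
  simp only [sub_apply, smul_apply, smul_eq_mul, hg2] at this
  simpa using this

/-- The bipolar theorem for regular cones. -/
theorem IsRegularCone.mem_of_forall_coneDual {C : Set V} (hC : IsRegularCone C) {x : V}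
    (hx : ∀ s ∈ coneDual C, 0 ≤ s x) : x ∈ C := by
  by_contra hxC
  obtain ⟨f, u, hu, hux⟩ := geometric_hahn_banach_closed_point hC.convex hC.isClosed hxC
  have hu0 : 0 < u := by simpa using hu 0 hC.zero_mem
  have hf : -f ∈ coneDual C := by
    intro z hz
    rw [neg_apply, Left.nonneg_neg_iff]
    by_contra! hpos
    have := hu _ (hC.smul_mem z hz (u / f z) (by positivity))
    rw [map_smul, smul_eq_mul, div_mul_cancel₀ _ hpos.ne'] at this
    exact lt_irrefl _ this
  have := hx _ hf
  rw [neg_apply] at this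
  linarith

variable [FiniteDimensional ℝ V]

namespace IsRegularCone

variable {C : Set V} (hC : IsRegularCone C)
include hC

/-- By compactness `s` is bounded below by some `δ > 0` on the unit vectors of the cone, so a
perturbation of norm less than `δ` is harmless. -/
theorem mem_interior_coneDual {s : StrongDual ℝ V} (hs : ∀ h ∈ C, h ≠ 0 → 0 < s h) :
    s ∈ interior (coneDual C) := by
  have hcomp : IsCompact (C ∩ Metric.sphere 0 1) := (isCompact_sphere 0 1).inter_left hC.isClosed
  obtain ⟨δ, hδ, hmin⟩ : ∃ δ : ℝ, 0 < δ ∧ ∀ h ∈ C ∩ Metric.sphere (0 : V) 1, δ ≤ s h := by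
    rcases (C ∩ Metric.sphere (0 : V) 1).eq_empty_or_nonempty with he | hne
    · exact ⟨1, one_pos, by simp [he]⟩
    · obtain ⟨h, hh, hm⟩ := hcomp.exists_isMinOn hne s.continuous.continuousOn
      refine ⟨s h, hs h hh.1 ?_, fun h' hh' => hm hh'⟩
      rintro rfl
      simpa using hh.2
  refine mem_interior.2 ⟨Metric.ball s δ, fun t ht x hx => ?_, Metric.isOpen_ball,
    Metric.mem_ball_self hδ⟩
  by_cases hx0 : x = 0
  · simp [hx0]
  have hn : 0 < ‖x‖ := norm_pos_iff.2 hx0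
  have h1 := hmin (‖x‖⁻¹ • x) ⟨hC.smul_mem x hx _ (inv_nonneg.2 hn.le), by
    simp [norm_smul, hn.ne']⟩
  rw [map_smul, smul_eq_mul, inv_mul_eq_div, le_div_iff₀ hn] at h1
  have h2 : |(t - s) x| ≤ ‖t - s‖ * ‖x‖ := (t - s).le_opNorm x
  rw [mem_ball_iff_norm] at ht
  have h3 := (abs_le.1 h2).1
  rw [sub_apply] at h3
  nlinarith

end IsRegularCone

namespace IsNormalBarrier

variable {C : Set V} {F : V → ℝ} {ν : ℝ} (hF : IsNormalBarrier C F ν) (hC : IsRegularCone C)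
include hF hC

theorem neg_grad_mem_interior_coneDual {x : V} (hx : x ∈ interior C) :
    -grad F x ∈ interior (coneDual C) := by
  refine hC.mem_interior_coneDual fun h hh h0 => ?_
  exact (Real.sqrt_pos.2 (hF.hess_pos hC hx h0)).trans_le (hF.sqrt_hess_le_neg_grad hC hx hh)

theorem isRegularCone_coneDual : IsRegularCone (coneDual C) where
  isClosed := isClosed_coneDual C
  convex := convex_coneDual C
  smul_mem s hs t ht x hx := by simpa using mul_nonneg ht (hs x hx)
  pointed s hs hs' := by
    have h0 : ∀ x ∈ C, s x = 0 := fun x hx => by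
      have h1 := hs x hx
      have h2 := hs' x hx
      rw [neg_apply] at h2
      linarith
    obtain ⟨x, hx⟩ := hC.nonempty_interior
    ext u
    obtain ⟨c, hc, hcu⟩ := hC.exists_smul_sub_mem hx u
    have := h0 _ hcu
    rw [map_sub, map_smul, h0 x (interior_subset hx)] at this
    simpa using this
  nonempty_interior := by
    obtain ⟨x, hx⟩ := hC.nonempty_interior
    exact ⟨_, hF.neg_grad_mem_interior_coneDual hC hx⟩

/-- Interior dual functionals make the objective coercive, and the barrier keeps sublevel sets away
from the boundary, so they are compact. It is used with `L` the whole space for the conjugate and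
with `L = {A x = b}` for the central path. -/
theorem exists_isMin_of_isClosed {s : StrongDual ℝ V} (hs : s ∈ interior (coneDual C)) {L : Set V}
    (hL : IsClosed L) (hne : (L ∩ interior C).Nonempty) :
    ∃ x ∈ L ∩ interior C, ∀ z ∈ L ∩ interior C, s x + F x ≤ s z + F z := by
  obtain ⟨δ, hδ, hle⟩ := exists_mul_norm_le_of_mem_interior hs
  obtain ⟨x₀, hx₀⟩ := hne
  -- The tangent inequality at `x₀` is applied to `R⁻¹ z` instead of `z`. This costs only the
  -- constant `ν log R` and shrinks the slope to at most `δ / 2`, half of the growth of `s`.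
  set R : ℝ := max 1 (2 * ‖grad F x₀‖ / δ) with hR
  have hR1 : 0 < R := lt_of_lt_of_le one_pos (le_max_left _ _)
  set m : ℝ := F x₀ + ν - ν * Real.log R with hm
  have hco : ∀ z ∈ interior C, m + δ / 2 * ‖z‖ ≤ s z + F z := by
    intro z hz
    have h1 := hF.add_grad_le hx₀.2 (hC.smul_mem_interior hz (inv_pos.2 hR1))
    rw [hF.logHomogeneous z hz _ (inv_pos.2 hR1), Real.log_inv, map_sub, map_smul,
      hF.grad_self hx₀.2, smul_eq_mul] at h1
    have h2 := neg_abs_le (grad F x₀ z)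
    have h3 : |grad F x₀ z| ≤ ‖grad F x₀‖ * ‖z‖ := (grad F x₀).le_opNorm z
    have h4 : R⁻¹ * ‖grad F x₀‖ ≤ δ / 2 := by
      rw [inv_mul_le_iff₀ hR1]
      have := le_max_right 1 (2 * ‖grad F x₀‖ / δ)
      rw [← hR, div_le_iff₀ hδ] at this
      linarith
    have h5 : -(δ / 2 * ‖z‖) ≤ R⁻¹ * grad F x₀ z := by
      have h6 : R⁻¹ * (-grad F x₀ z) ≤ R⁻¹ * (‖grad F x₀‖ * ‖z‖) :=
        mul_le_mul_of_nonneg_left (by linarith) (inv_nonneg.2 hR1.le)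
      have h7 := mul_le_mul_of_nonneg_right h4 (norm_nonneg z)
      linarith
    have h8 := hle z (interior_subset hz)
    linarith
  set S : Set V := {z | z ∈ L ∩ interior C ∧ s z + F z ≤ s x₀ + F x₀} with hS
  have hbdd : Bornology.IsBounded S := by
    refine (Metric.isBounded_closedBall (x := (0 : V))
      (r := (s x₀ + F x₀ - m) / (δ / 2))).subset fun z hz => ?_
    rw [mem_closedBall_zero_iff, le_div_iff₀ (by positivity)]
    linarith [hco z hz.1.2, hz.2]
  have hclosed : IsClosed S := by
    refine isClosed_of_closure_subset fun z hz => ?_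
    have hzL : z ∈ L := hL.closure_subset (closure_mono (fun w hw => hw.1.1) hz)
    have hzC : z ∈ C := hC.isClosed.closure_subset
      (closure_mono (fun w hw => interior_subset hw.1.2) hz)
    have : (𝓝[S] z).NeBot := mem_closure_iff_nhdsWithin_neBot.1 hz
    by_cases hzi : z ∈ interior C
    · refine ⟨⟨hzL, hzi⟩, ?_⟩
      have h1 : Tendsto (fun w => s w + F w) (𝓝[S] z) (𝓝 (s z + F z)) :=
        (s.continuous.continuousAt.add (hF.hasFDerivAt hzi).continuousAt).tendsto.mono_left
          nhdsWithin_le_nhds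
      refine le_of_tendsto h1 ?_
      filter_upwards [self_mem_nhdsWithin] with w hw using hw.2
    · exfalso
      have h1 := (hF.tendsto_atTop z ⟨subset_closure hzC, hzi⟩).mono_left
        (nhdsWithin_mono z (fun w (hw : w ∈ S) => hw.1.2))
      obtain ⟨w, hw, hwS⟩ := ((h1.eventually_gt_atTop (s x₀ + F x₀)).and
        self_mem_nhdsWithin).exists
      have h2 := hle w (interior_subset hwS.1.2)
      have h3 : 0 ≤ δ * ‖w‖ := by positivity
      linarith [hwS.2]
  have hcomp : IsCompact S := Metric.isCompact_of_isClosed_isBounded hclosed hbdd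
  obtain ⟨x, hx, hmin⟩ := hcomp.exists_isMinOn ⟨x₀, hx₀, le_rfl⟩
    (f := fun z => s z + F z) (fun z hz => (s.continuous.continuousAt.add
      (hF.hasFDerivAt hz.1.2).continuousAt).continuousWithinAt)
  refine ⟨x, hx.1, fun z hz => ?_⟩
  by_cases hzS : s z + F z ≤ s x₀ + F x₀
  · exact hmin ⟨hz, hzS⟩
  · exact hx.2.trans (not_le.1 hzS).le

theorem exists_grad_eq_neg {s : StrongDual ℝ V} (hs : s ∈ interior (coneDual C)) :
    ∃ x ∈ interior C, grad F x = -s := by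
  obtain ⟨x, hx, hmin⟩ := hF.exists_isMin_of_isClosed hC hs isClosed_univ
    (by simpa using hC.nonempty_interior)
  refine ⟨x, hx.2, ?_⟩
  have hloc : IsLocalMin (fun z => s z + F z) x := by
    filter_upwards [isOpen_interior.mem_nhds hx.2] with z hz using hmin z ⟨mem_univ z, hz⟩
  have := hloc.hasFDerivAt_eq_zero (s.hasFDerivAt.add (hF.hasFDerivAt hx.2))
  exact (neg_eq_of_add_eq_zero_right this).symm

end IsNormalBarrier

end Dual

/-! ### The conjugate barrier is a normal barrier for the dual cone. -/

section Conjugate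

variable {V : Type*} [NormedAddCommGroup V] [NormedSpace ℝ V]

/-- The point `x ∈ int C` with `∇F(x) = -s`. -/
noncomputable def gradInv (C : Set V) (F : V → ℝ) (s : StrongDual ℝ V) : V :=
  Classical.epsilon fun x => x ∈ interior C ∧ grad F x = -s

/-- The map `x ↦ (s ↦ -⟨s, x⟩)` from `V` to its bidual. -/
noncomputable def negEval (V : Type*) [NormedAddCommGroup V] [NormedSpace ℝ V] :
    V →L[ℝ] StrongDual ℝ (StrongDual ℝ V) :=
  -(NormedSpace.inclusionInDoubleDual ℝ V)

@[simp]
theorem negEval_apply (x : V) (s : StrongDual ℝ V) : negEval V x s = -(s x) :=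
  rfl

theorem hasFDerivAt_clm_comp {W : Type*} [NormedAddCommGroup W] [NormedSpace ℝ W]
    {Y : Type*} [NormedAddCommGroup Y] [NormedSpace ℝ Y] (L : V →L[ℝ] Y) {g : W → V}
    {g' : W →L[ℝ] V} {w : W} (h : HasFDerivAt g g' w) :
    HasFDerivAt (fun z => L (g z)) (L.comp g') w :=
  L.hasFDerivAt.comp w h

theorem contDiffAt_clm_comp {W : Type*} [NormedAddCommGroup W] [NormedSpace ℝ W]
    {Y : Type*} [NormedAddCommGroup Y] [NormedSpace ℝ Y] (L : V →L[ℝ] Y) {g : W → V} {w : W}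
    {n : WithTop ℕ∞} (h : ContDiffAt ℝ n g w) : ContDiffAt ℝ n (fun z => L (g z)) w :=
  L.contDiff.contDiffAt.comp w h

/-- Along a nonzero direction of the cone, a normal barrier is unbounded below. -/
theorem IsNormalBarrier.exists_line_lt {C : Set V} {F : V → ℝ} {ν : ℝ}
    (hF : IsNormalBarrier C F ν) (hC : IsRegularCone C) {x h : V} (hx : x ∈ interior C) (hh : h ∈ C) (h0 : h ≠ 0) (M : ℝ) :
    ∃ τ : ℝ, 0 ≤ τ ∧ F (x + τ • h) < M := by
  obtain ⟨τ₀, hτ₀, hnot⟩ : ∃ τ₀ : ℝ, 0 < τ₀ ∧ x - τ₀ • h ∉ C := by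
    by_contra! hcon
    refine h0 (hC.pointed h hh (hC.mem_of_forall_add_smul_mem (x := x) fun t ht => ?_))
    simpa [sub_eq_add_neg] using hcon t ht
  have hl : ∀ t : ℝ, 0 ≤ t → x + t • h ∈ interior C := fun t ht => hC.line_mem_interior hx hh ht
  -- Otherwise the local norm of `h` at `x + t • h` is below `1 / (t + τ₀)`, and stepping back by `t
  -- + τ₀` inside the Dikin ellipsoid reaches `x - τ₀ • h`, which is not in the cone.
  have hder : ∀ t : ℝ, 0 ≤ t → 1 / (t + τ₀) ≤ -grad F (x + t • h) h := by
    intro t ht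
    by_contra! hlt
    have h1 := (hF.sqrt_hess_le_neg_grad hC (hl t ht) hh).trans_lt hlt
    have hpos : 0 < t + τ₀ := by linarith
    have h2 : hess F (x + t • h) (-(t + τ₀) • h) (-(t + τ₀) • h) < 1 := by
      simp only [map_smul, smul_apply, smul_eq_mul]
      rw [Real.sqrt_lt' (by positivity), div_pow, lt_div_iff₀ (by positivity)] at h1
      nlinarith
    have h3 := interior_subset (hF.add_mem_interior_of_hess_lt_one (hl t ht) h2)
    apply hnot
    convert h3 using 1
    module
  have hmono : ∀ T : ℝ, 0 ≤ T → F (x + T • h) + Real.log (T + τ₀) ≤ F x + Real.log τ₀ := by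
    intro T hT
    have := le_of_hasDerivAt_nonpos hT
      (f := fun t => F (x + t • h) + Real.log (t + τ₀))
      (f' := fun t => grad F (x + t • h) h + 1 / (t + τ₀))
      (fun t ht => (hF.hasDerivAt_line (hl t ht.1)).add
        (((hasDerivAt_id t).add_const τ₀).log (by simp; linarith [ht.1])))
      (fun t ht => by linarith [hder t ht.1])
    simpa using this
  have hlim : Tendsto (fun T : ℝ => Real.log (T + τ₀)) atTop atTop :=
    Real.tendsto_log_atTop.comp (tendsto_atTop_add_const_right _ _ tendsto_id)
  obtain ⟨T, hT, hT0⟩ := ((hlim.eventually_gt_atTop (F x + Real.log τ₀ - M)).and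
    (eventually_ge_atTop 0)).exists
  exact ⟨T, hT0, by linarith [hmono T hT0]⟩

variable [FiniteDimensional ℝ V]

namespace IsNormalBarrier

variable {C : Set V} {F : V → ℝ} {ν : ℝ} (hF : IsNormalBarrier C F ν) (hC : IsRegularCone C)
include hF hC

theorem gradInv_mem_and_grad {s : StrongDual ℝ V} (hs : s ∈ interior (coneDual C)) :
    gradInv C F s ∈ interior C ∧ grad F (gradInv C F s) = -s :=
  Classical.epsilon_spec (hF.exists_grad_eq_neg hC hs)

theorem gradInv_mem {s : StrongDual ℝ V} (hs : s ∈ interior (coneDual C)) :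
    gradInv C F s ∈ interior C := (hF.gradInv_mem_and_grad hC hs).1

theorem grad_gradInv {s : StrongDual ℝ V} (hs : s ∈ interior (coneDual C)) :
    grad F (gradInv C F s) = -s := (hF.gradInv_mem_and_grad hC hs).2

theorem gradInv_eq {s : StrongDual ℝ V} {x : V} (hx : x ∈ interior C) (h : grad F x = -s) :
    gradInv C F s = x := by
  have hs : s ∈ interior (coneDual C) := by
    rw [← neg_neg s, ← h]
    exact hF.neg_grad_mem_interior_coneDual hC hx
  exact hF.grad_injOn hC (hF.gradInv_mem hC hs) hx ((hF.grad_gradInv hC hs).trans h.symm)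

theorem isGreatest_conjBarrier {s : StrongDual ℝ V} (hs : s ∈ interior (coneDual C)) :
    IsGreatest ((fun x : V => -(s x) - F x) '' interior C)
      (-(s (gradInv C F s)) - F (gradInv C F s)) := by
  refine ⟨⟨_, hF.gradInv_mem hC hs, rfl⟩, ?_⟩
  rintro _ ⟨z, hz, rfl⟩
  have := hF.add_grad_le (hF.gradInv_mem hC hs) hz
  rw [hF.grad_gradInv hC hs, neg_apply, map_sub] at this
  dsimp only
  linarith

theorem conjBarrier_eq {s : StrongDual ℝ V} (hs : s ∈ interior (coneDual C)) :
    conjBarrier C F s = -(s (gradInv C F s)) - F (gradInv C F s) :=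
  (hF.isGreatest_conjBarrier hC hs).csSup_eq

theorem le_conjBarrier {s : StrongDual ℝ V} (hs : s ∈ interior (coneDual C)) {x : V}
    (hx : x ∈ interior C) : -(s x) - F x ≤ conjBarrier C F s := by
  rw [hF.conjBarrier_eq hC hs]
  exact (hF.isGreatest_conjBarrier hC hs).2 ⟨x, hx, rfl⟩

/-- The inverse function theorem for `∇F`, whose derivative is positive definite. The local inverse
agrees with `gradInv` because `∇F` is injective. -/
theorem contDiffAt_gradInv {s : StrongDual ℝ V} (hs : s ∈ interior (coneDual C)) :
    ContDiffAt ℝ 2 (gradInv C F) s := by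
  have hx := hF.gradInv_mem hC hs
  have hg := hF.grad_gradInv hC hs
  set x := gradInv C F s with hxdef
  obtain ⟨e, he⟩ := (hF.isPosDef_hess hC hx).isInvertible
  have hcd : ContDiffAt ℝ 2 (grad F) x :=
    hF.contDiffOn_grad.contDiffAt (isOpen_interior.mem_nhds hx)
  have hfd : HasFDerivAt (grad F) (e : V →L[ℝ] StrongDual ℝ V) x := by
    rw [he]
    exact hF.hasFDerivAt_grad hx
  have hloc := hcd.to_localInverse hfd (by norm_num)
  set g := hcd.localInverse hfd (by norm_num) with hgdef
  rw [hg] at hloc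
  have hgx : g (-s) = x := by
    rw [← hg]
    exact hcd.localInverse_apply_image hfd (by norm_num)
  have hright : ∀ᶠ w in 𝓝 (-s), grad F (g w) = w := by
    rw [← hg]
    exact (hcd.hasStrictFDerivAt' hfd (by norm_num)).eventually_right_inverse
  have hmem : ∀ᶠ w in 𝓝 (-s), g w ∈ interior C := by
    refine hloc.continuousAt.preimage_mem_nhds (isOpen_interior.mem_nhds ?_)
    rw [hgx]
    exact hx
  have hneg : Tendsto (fun t : StrongDual ℝ V => -t) (𝓝 s) (𝓝 (-s)) :=
    (continuous_neg.tendsto s)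
  have hcomp : ContDiffAt ℝ 2 (fun t => g (-t)) s :=
    ContDiffAt.comp s hloc contDiffAt_id.neg
  refine hcomp.congr_of_eventuallyEq ?_
  filter_upwards [hneg.eventually hright, hneg.eventually hmem] with t h1 h2
  exact hF.gradInv_eq hC h2 h1

theorem hasFDerivAt_gradInv {s : StrongDual ℝ V} (hs : s ∈ interior (coneDual C)) :
    HasFDerivAt (gradInv C F) (fderiv ℝ (gradInv C F) s) s :=
  ((hF.contDiffAt_gradInv hC hs).differentiableAt (by norm_num)).hasFDerivAt

theorem hess_fderiv_gradInv {s : StrongDual ℝ V} (hs : s ∈ interior (coneDual C))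
    (u : StrongDual ℝ V) : hess F (gradInv C F s) (fderiv ℝ (gradInv C F) s u) = -u := by
  have h1 := HasFDerivAt.comp s (hF.hasFDerivAt_grad (hF.gradInv_mem hC hs))
    (hF.hasFDerivAt_gradInv hC hs)
  have h2 : HasFDerivAt (fun t : StrongDual ℝ V => -t)
      (-ContinuousLinearMap.id ℝ (StrongDual ℝ V)) s := (hasFDerivAt_id s).neg
  have hev : (grad F ∘ gradInv C F) =ᶠ[𝓝 s] fun t => -t := by
    filter_upwards [isOpen_interior.mem_nhds hs] with t ht using hF.grad_gradInv hC ht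
  have h3 := h1.unique (h2.congr_of_eventuallyEq hev)
  exact congrArg (fun l : StrongDual ℝ V →L[ℝ] StrongDual ℝ V => l u) h3

theorem hasFDerivAt_conjBarrier {s : StrongDual ℝ V} (hs : s ∈ interior (coneDual C)) :
    HasFDerivAt (conjBarrier C F)
      (negEval V (gradInv C F s)) s := by
  have hX := hF.hasFDerivAt_gradInv hC hs
  have h1 : HasFDerivAt (fun t : StrongDual ℝ V => t (gradInv C F t)) _ s :=
    (hasFDerivAt_id s).clm_apply hX
  have h2 : HasFDerivAt (fun t => F (gradInv C F t)) _ s :=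
    (hF.hasFDerivAt (hF.gradInv_mem hC hs)).comp s hX
  have hev : conjBarrier C F =ᶠ[𝓝 s] fun t => -(t (gradInv C F t)) - F (gradInv C F t) := by
    filter_upwards [isOpen_interior.mem_nhds hs] with t ht using hF.conjBarrier_eq hC ht
  refine ((h1.neg.sub h2).congr_of_eventuallyEq hev).congr_fderiv ?_
  ext u
  simp [hF.grad_gradInv hC hs]

theorem grad_conjBarrier {s : StrongDual ℝ V} (hs : s ∈ interior (coneDual C)) :
    grad (conjBarrier C F) s = negEval V (gradInv C F s) :=
  (hF.hasFDerivAt_conjBarrier hC hs).fderiv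

theorem grad_conjBarrier_apply {s : StrongDual ℝ V} (hs : s ∈ interior (coneDual C))
    (u : StrongDual ℝ V) : grad (conjBarrier C F) s u = -(u (gradInv C F s)) := by
  rw [hF.grad_conjBarrier hC hs, negEval_apply]

theorem contDiffOn_grad_conjBarrier :
    ContDiffOn ℝ 2 (grad (conjBarrier C F)) (interior (coneDual C)) := by
  intro s hs
  have h1 := contDiffAt_clm_comp (Y := StrongDual ℝ (StrongDual ℝ V)) (negEval V) (hF.contDiffAt_gradInv hC hs)
  refine (h1.congr_of_eventuallyEq ?_).contDiffWithinAt
  filter_upwards [isOpen_interior.mem_nhds hs] with t ht using hF.grad_conjBarrier hC ht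

theorem contDiffOn_conjBarrier :
    ContDiffOn ℝ 3 (conjBarrier C F) (interior (coneDual C)) := by
  rw [show (3 : WithTop ℕ∞) = 2 + 1 by norm_num,
    contDiffOn_succ_iff_fderiv_of_isOpen isOpen_interior]
  exact ⟨fun s hs => (hF.hasFDerivAt_conjBarrier hC hs).differentiableAt.differentiableWithinAt,
    by simp, hF.contDiffOn_grad_conjBarrier hC⟩

theorem hess_conjBarrier_apply {s : StrongDual ℝ V} (hs : s ∈ interior (coneDual C))
    (u w : StrongDual ℝ V) :
    hess (conjBarrier C F) s u w = -(w (fderiv ℝ (gradInv C F) s u)) := by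
  have h1 := hasFDerivAt_clm_comp (Y := StrongDual ℝ (StrongDual ℝ V)) (negEval V) (hF.hasFDerivAt_gradInv hC hs)
  have hev : fderiv ℝ (conjBarrier C F) =ᶠ[𝓝 s] fun t => negEval V (gradInv C F t) := by
    filter_upwards [isOpen_interior.mem_nhds hs] with t ht using hF.grad_conjBarrier hC ht
  rw [hess, (h1.congr_of_eventuallyEq hev).fderiv]
  simp

/-- With `X = gradInv C F`, differentiate `∇²F(X(s)) X'(s) u = -u` once more along `u` and pair with
`X'(s) u`. Self-concordance thus passes to the conjugate with the same constant. -/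
theorem third_conjBarrier_self {s : StrongDual ℝ V} (hs : s ∈ interior (coneDual C))
    (u : StrongDual ℝ V) :
    third (conjBarrier C F) s u u u =
      -third F (gradInv C F s) (fderiv ℝ (gradInv C F) s u) (fderiv ℝ (gradInv C F) s u)
        (fderiv ℝ (gradInv C F) s u) := by
  set q₀ := fderiv ℝ (gradInv C F) s u with hq₀
  have hx := hF.gradInv_mem hC hs
  have hl : HasDerivAt (fun t : ℝ => s + t • u) u 0 := by
    simpa using ((hasDerivAt_id (0 : ℝ)).smul_const u).const_add s
  have hev : ∀ᶠ t : ℝ in 𝓝 0, s + t • u ∈ interior (coneDual C) :=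
    hl.continuousAt.preimage_mem_nhds (isOpen_interior.mem_nhds (by simpa using hs))
  have hs0 : s + (0 : ℝ) • u = s := by simp
  have hp : HasDerivAt (fun t : ℝ => gradInv C F (s + t • u)) q₀ 0 := by
    have h := hF.hasFDerivAt_gradInv hC hs
    rw [← hs0] at h
    have h2 := h.comp_hasDerivAt (0 : ℝ) hl
    rwa [hs0] at h2
  have hcd : ContDiffAt ℝ 1 (fderiv ℝ (gradInv C F)) s :=
    (hF.contDiffAt_gradInv hC hs).fderiv_right (by norm_num)
  obtain ⟨z, hq⟩ : ∃ z, HasDerivAt (fun t : ℝ => fderiv ℝ (gradInv C F) (s + t • u) u) z 0 := by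
    have h := (hcd.differentiableAt (by norm_num)).hasFDerivAt
    rw [← hs0] at h
    have h2 : HasDerivAt (fun t : ℝ => fderiv ℝ (gradInv C F) (s + t • u)) _ 0 :=
      HasFDerivAt.comp_hasDerivAt (F := StrongDual ℝ V) (E := StrongDual ℝ V →L[ℝ] V)
        (f := fun t : ℝ => s + t • u) (l := fun w => fderiv ℝ (gradInv C F) w) 0 h hl
    exact ⟨_, h2.clm_apply (hasDerivAt_const 0 u)⟩
  have hA : third F (gradInv C F s) q₀ q₀ q₀ + hess F (gradInv C F s) z q₀ = 0 := by
    have h1 : HasDerivAt (fun t : ℝ => hess F (gradInv C F (s + t • u)))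
        (fderiv ℝ (fderiv ℝ (fderiv ℝ F)) (gradInv C F s) q₀) 0 := by
      have h : HasFDerivAt (fun w => hess F w) (fderiv ℝ (fderiv ℝ (fderiv ℝ F)) (gradInv C F s))
          (gradInv C F (s + (0 : ℝ) • u)) := by
        rw [hs0]
        exact hF.hasFDerivAt_hess hx
      exact HasFDerivAt.comp_hasDerivAt (F := V) (E := V →L[ℝ] StrongDual ℝ V)
        (f := fun t : ℝ => gradInv C F (s + t • u)) (l := fun w => hess F w) 0 h hp
    have h3 := (h1.clm_apply hq).clm_apply (hasDerivAt_const 0 q₀)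
    have h4 : (fun t : ℝ => hess F (gradInv C F (s + t • u))
        (fderiv ℝ (gradInv C F) (s + t • u) u) q₀) =ᶠ[𝓝 0] fun _ => -(u q₀) := by
      filter_upwards [hev] with t ht
      rw [hF.hess_fderiv_gradInv hC ht]
      rfl
    have h5 := h3.unique ((hasDerivAt_const (0 : ℝ) (-(u q₀))).congr_of_eventuallyEq h4)
    simpa [third, hs0, ← hq₀] using h5
  have hB : third (conjBarrier C F) s u u u = -(u z) := by
    have h3 := hasDerivAt_hess_line_of_contDiffOn isOpen_interior (hF.contDiffOn_conjBarrier hC)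
      (x := s) (h := u) u u (t := 0) (by simpa using hs)
    have h4 : (fun t : ℝ => hess (conjBarrier C F) (s + t • u) u u) =ᶠ[𝓝 0]
        fun t => -(u (fderiv ℝ (gradInv C F) (s + t • u) u)) := by
      filter_upwards [hev] with t ht using hF.hess_conjBarrier_apply hC ht u u
    have h5 : HasDerivAt (fun t : ℝ => -(u (fderiv ℝ (gradInv C F) (s + t • u) u))) (-(u z)) 0 :=
      (u.hasFDerivAt.comp_hasDerivAt 0 hq).neg
    have h6 := h3.unique (h5.congr_of_eventuallyEq h4)
    rwa [hs0] at h6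
  have h1 := hF.hess_fderiv_gradInv hC hs u
  have h2 := hF.hess_symm hx z q₀
  rw [← hq₀] at h1
  rw [h1, neg_apply] at h2
  rw [hB]
  linarith

theorem hess_conjBarrier_self {s : StrongDual ℝ V} (hs : s ∈ interior (coneDual C))
    (u : StrongDual ℝ V) : hess (conjBarrier C F) s u u =
      hess F (gradInv C F s) (fderiv ℝ (gradInv C F) s u) (fderiv ℝ (gradInv C F) s u) := by
  rw [hF.hess_conjBarrier_apply hC hs, hF.hess_fderiv_gradInv hC hs, neg_apply]

theorem gradInv_smul {s : StrongDual ℝ V} (hs : s ∈ interior (coneDual C)) {τ : ℝ} (hτ : 0 < τ) :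
    gradInv C F (τ • s) = τ⁻¹ • gradInv C F s := by
  have hx := hF.gradInv_mem hC hs
  refine hF.gradInv_eq hC (hC.smul_mem_interior hx (inv_pos.2 hτ)) ?_
  rw [hF.grad_smul hC hx (inv_pos.2 hτ), hF.grad_gradInv hC hs, inv_inv, smul_neg]

/-- The conjugate of a normal barrier is a normal barrier for the dual cone. -/
theorem conjBarrier : IsNormalBarrier (coneDual C) (conjBarrier C F) ν where
  contDiffOn := hF.contDiffOn_conjBarrier hC
  convexOn := by
    refine ⟨(convex_coneDual C).interior, fun s hs t ht a b ha hb hab => ?_⟩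
    have hm := (convex_coneDual C).interior hs ht ha hb hab
    rw [hF.conjBarrier_eq hC hm]
    have hx := hF.gradInv_mem hC hm
    set x := gradInv C F (a • s + b • t)
    have h1 := mul_le_mul_of_nonneg_left (hF.le_conjBarrier hC hs hx) ha
    have h2 := mul_le_mul_of_nonneg_left (hF.le_conjBarrier hC ht hx) hb
    simp only [add_apply, smul_apply, smul_eq_mul]
    have h3 : F x = a * F x + b * F x := by rw [← add_mul, hab, one_mul]
    linarith
  tendsto_atTop s hs := by
    have hs1 : s ∈ coneDual C := (isClosed_coneDual C).frontier_subset hs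
    -- A boundary functional vanishes on some nonzero `h` in the cone. Along `h` the primal barrier
    -- is unbounded below, so the conjugate exceeds any `M` near `s`.
    obtain ⟨h, hh, h0, hle⟩ : ∃ h ∈ C, h ≠ 0 ∧ s h ≤ 0 := by
      by_contra! hcon
      exact hs.2 (hC.mem_interior_coneDual hcon)
    have hsh : s h = 0 := le_antisymm hle (hs1 h hh)
    obtain ⟨x, hx⟩ := hC.nonempty_interior
    refine Filter.tendsto_atTop.2 fun M => ?_
    obtain ⟨τ, hτ, hlt⟩ := hF.exists_line_lt hC hx hh h0 (-(s x) - M)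
    have hc : Continuous fun t : StrongDual ℝ V => -(t (x + τ • h)) - F (x + τ • h) := by fun_prop
    have hval : M < -(s (x + τ • h)) - F (x + τ • h) := by
      rw [map_add, map_smul, hsh, smul_zero, add_zero]
      linarith
    filter_upwards [nhdsWithin_le_nhds (hc.continuousAt.eventually_const_lt hval),
      self_mem_nhdsWithin] with t h1 h2
    exact h1.le.trans (hF.le_conjBarrier hC h2 (hC.line_mem_interior hx hh hτ))
  selfConcordant s hs u := by
    rw [hF.third_conjBarrier_self hC hs, hF.hess_conjBarrier_self hC hs, abs_neg]
    exact hF.selfConcordant _ (hF.gradInv_mem hC hs) _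
  logHomogeneous s hs τ hτ := by
    have hm := (hF.isRegularCone_coneDual hC).smul_mem_interior hs hτ
    rw [hF.conjBarrier_eq hC hm, hF.conjBarrier_eq hC hs, hF.gradInv_smul hC hs hτ,
      hF.logHomogeneous _ (hF.gradInv_mem hC hs) _ (inv_pos.2 hτ), Real.log_inv]
    simp only [map_smul, smul_apply, smul_eq_mul]
    field_simp
    ring

/-- At corresponding points the Hessians of a barrier and of its conjugate are inverse to each
other. At `x₁` this identifies `‖·‖_B` on `E*` with the local norm at `s₁`. -/
theorem hess_conjBarrier_neg_grad {x : V} (hx : x ∈ interior C) (u w : StrongDual ℝ V) :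
    hess (ConicIPM.conjBarrier C F) (-grad F x) u w = w ((hess F x).inverse u) := by
  have hs := hF.neg_grad_mem_interior_coneDual hC hx
  have hX : gradInv C F (-grad F x) = x := hF.gradInv_eq hC hx (by rw [neg_neg])
  have h1 := hF.hess_fderiv_gradInv hC hs u
  rw [hX] at h1
  rw [hF.hess_conjBarrier_apply hC hs]
  generalize fderiv ℝ (gradInv C F) (-grad F x) u = d at h1
  rw [← neg_neg u, ← h1, map_neg, (hF.isPosDef_hess hC hx).isInvertible.inverse_apply_self, map_neg]

end IsNormalBarrier

end Conjugate

/-! ### Derivatives of a barrier composed with an affine map. -/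

section AffineComposition

variable {W : Type*} [NormedAddCommGroup W] [NormedSpace ℝ W]
  {H : Type*} [NormedAddCommGroup H] [NormedSpace ℝ H]

theorem hasFDerivAt_const_sub_clm (L : H →L[ℝ] W) (c : W) (y : H) :
    HasFDerivAt (fun z => c - L z) (-L) y :=
  L.hasFDerivAt.const_sub c

theorem fderiv_comp_const_sub_clm {Φ : W → ℝ} (L : H →L[ℝ] W) (c : W) {y : H}
    (h : HasFDerivAt Φ (grad Φ (c - L y)) (c - L y)) :
    fderiv ℝ (fun z => Φ (c - L z)) y = (grad Φ (c - L y)).comp (-L) :=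
  (h.comp y (hasFDerivAt_const_sub_clm L c y)).fderiv

theorem IsNormalBarrier.grad_comp_const_sub_clm {C : Set W} {Φ : W → ℝ} {ν : ℝ}
    (hΦ : IsNormalBarrier C Φ ν) (L : H →L[ℝ] W) (c : W) {y : H} (hy : c - L y ∈ interior C)
    (h : H) : grad (fun z => Φ (c - L z)) y h = -grad Φ (c - L y) (L h) := by
  rw [grad, fderiv_comp_const_sub_clm L c (hΦ.hasFDerivAt hy)]
  simp

theorem IsNormalBarrier.hess_comp_const_sub_clm {C : Set W} {Φ : W → ℝ} {ν : ℝ}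
    (hΦ : IsNormalBarrier C Φ ν) (L : H →L[ℝ] W) (c : W) {y : H} (hy : c - L y ∈ interior C)
    (h k : H) : hess (fun z => Φ (c - L z)) y h k = hess Φ (c - L y) (L h) (L k) := by
  have hev : fderiv ℝ (fun z => Φ (c - L z)) =ᶠ[𝓝 y] fun z => (grad Φ (c - L z)).comp (-L) := by
    have hc : ContinuousAt (fun z => c - L z) y := (hasFDerivAt_const_sub_clm L c y).continuousAt
    filter_upwards [hc.preimage_mem_nhds (isOpen_interior.mem_nhds hy)] with z hz
    exact fderiv_comp_const_sub_clm L c (hΦ.hasFDerivAt hz)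
  have h1 : HasFDerivAt (fun z => grad Φ (c - L z)) ((hess Φ (c - L y)).comp (-L)) y :=
    HasFDerivAt.comp y (hΦ.hasFDerivAt_grad hy) (hasFDerivAt_const_sub_clm L c y)
  have h2 := h1.clm_comp (hasFDerivAt_const (-L) y)
  rw [hess, (h2.congr_of_eventuallyEq hev).fderiv]
  simp

end AffineComposition

/-! ### Reflexivity in finite dimension. -/

section Bidual

variable {V : Type*} [NormedAddCommGroup V] [NormedSpace ℝ V] [FiniteDimensional ℝ V]

theorem finrank_strongDual : Module.finrank ℝ (StrongDual ℝ V) = Module.finrank ℝ V := by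
  rw [← (LinearMap.toContinuousLinearMap : (V →ₗ[ℝ] ℝ) ≃ₗ[ℝ] (V →L[ℝ] ℝ)).finrank_eq]
  exact Subspace.dual_finrank_eq

theorem isInvertible_inclusionInDoubleDual :
    (NormedSpace.inclusionInDoubleDual ℝ V).IsInvertible := by
  have hinj : Function.Injective (NormedSpace.inclusionInDoubleDual ℝ V) :=
    (NormedSpace.inclusionInDoubleDualLi ℝ (E := V)).injective
  have hrank : Module.finrank ℝ V = Module.finrank ℝ (StrongDual ℝ (StrongDual ℝ V)) := by
    rw [finrank_strongDual, finrank_strongDual]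
  let e : V ≃ₗ[ℝ] StrongDual ℝ (StrongDual ℝ V) := LinearEquiv.ofInjectiveOfFinrankEq
    (NormedSpace.inclusionInDoubleDual ℝ V : V →ₗ[ℝ] StrongDual ℝ (StrongDual ℝ V)) hinj hrank
  exact ⟨e.toContinuousLinearEquiv, by ext x y; rfl⟩

theorem apply_inverse_inclusionInDoubleDual (ψ : StrongDual ℝ (StrongDual ℝ V))
    (u : StrongDual ℝ V) : u ((NormedSpace.inclusionInDoubleDual ℝ V).inverse ψ) = ψ u := by
  conv_rhs => rw [← isInvertible_inclusionInDoubleDual.self_apply_inverse ψ]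
  rw [NormedSpace.dual_def]

end Bidual

/-! ### The dual feasible set, the central path and the fixed norms. -/

namespace ConicProblem

variable {E H : Type*} [NormedAddCommGroup E] [NormedSpace ℝ E]
  [NormedAddCommGroup H] [NormedSpace ℝ H]

/-- The standing assumptions: a regular cone with a normal barrier, a surjective constraint
operator, and strictly feasible primal and dual problems. -/
structure IsStandard (P : ConicProblem E H) : Prop where
  regular : IsRegularCone (P.K : Set E)
  barrier : IsNormalBarrier (P.K : Set E) P.F P.ν
  surjective : Function.Surjective P.A
  feasible : P.StrictlyFeasible

theorem IsRegular.isRegularCone {P : ConicProblem E H} (hK : P.IsRegular) :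
    IsRegularCone (P.K : Set E) where
  isClosed := P.K.isClosed
  convex := P.K.convex
  smul_mem _ hx _ ht := P.K.smul_mem hx ht
  pointed := hK.1
  nonempty_interior := hK.2

theorem adj_apply (P : ConicProblem E H) (h : H) (x : E) : P.adj h x = P.A x h := rfl

theorem slack_add (P : ConicProblem E H) (y h : H) : P.slack (y + h) = P.slack y - P.adj h := by
  simp only [slack, map_add]
  abel

theorem slack_sub_slack (P : ConicProblem E H) (y y' : H) :
    P.slack y - P.slack y' = P.adj (y' - y) := by
  simp only [slack, map_sub]
  abel

theorem continuous_slack (P : ConicProblem E H) : Continuous P.slack :=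
  continuous_const.sub P.adj.continuous

theorem hess_dualBarrier_eq [FiniteDimensional ℝ E] (P : ConicProblem E H)
    (s k u : StrongDual ℝ E) : hess P.dualBarrier s k u = u (P.dualHess s k) :=
  (apply_inverse_inclusionInDoubleDual _ _).symm

/-- A functional vanishing on `ker A` factors through `A`; a linear right inverse of `A` provides
the factor as an element of the bidual of `H`. This supplies Lagrange multipliers. -/
theorem exists_adj_eq [FiniteDimensional ℝ H] {P : ConicProblem E H} (hA : Function.Surjective P.A) (g : StrongDual ℝ E)
    (hg : ∀ x, P.A x = 0 → g x = 0) : ∃ y, P.adj y = g := by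
  obtain ⟨S, hS⟩ := (P.A : E →ₗ[ℝ] StrongDual ℝ H).exists_rightInverse_of_surjective
    (LinearMap.range_eq_top.2 hA)
  set ψ : StrongDual ℝ (StrongDual ℝ H) :=
    LinearMap.toContinuousLinearMap ((g : E →ₗ[ℝ] ℝ).comp S) with hψ
  refine ⟨(NormedSpace.inclusionInDoubleDual ℝ H).inverse ψ, ?_⟩
  ext x
  rw [adj_apply, apply_inverse_inclusionInDoubleDual]
  have h1 : P.A (S (P.A x)) = P.A x := congrArg (fun l => l (P.A x)) hS
  have h2 := hg (x - S (P.A x)) (by rw [map_sub, h1, sub_self])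
  rw [map_sub, sub_eq_zero] at h2
  rw [h2]
  rfl

namespace IsStandard

variable {P : ConicProblem E H} (hP : P.IsStandard)
include hP

theorem adj_injective : Function.Injective P.adj := by
  refine (injective_iff_map_eq_zero P.adj).2 fun h hh => ?_
  by_contra hne
  obtain ⟨g, -, hg⟩ := exists_dual_vector ℝ h (norm_ne_zero_iff.2 hne)
  obtain ⟨x, rfl⟩ := hP.surjective g
  rw [← P.adj_apply, hh, zero_apply] at hg
  exact hne (norm_eq_zero.1 (by exact_mod_cast hg.symm))

variable [FiniteDimensional ℝ E]

theorem isRegularCone_dualCone : IsRegularCone P.dualCone :=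
  hP.barrier.isRegularCone_coneDual hP.regular

theorem dualBarrier : IsNormalBarrier P.dualCone P.dualBarrier P.ν :=
  hP.barrier.conjBarrier hP.regular

/-- For the direct implication, `y` is moved slightly beyond itself, away from a strictly feasible
`y₀`. Its slack is then a convex combination of a feasible slack and the interior slack of `y₀`. -/
theorem mem_interior_Q {y : H} : y ∈ interior P.Q ↔ P.slack y ∈ interior P.dualCone := by
  constructor
  · intro hy
    obtain ⟨y₀, hy₀⟩ := hP.feasible.2
    have hc : ContinuousAt (fun t : ℝ => y + t • (y - y₀)) 0 := by fun_prop
    have hev : ∀ᶠ t : ℝ in 𝓝[>] 0, y + t • (y - y₀) ∈ P.Q := by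
      refine nhdsWithin_le_nhds (hc.preimage_mem_nhds (mem_interior_iff_mem_nhds.1 ?_))
      simpa using hy
    obtain ⟨t, ht, htp⟩ := (hev.and self_mem_nhdsWithin).exists
    have htp : 0 < t := htp
    have h1 := hP.isRegularCone_dualCone.convex.combo_interior_self_mem_interior hy₀ ht
      (a := t / (1 + t)) (b := 1 / (1 + t)) (by positivity) (by positivity) (by field_simp; ring)
    convert h1 using 1
    have e1 : P.slack (y + t • (y - y₀)) = (1 + t) • P.slack y - t • P.slack y₀ := by
      simp only [slack, map_add, map_smul, map_sub]
      module
    rw [e1, smul_sub, smul_smul, smul_smul, one_div_mul_cancel (by positivity), one_smul,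
      one_div_mul_eq_div]
    abel
  · intro hy
    refine mem_interior_iff_mem_nhds.2 ?_
    exact Filter.mem_of_superset
      (P.continuous_slack.continuousAt.preimage_mem_nhds (isOpen_interior.mem_nhds hy))
      fun z hz => show P.slack z ∈ P.dualCone from interior_subset hz

theorem grad_f {y : H} (hy : P.slack y ∈ interior P.dualCone) (h : H) :
    grad P.f y h = -grad P.dualBarrier (P.slack y) (P.adj h) :=
  hP.dualBarrier.grad_comp_const_sub_clm P.adj P.c hy h

theorem hess_f {y : H} (hy : P.slack y ∈ interior P.dualCone) (h k : H) :
    hess P.f y h k = hess P.dualBarrier (P.slack y) (P.adj h) (P.adj k) :=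
  hP.dualBarrier.hess_comp_const_sub_clm P.adj P.c hy h k

theorem isPosDef_hess_dualBarrier {s : StrongDual ℝ E} (hs : s ∈ interior P.dualCone) :
    IsPosDef (hess P.dualBarrier s) :=
  hP.dualBarrier.isPosDef_hess hP.isRegularCone_dualCone hs

theorem opNorm_hess_f {y : H} (hy : P.slack y ∈ interior P.dualCone) (h : H) :
    opNorm (hess P.f y) h = opNorm (hess P.dualBarrier (P.slack y)) (P.adj h) := by
  rw [opNorm, hP.hess_f hy, opNorm]

theorem isPosDef_hess_f {y : H} (hy : P.slack y ∈ interior P.dualCone) :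
    IsPosDef (hess P.f y) where
  symm u w := by rw [hP.hess_f hy, hP.hess_f hy, (hP.isPosDef_hess_dualBarrier hy).symm]
  pos u hu := by
    rw [hP.hess_f hy]
    exact (hP.isPosDef_hess_dualBarrier hy).pos _
      ((map_ne_zero_iff P.adj hP.adj_injective).2 hu)

variable [FiniteDimensional ℝ H]

/-- `x_μ` minimizes `⟨s(y₀)/μ, x⟩ + F(x)` on `A x = b`. This is the barrier problem for `c / μ` up
to a constant, since `c - s(y₀)` lies in the range of `A*`. -/
theorem exists_isCentralPoint {μ : ℝ} (hμ : 0 < μ) : ∃ z, P.IsCentralPoint μ z := by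
  obtain ⟨⟨x₀, hx₀, hAx₀⟩, y₀, hy₀⟩ := hP.feasible
  have hs := hP.isRegularCone_dualCone.smul_mem_interior hy₀ (inv_pos.2 hμ)
  obtain ⟨x, hx, hmin⟩ := hP.barrier.exists_isMin_of_isClosed hP.regular hs
    (L := {x | P.A x = P.b}) (isClosed_eq P.A.continuous continuous_const) ⟨x₀, hAx₀, hx₀⟩
  obtain ⟨y₁, hy₁⟩ := exists_adj_eq hP.surjective (μ⁻¹ • P.slack y₀ + grad P.F x) (by
    intro d hd
    generalize μ⁻¹ • P.slack y₀ = g at *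
    have hl : HasDerivAt (fun t : ℝ => g (x + t • d) + P.F (x + t • d)) (g d + grad P.F x d) 0 := by
      have h1 := hP.barrier.hasDerivAt_line (x := x) (h := d) (t := 0) (by simpa using hx.2)
      rw [zero_smul, add_zero] at h1
      have h2 : HasDerivAt (fun t : ℝ => x + t • d) d 0 := by
        simpa using ((hasDerivAt_id (0 : ℝ)).smul_const d).const_add x
      exact (g.hasFDerivAt.comp_hasDerivAt (0 : ℝ) h2).add h1
    have hloc : IsLocalMin (fun t : ℝ => g (x + t • d) + P.F (x + t • d)) 0 := by
      have hc : ContinuousAt (fun t : ℝ => x + t • d) 0 := by fun_prop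
      filter_upwards [hc.preimage_mem_nhds (isOpen_interior.mem_nhds (by simpa using hx.2))]
        with t ht
      have := hmin (x + t • d) ⟨by
        have := hx.1
        simp only [mem_ofPred_eq] at this ⊢
        rw [map_add, map_smul, hd, smul_zero, add_zero, this], ht⟩
      simpa using this
    rw [add_apply]
    exact hloc.hasDerivAt_eq_zero hl)
  refine ⟨(x, -(μ • grad P.F x), y₀ + μ • y₁), hx.2, hx.1, ?_, rfl⟩
  rw [map_add, map_smul, hy₁, smul_add, smul_smul, mul_inv_cancel₀ hμ.ne', one_smul, slack]
  abel

theorem isCentralPoint_centralPath {μ : ℝ} (hμ : 0 < μ) :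
    P.IsCentralPoint μ (P.centralPath μ) :=
  Classical.epsilon_spec (hP.exists_isCentralPoint hμ)

theorem sCentral_eq_slack {μ : ℝ} (hμ : 0 < μ) :
    P.sCentral μ = P.slack (P.centralPath μ).2.2 := by
  obtain ⟨-, -, h3, h4⟩ := hP.isCentralPoint_centralPath hμ
  rw [sCentral, h4, slack, ← h3]
  abel

theorem sCentral_mem_interior {μ : ℝ} (hμ : 0 < μ) : P.sCentral μ ∈ interior P.dualCone := by
  obtain ⟨h1, -, -, h4⟩ := hP.isCentralPoint_centralPath hμ
  have h5 : P.sCentral μ = μ • -grad P.F (P.centralPath μ).1 := by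
    rw [sCentral, h4]
    ext
    simp
  rw [h5]
  exact hP.isRegularCone_dualCone.smul_mem_interior
    (hP.barrier.neg_grad_mem_interior_coneDual hP.regular h1) hμ

theorem sCentral_apply_xCentral {μ : ℝ} (hμ : 0 < μ) :
    P.sCentral μ (P.centralPath μ).1 = P.ν * μ := by
  obtain ⟨h1, -, -, h4⟩ := hP.isCentralPoint_centralPath hμ
  rw [sCentral, h4, neg_apply, smul_apply, hP.barrier.grad_self h1, smul_eq_mul]
  ring

theorem grad_dualBarrier_sCentral {μ : ℝ} (hμ : 0 < μ) (u : StrongDual ℝ E) :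
    grad P.dualBarrier (P.sCentral μ) u = -(μ⁻¹ * u (P.centralPath μ).1) := by
  obtain ⟨h1, -, -, h4⟩ := hP.isCentralPoint_centralPath hμ
  have h5 : gradInv (P.K : Set E) P.F (P.sCentral μ) = μ⁻¹ • (P.centralPath μ).1 := by
    refine hP.barrier.gradInv_eq hP.regular (hP.regular.smul_mem_interior h1 (inv_pos.2 hμ)) ?_
    rw [hP.barrier.grad_smul hP.regular h1 (inv_pos.2 hμ), inv_inv, sCentral, h4, neg_neg]
  have h6 := hP.barrier.grad_conjBarrier_apply hP.regular (hP.sCentral_mem_interior hμ) u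
  rw [h5, map_smul, smul_eq_mul] at h6
  exact h6

theorem isPosDef_B : IsPosDef P.B :=
  hP.barrier.isPosDef_hess hP.regular (hP.isCentralPoint_centralPath one_pos).1

theorem hess_dualBarrier_sCentral_one (u w : StrongDual ℝ E) :
    hess P.dualBarrier (P.sCentral 1) u w = w (P.B.inverse u) := by
  obtain ⟨h1, -, -, h4⟩ := hP.isCentralPoint_centralPath one_pos
  rw [sCentral, h4, one_smul]
  exact hP.barrier.hess_conjBarrier_neg_grad hP.regular h1 u w

theorem opDualNorm_B (u : StrongDual ℝ E) :
    opDualNorm P.B u = opNorm (hess P.dualBarrier (P.sCentral 1)) u := by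
  rw [opDualNorm, opNorm, hP.hess_dualBarrier_sCentral_one]

theorem opNorm_G (h : H) :
    opNorm P.G h = opNorm (hess P.dualBarrier (P.sCentral 1)) (P.adj h) := by
  rw [opNorm, opNorm, hP.hess_dualBarrier_sCentral_one]
  rfl

theorem abs_apply_le_opNorm_B (u : StrongDual ℝ E) (x : E) :
    |u x| ≤ opNorm P.B x * opNorm (hess P.dualBarrier (P.sCentral 1)) u := by
  have := hP.isPosDef_B.abs_apply_le u x
  rwa [hP.opDualNorm_B, mul_comm] at this

theorem opNorm_B_le_sCentral_one {x : E} (hx : x ∈ P.K) : opNorm P.B x ≤ P.sCentral 1 x := by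
  obtain ⟨h1, -, -, h4⟩ := hP.isCentralPoint_centralPath one_pos
  rw [sCentral, h4, one_smul]
  exact hP.barrier.sqrt_hess_le_neg_grad hP.regular h1 hx

theorem opNorm_sCentral_one :
    opNorm (hess P.dualBarrier (P.sCentral 1)) (P.sCentral 1) = √P.ν := by
  rw [opNorm, hP.dualBarrier.hess_self_self hP.isRegularCone_dualCone
    (hP.sCentral_mem_interior one_pos)]

end IsStandard

end ConicProblem

/-! ### Cone order, local norms and polarization. -/

section Barrier

variable {V : Type*} [NormedAddCommGroup V] [NormedSpace ℝ V]

theorem IsNormalBarrier.smul_add_mem_of_opNorm_le {C : Set V} {Φ : V → ℝ} {ν : ℝ}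
    (hΦ : IsNormalBarrier C Φ ν) (hC : IsRegularCone C) {x d : V} (hx : x ∈ interior C) {ρ : ℝ}
    (hρ : opNorm (hess Φ x) d ≤ ρ) : ρ • x + d ∈ C := by
  rcases ((opNorm_nonneg _ _).trans hρ).eq_or_lt with h0 | hpos
  · have hd : d = 0 := by
      by_contra hne
      exact ((hΦ.isPosDef_hess hC hx).opNorm_pos hne).not_ge (hρ.trans_eq h0.symm)
    simpa [← h0, hd] using hC.zero_mem
  · have h1 : hess Φ x (ρ⁻¹ • d) (ρ⁻¹ • d) ≤ 1 := by
      rw [← (hΦ.isPosDef_hess hC hx).sq_opNorm, opNorm_smul, abs_of_pos (inv_pos.2 hpos),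
        inv_mul_eq_div]
      have : opNorm (hess Φ x) d / ρ ≤ 1 := (div_le_one hpos).2 hρ
      have h2 : 0 ≤ opNorm (hess Φ x) d / ρ := div_nonneg (opNorm_nonneg _ _) hpos.le
      nlinarith
    have h2 := hC.smul_mem _ (hΦ.add_mem_of_hess_le_one hC.isClosed hx h1) ρ hpos.le
    rwa [smul_add, smul_smul, mul_inv_cancel₀ hpos.ne', one_smul] at h2

theorem IsNormalBarrier.smul_sub_mem_of_opNorm_le {C : Set V} {Φ : V → ℝ} {ν : ℝ}
    (hΦ : IsNormalBarrier C Φ ν) (hC : IsRegularCone C) {x d : V} (hx : x ∈ interior C) {ρ : ℝ}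
    (hρ : opNorm (hess Φ x) d ≤ ρ) : ρ • x - d ∈ C := by
  rw [sub_eq_add_neg]
  exact hΦ.smul_add_mem_of_opNorm_le hC hx (by rwa [opNorm_neg])

theorem IsNormalBarrier.opNorm_le_of_smul_sub_mem {C : Set V} {Φ : V → ℝ} {ν : ℝ}
    (hΦ : IsNormalBarrier C Φ ν) (hC : IsRegularCone C) (hN : HasNegativeCurvature C Φ)
    {x x' : V} (hx : x ∈ interior C) (hx' : x' ∈ interior C) {ρ : ℝ} (hρ : 0 < ρ)
    (h : ρ • x - x' ∈ C) (u : V) : opNorm (hess Φ x) u ≤ ρ * opNorm (hess Φ x') u := by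
  refine Real.sqrt_le_iff.2 ⟨mul_nonneg hρ.le (opNorm_nonneg _ _), ?_⟩
  rw [mul_pow, (hΦ.isPosDef_hess hC hx').sq_opNorm]
  exact hΦ.hess_le_of_smul_sub_mem hC hN hx hx' hρ h u

/-- A symmetric bilinear form dominated on the diagonal is dominated off the diagonal. -/
theorem abs_sub_apply_le_of_diagonal {D D' Q : V →L[ℝ] StrongDual ℝ V} (hQ : IsPosDef Q)
    (hD : ∀ u w, D u w = D w u) (hD' : ∀ u w, D' u w = D' w u) {c : ℝ}
    (h : ∀ u, |D u u - D' u u| ≤ c * Q u u) (u w : V) :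
    |D u w - D' u w| ≤ c * (opNorm Q u * opNorm Q w) := by
  by_cases hu : u = 0
  · simp [hu, opNorm]
  by_cases hw : w = 0
  · simp [hw, opNorm]
  have ha := hQ.opNorm_pos hu
  have hb := hQ.opNorm_pos hw
  have hqa := hQ.sq_opNorm u
  have hqb := hQ.sq_opNorm w
  set a := opNorm Q u
  set b := opNorm Q w
  -- The weights give `b • u` and `a • w` equal norms, so that polarization loses nothing.
  have h1 := abs_le.1 (h (b • u + a • w))
  have h2 := abs_le.1 (h (b • u - a • w))
  simp only [map_add, map_sub, map_smul, add_apply, sub_apply, smul_apply, smul_eq_mul,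
    hD w u, hD' w u, ← hqa, ← hqb] at h1 h2
  have hab : 0 < a * b := by positivity
  rw [abs_le]
  constructor
  · refine le_of_mul_le_mul_left ?_ hab
    nlinarith [h1.1, h2.2]
  · refine le_of_mul_le_mul_left ?_ hab
    nlinarith [h1.2, h2.1]

end Barrier

/-! ### Estimates near the central path and consequences of sharpness. -/

namespace ConicProblem

variable {E H : Type*} [NormedAddCommGroup E] [NormedSpace ℝ E] [FiniteDimensional ℝ E]
  [NormedAddCommGroup H] [NormedSpace ℝ H]

namespace IsStandard

variable {P : ConicProblem E H} (hP : P.IsStandard)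
include hP

theorem grad_f_eq_hess {y : H} (hy : P.slack y ∈ interior P.dualCone) (h : H) :
    grad P.f y h = hess P.dualBarrier (P.slack y) (P.slack y) (P.adj h) := by
  rw [hP.grad_f hy, hP.dualBarrier.hess_self hP.isRegularCone_dualCone hy]

theorem add_mem_Q {y h : H} (hy : P.slack y ∈ interior P.dualCone)
    (hh : opNorm (hess P.f y) h ≤ 1) : y + h ∈ P.Q := by
  have h1 := hP.dualBarrier.smul_sub_mem_of_opNorm_le hP.isRegularCone_dualCone hy
    (d := P.adj h) (ρ := 1) (by rwa [← hP.opNorm_hess_f hy])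
  rwa [one_smul, ← slack_add] at h1

variable [FiniteDimensional ℝ H]

theorem b_apply {μ : ℝ} (hμ : 0 < μ) (h : H) : P.b h = P.adj h (P.centralPath μ).1 := by
  rw [adj_apply, (hP.isCentralPoint_centralPath hμ).2.1]

theorem opDualNorm_grad_f_le {y : H} (hy : P.slack y ∈ interior P.dualCone) :
    opDualNorm (hess P.f y) (grad P.f y) ≤ √P.ν := by
  refine (hP.isPosDef_hess_f hy).opDualNorm_le (Real.sqrt_nonneg _) fun h => ?_
  rw [hP.grad_f_eq_hess hy, hP.opNorm_hess_f hy]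
  have h1 := (le_abs_self _).trans
    ((hP.isPosDef_hess_dualBarrier hy).cauchy_schwarz (P.slack y) (P.adj h))
  refine h1.trans_eq ?_
  congr 1
  rw [opNorm, hP.dualBarrier.hess_self_self hP.isRegularCone_dualCone hy]

theorem abs_residual_apply_le {y : H} {μ β : ℝ} (hy : y ∈ P.nbhd μ β) (h : H) :
    |(grad P.f y - (1 / μ) • P.b) h| ≤ β * opNorm (hess P.f y) h := by
  have hs := hP.mem_interior_Q.1 hy.1
  refine ((hP.isPosDef_hess_f hs).abs_apply_le _ h).trans ?_
  exact mul_le_mul_of_nonneg_right hy.2 (opNorm_nonneg _ _)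

theorem slack_yCentral_mem {μ : ℝ} (hμ : 0 < μ) :
    P.slack (P.centralPath μ).2.2 ∈ interior P.dualCone := by
  rw [← hP.sCentral_eq_slack hμ]
  exact hP.sCentral_mem_interior hμ

/-- With `r` the distance, strong monotonicity of `∇F_*` between `s(y)` and `s_μ` gives `r² / (1 +
r) ≤ β r`, because `∇F_*(s_μ)` acts on the range of `A*` as `-b/μ`. -/
theorem opNorm_sub_yCentral_le {y : H} {μ β : ℝ} (hμ : 0 < μ) (hβ : β < 1)
    (hy : y ∈ P.nbhd μ β) :
    opNorm (hess P.f y) (y - (P.centralPath μ).2.2) ≤ β / (1 - β) := by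
  have hs := hP.mem_interior_Q.1 hy.1
  have h1 := hP.dualBarrier.div_le_grad_sub hP.isRegularCone_dualCone hs
    (hP.sCentral_mem_interior hμ)
  rw [hP.sCentral_eq_slack hμ, slack_sub_slack, ← hP.sCentral_eq_slack hμ,
    hP.grad_dualBarrier_sCentral hμ, ← hP.b_apply hμ, ← hP.hess_f hs] at h1
  set d := y - (P.centralPath μ).2.2 with hd
  have h2 := (le_abs_self _).trans (hP.abs_residual_apply_le hy d)
  rw [sub_apply, smul_apply, smul_eq_mul, hP.grad_f hs, one_div] at h2
  have h3 := (hP.isPosDef_hess_f hs).sq_opNorm d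
  have h4 := opNorm_nonneg (hess P.f y) d
  change _ / (1 + opNorm (hess P.f y) d) ≤ _ at h1
  rw [← h3, div_le_iff₀ (by positivity)] at h1
  rw [le_div_iff₀ (by linarith)]
  set r := opNorm (hess P.f y) d
  rcases h4.eq_or_lt with h0 | hpos
  · have hβ0 : 0 ≤ β := (opDualNorm_nonneg _ _).trans hy.2
    rw [← h0]
    linarith
  · have h5 : r ^ 2 ≤ β * r * (1 + r) := by nlinarith
    nlinarith

theorem b_sub_yCentral (yStar : H) {μ : ℝ} (hμ : 0 < μ) :
    P.b (yStar - (P.centralPath μ).2.2) = P.ν * μ - P.slack yStar (P.centralPath μ).1 := by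
  rw [hP.b_apply hμ, ← slack_sub_slack, ← hP.sCentral_eq_slack hμ, sub_apply,
    hP.sCentral_apply_xCentral hμ]

theorem b_sub_yCentral_le {yStar : H} (hStar : yStar ∈ P.Q) {μ : ℝ} (hμ : 0 < μ) :
    P.b (yStar - (P.centralPath μ).2.2) ≤ P.ν * μ := by
  have h1 := hStar _ (interior_subset (hP.isCentralPoint_centralPath hμ).1)
  linarith [hP.b_sub_yCentral yStar hμ]

theorem slack_optimal_xCentral_le {yStar : H} (hopt : P.IsDualOptimal yStar) {μ : ℝ}
    (hμ : 0 < μ) : P.slack yStar (P.centralPath μ).1 ≤ P.ν * μ := by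
  have h1 := hP.b_sub_yCentral yStar hμ
  have h2 := hopt.2 _ (interior_subset (hP.mem_interior_Q.2 (hP.slack_yCentral_mem hμ)))
  rw [map_sub] at h1
  linarith

/-- The gap at `y_μ` is at most `νμ`. Moving to `y` changes it by `⟨b, y - y_μ⟩`, where `b/μ` has
local norm at most `β + √ν`. -/
theorem gap_le {yStar y : H} {μ β : ℝ} (hμ : 0 < μ) (hβ0 : 0 ≤ β) (hβ : β < 1)
    (hStar : yStar ∈ P.Q) (hy : y ∈ P.nbhd μ β) : P.b yStar - P.b y ≤ P.κ₁ β * μ := by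
  have hs := hP.mem_interior_Q.1 hy.1
  have h1 := hP.b_sub_yCentral_le hStar hμ
  set d := y - (P.centralPath μ).2.2 with hd
  have h2 := hP.opNorm_sub_yCentral_le hμ hβ hy
  rw [← hd] at h2
  have h3 := (abs_le.1 (hP.abs_residual_apply_le hy d)).2
  have h4 := ((hP.isPosDef_hess_f hs).abs_apply_le (grad P.f y) d).trans
    (mul_le_mul_of_nonneg_right (hP.opDualNorm_grad_f_le hs) (opNorm_nonneg _ d))
  have h5 := (abs_le.1 h4).1
  rw [sub_apply, smul_apply, smul_eq_mul, one_div] at h3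
  have h6 : -(μ⁻¹ * P.b d) ≤ (β + √P.ν) * (β / (1 - β)) := by
    have : (β + √P.ν) * opNorm (hess P.f y) d ≤ (β + √P.ν) * (β / (1 - β)) :=
      mul_le_mul_of_nonneg_left h2 (by positivity)
    linarith
  have h7 : -(P.b d) ≤ μ * ((β + √P.ν) * (β / (1 - β))) := by
    have := mul_le_mul_of_nonneg_left h6 hμ.le
    rw [mul_neg, ← mul_assoc, mul_inv_cancel₀ hμ.ne', one_mul] at this
    exact this
  rw [κ₁]
  rw [hd] at h7
  simp only [map_sub] at h1 h7
  have h8 : (P.ν + β * (β + √P.ν) / (1 - β)) * μ =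
      P.ν * μ + μ * ((β + √P.ν) * (β / (1 - β))) := by ring
  rw [h8]
  linarith

theorem isPosDef_hess_sCentral {μ : ℝ} (hμ : 0 < μ) :
    IsPosDef (hess P.dualBarrier (P.sCentral μ)) :=
  hP.isPosDef_hess_dualBarrier (hP.sCentral_mem_interior hμ)

theorem opNorm_G_add_le (h k : H) : opNorm P.G (h + k) ≤ opNorm P.G h + opNorm P.G k := by
  simp only [hP.opNorm_G, map_add]
  exact (hP.isPosDef_hess_sCentral one_pos).opNorm_add_le _ _

theorem opNorm_G_pos {h : H} (hh : h ≠ 0) : 0 < opNorm P.G h := by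
  rw [hP.opNorm_G]
  exact (hP.isPosDef_hess_sCentral one_pos).opNorm_pos
    ((map_ne_zero_iff P.adj hP.adj_injective).2 hh)

/-- For `k` in the local unit ball both `y + k` and `y - k` are feasible. Sharpness at the two
points adds up, and the linear terms in `k` cancel. -/
theorem mul_opNorm_G_le {yStar y : H} {γd : ℝ} (hsharp : P.IsSharp yStar γd)
    (hy : P.slack y ∈ interior P.dualCone) (h : H) :
    γd * opNorm P.G h ≤ (P.b yStar - P.b y) * opNorm (hess P.f y) h := by
  have hunit : ∀ k : H, opNorm (hess P.f y) k ≤ 1 →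
      γd * opNorm P.G k ≤ P.b yStar - P.b y := by
    intro k hk
    have h1 := hsharp.2 _ (hP.add_mem_Q hy hk)
    have h2 := hsharp.2 _ (hP.add_mem_Q hy (h := -k) (by rwa [opNorm_neg]))
    have h3 := hP.opNorm_G_add_le (y + k - yStar) (-(y + -k - yStar))
    rw [opNorm_neg, show y + k - yStar + -(y + -k - yStar) = (2 : ℝ) • k by module,
      opNorm_smul, abs_of_pos two_pos] at h3
    have h4 := mul_le_mul_of_nonneg_left h3 hsharp.1.le
    simp only [map_add, map_neg] at h1 h2
    linarith
  by_cases hh : h = 0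
  · simp [hh, opNorm]
  have hpos := (hP.isPosDef_hess_f hy).opNorm_pos hh
  have h1 := hunit ((opNorm (hess P.f y) h)⁻¹ • h) (by
    rw [opNorm_smul, abs_of_pos (inv_pos.2 hpos), inv_mul_cancel₀ hpos.ne'])
  rw [opNorm_smul, abs_of_pos (inv_pos.2 hpos)] at h1
  have h2 := mul_le_mul_of_nonneg_right h1 hpos.le
  calc γd * opNorm P.G h =
      γd * ((opNorm (hess P.f y) h)⁻¹ * opNorm P.G h) * opNorm (hess P.f y) h := by
        field_simp
    _ ≤ _ := h2

theorem opNorm_sCentral_optimal_le {yStar : H} (hopt : P.IsDualOptimal yStar) {μ : ℝ}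
    (hμ : 0 < μ) : opNorm (hess P.dualBarrier (P.sCentral μ)) (P.slack yStar) ≤ P.ν := by
  have h1 := hP.dualBarrier.sqrt_hess_le_neg_grad hP.isRegularCone_dualCone
    (hP.sCentral_mem_interior hμ) hopt.1
  rw [hP.grad_dualBarrier_sCentral hμ, neg_neg] at h1
  refine h1.trans ?_
  rw [inv_mul_le_iff₀ hμ, mul_comm]
  exact hP.slack_optimal_xCentral_le hopt hμ

theorem opNorm_sCentral_le (hNC : HasNegativeCurvature P.dualCone P.dualBarrier)
    (hν : 0 < P.ν) {μ : ℝ} (hμ : 0 < μ) (hμ1 : μ ≤ 1) (u : StrongDual ℝ E) :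
    opNorm (hess P.dualBarrier (P.sCentral μ)) u ≤
      2 * P.ν / μ * opNorm (hess P.dualBarrier (P.sCentral 1)) u := by
  have hm := hP.sCentral_mem_interior hμ
  have hm1 := hP.sCentral_mem_interior one_pos
  have h1 := hP.dualBarrier.sqrt_hess_le_neg_grad hP.isRegularCone_dualCone hm
    (interior_subset hm1)
  rw [hP.grad_dualBarrier_sCentral hμ, neg_neg] at h1
  have h2 : P.sCentral 1 (P.centralPath μ).1 ≤ 2 * P.ν := by
    -- Orthogonality of `s₁ - s_μ` and `x₁ - x_μ` gives `⟨s₁, x_μ⟩ + ⟨s_μ, x₁⟩ = ν(1 + μ) ≤ 2ν`.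
    have e1 : (P.sCentral 1 - P.sCentral μ) (P.centralPath 1).1 =
        (P.sCentral 1 - P.sCentral μ) (P.centralPath μ).1 := by
      rw [hP.sCentral_eq_slack hμ, hP.sCentral_eq_slack one_pos, slack_sub_slack,
        ← hP.b_apply hμ, ← hP.b_apply one_pos]
    rw [sub_apply, sub_apply, hP.sCentral_apply_xCentral hμ,
      hP.sCentral_apply_xCentral one_pos] at e1
    have e2 := interior_subset hm _ (interior_subset (hP.isCentralPoint_centralPath one_pos).1)
    nlinarith
  refine hP.dualBarrier.opNorm_le_of_smul_sub_mem hP.isRegularCone_dualCone hNC hm hm1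
    (by positivity) (hP.dualBarrier.smul_sub_mem_of_opNorm_le hP.isRegularCone_dualCone hm
      (h1.trans ?_)) u
  rw [inv_mul_eq_div]
  gcongr

/-- With `r = β / (1 - β)`, both `(1 + r) s - s_μ` and `s_μ - (1 - r) s` lie in the dual cone. The
Hessians then differ by a factor between `(1 - r)²` and `(1 + r)²`, and `2r + r² ≤ 3β` for `β ≤
1/9`. -/
theorem abs_hess_sub_hess_sCentral_le (hNC : HasNegativeCurvature P.dualCone P.dualBarrier)
    {y : H} {μ β : ℝ} (hμ : 0 < μ) (hβ0 : 0 ≤ β) (hβ : β ≤ 1 / 9) (hy : y ∈ P.nbhd μ β)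
    (u : StrongDual ℝ E) :
    |hess P.dualBarrier (P.slack y) u u - hess P.dualBarrier (P.sCentral μ) u u| ≤
      3 * β * hess P.dualBarrier (P.sCentral μ) u u := by
  have hs := hP.mem_interior_Q.1 hy.1
  have hm := hP.sCentral_mem_interior hμ
  have hr := hP.opNorm_sub_yCentral_le hμ (by linarith) hy
  set r := β / (1 - β) with hrdef
  have hr0 : 0 ≤ r := div_nonneg hβ0 (by linarith)
  have hr1 : r ≤ 9 / 8 * β := by
    rw [hrdef, div_le_iff₀ (by linarith)]
    nlinarith
  rw [hP.opNorm_hess_f hs, ← slack_sub_slack, ← hP.sCentral_eq_slack hμ] at hr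
  have h1 := hP.dualBarrier.smul_sub_mem_of_opNorm_le hP.isRegularCone_dualCone hs hr
  have h2 := hP.dualBarrier.smul_add_mem_of_opNorm_le hP.isRegularCone_dualCone hs hr
  have h3 := hP.dualBarrier.hess_le_of_smul_sub_mem hP.isRegularCone_dualCone hNC hs hm
    (ρ := 1 + r) (by linarith) (by convert h1 using 1; module) u
  have hr2 : 0 < 1 - r := by linarith
  have h4 := hP.dualBarrier.hess_le_of_smul_sub_mem hP.isRegularCone_dualCone hNC hm hs
    (ρ := (1 - r)⁻¹) (by positivity) (by
      have := hP.isRegularCone_dualCone.smul_mem _ h2 (1 - r)⁻¹ (by positivity)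
      have e : (1 - r)⁻¹ • P.sCentral μ - P.slack y =
          (1 - r)⁻¹ • (r • P.slack y + (P.sCentral μ - P.slack y)) := by
        rw [show r • P.slack y + (P.sCentral μ - P.slack y) =
          P.sCentral μ - (1 - r) • P.slack y by module, smul_sub, smul_smul,
          inv_mul_cancel₀ hr2.ne', one_smul]
      rwa [e]) u
  rw [inv_pow, ← div_eq_inv_mul, le_div_iff₀ (by positivity)] at h4
  have hq := (hP.isPosDef_hess_sCentral hμ).nonneg u
  set q := hess P.dualBarrier (P.sCentral μ) u u
  rw [abs_le]
  have h5 : 2 * r + r ^ 2 ≤ 3 * β := by nlinarith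
  constructor
  · nlinarith
  · nlinarith

theorem opNorm_B_dualHess_le (hNC : HasNegativeCurvature P.dualCone P.dualBarrier)
    (hν : 0 < P.ν) {yStar : H} (hopt : P.IsDualOptimal yStar) {σd : ℝ}
    (hbound : P.IsHessBounded yStar σd) {y : H} {μ β : ℝ} (hμ : 0 < μ) (hμ1 : μ ≤ 1)
    (hβ0 : 0 ≤ β) (hβ : β ≤ 1 / 9) (hy : y ∈ P.nbhd μ β) :
    opNorm P.B (P.dualHess (P.slack y) (P.slack yStar)) ≤ σd + 6 * P.ν ^ 2 / μ * β := by
  have hs := hP.mem_interior_Q.1 hy.1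
  set w := P.dualHess (P.slack y) (P.slack yStar) with hw
  set w' := P.dualHess (P.sCentral μ) (P.slack yStar) with hw'
  have h1 : opNorm P.B w' ≤ σd := hbound μ hμ hμ1
  -- The difference is tested against its own image under `B`. The constant is `3β` from the Hessian
  -- comparison, `ν` from the local norm of `s_*`, and `2ν/μ` from passing from `s_μ` to `s₁`.
  have hδ : opNorm P.B (w - w') ≤ 6 * P.ν ^ 2 / μ * β := by
    set δ := w - w' with hδ
    have e1 : P.B δ δ = hess P.dualBarrier (P.slack y) (P.slack yStar) (P.B δ) -
        hess P.dualBarrier (P.sCentral μ) (P.slack yStar) (P.B δ) := by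
      rw [hess_dualBarrier_eq, hess_dualBarrier_eq, ← map_sub]
    have e2 := (le_abs_self _).trans (abs_sub_apply_le_of_diagonal
      (hP.isPosDef_hess_sCentral hμ) (hP.isPosDef_hess_dualBarrier hs).symm
      (hP.isPosDef_hess_sCentral hμ).symm
      (hP.abs_hess_sub_hess_sCentral_le hNC hμ hβ0 hβ hy) (P.slack yStar) (P.B δ))
    rw [← e1, ← hP.isPosDef_B.sq_opNorm] at e2
    have e3 := hP.opNorm_sCentral_le hNC hν hμ hμ1 (P.B δ)
    rw [← hP.opDualNorm_B, hP.isPosDef_B.opDualNorm_apply] at e3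
    have e4 := hP.opNorm_sCentral_optimal_le hopt hμ
    have e5 : opNorm P.B δ ^ 2 ≤ 3 * β * (P.ν * (2 * P.ν / μ * opNorm P.B δ)) := by
      refine e2.trans (mul_le_mul_of_nonneg_left ?_ (by positivity))
      exact mul_le_mul e4 e3 (opNorm_nonneg _ _) hν.le
    have e6 := opNorm_nonneg P.B δ
    have e7 : 3 * β * (P.ν * (2 * P.ν / μ * opNorm P.B δ)) =
        6 * P.ν ^ 2 / μ * β * opNorm P.B δ := by ring
    rw [e7] at e5
    rcases e6.eq_or_lt with h0 | hpos
    · rw [← h0]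
      positivity
    · nlinarith
  calc opNorm P.B w = opNorm P.B (w' + (w - w')) := by rw [add_sub_cancel]
    _ ≤ _ := (hP.isPosDef_B.opNorm_add_le _ _).trans (add_le_add h1 hδ)

theorem not_mem_interior_Q_of_isSharp [Nontrivial H] {yStar : H} {γd : ℝ}
    (hsharp : P.IsSharp yStar γd) : yStar ∉ interior P.Q := by
  intro hmem
  obtain ⟨h, hh⟩ := exists_ne (0 : H)
  have hc : ContinuousAt (fun t : ℝ => yStar + t • h) 0 := by fun_prop
  have hc' : ContinuousAt (fun t : ℝ => yStar + t • -h) 0 := by fun_prop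
  have h1 := hc.preimage_mem_nhds (isOpen_interior.mem_nhds (by simpa using hmem))
  have h2 := hc'.preimage_mem_nhds (isOpen_interior.mem_nhds (by simpa using hmem))
  have hev : ∀ᶠ t : ℝ in 𝓝[>] 0, yStar + t • h ∈ interior P.Q ∧ yStar + t • -h ∈ interior P.Q :=
    nhdsWithin_le_nhds (Filter.inter_mem h1 h2)
  obtain ⟨t, ⟨ht1, ht2⟩, htp⟩ := (hev.and self_mem_nhdsWithin).exists
  have htp : 0 < t := htp
  have e1 := hsharp.2 _ (interior_subset ht1)
  have e2 := hsharp.2 _ (interior_subset ht2)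
  rw [add_sub_cancel_left, opNorm_smul, abs_of_pos htp] at e1 e2
  rw [opNorm_neg] at e2
  simp only [map_add, map_smul, map_neg, smul_eq_mul] at e1 e2
  have e3 : 0 < γd * (t * opNorm P.G h) :=
    mul_pos hsharp.1 (mul_pos htp (hP.opNorm_G_pos hh))
  linarith

theorem one_le_opNorm_sub [Nontrivial H] {yStar y : H} {γd : ℝ} (hsharp : P.IsSharp yStar γd)
    (hy : P.slack y ∈ interior P.dualCone) : 1 ≤ opNorm (hess P.f y) (yStar - y) := by
  by_contra! hlt
  refine hP.not_mem_interior_Q_of_isSharp hsharp (hP.mem_interior_Q.2 ?_)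
  have h1 := hP.dualBarrier.add_mem_interior_of_hess_lt_one hy (h := P.adj (y - yStar)) (by
    rw [← hP.hess_f hy, ← (hP.isPosDef_hess_f hy).sq_opNorm, ← opNorm_neg, neg_sub]
    have := opNorm_nonneg (hess P.f y) (yStar - y)
    nlinarith)
  rwa [← slack_sub_slack, add_sub_cancel] at h1

/-- Evaluated at `y₁`, where `‖·‖_G` is the local norm: `y_*` is at distance at least `1`, while the
gap is at most `ν`. -/
theorem sharpness_le_parameter [Nontrivial H] {yStar : H} {γd : ℝ}
    (hStar : yStar ∈ P.Q) (hsharp : P.IsSharp yStar γd) : γd ≤ P.ν := by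
  have hm := hP.slack_yCentral_mem one_pos
  have h1 := hP.one_le_opNorm_sub hsharp hm
  have h2 := hP.b_sub_yCentral_le hStar one_pos
  have h3 := hsharp.2 _ (interior_subset (hP.mem_interior_Q.2 hm))
  rw [hP.opNorm_hess_f hm, ← hP.sCentral_eq_slack one_pos, ← hP.opNorm_G, ← opNorm_neg,
    neg_sub] at h1
  rw [map_sub] at h2
  nlinarith [hsharp.1]

end IsStandard

end ConicProblem

/-- Every point of the segment dominates `τ x` in the cone order, so the Hessian along it is at most
`τ⁻²` times the Hessian at `x`. -/
theorem IsNormalBarrier.abs_grad_sub_le {V : Type*} [NormedAddCommGroup V] [NormedSpace ℝ V]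
    {C : Set V} {Φ : V → ℝ} {ν : ℝ} (hΦ : IsNormalBarrier C Φ ν) (hC : IsRegularCone C)
    (hN : HasNegativeCurvature C Φ) {x z z' : V} (hx : x ∈ interior C) (hz : z ∈ interior C)
    (hz' : z' ∈ interior C) {τ : ℝ} (hτ : 0 < τ) (h : z - τ • x ∈ C) (h' : z' - τ • x ∈ C) (u : V) :
    |grad Φ z' u - grad Φ z u| ≤
      τ⁻¹ ^ 2 * (opNorm (hess Φ x) (z' - z) * opNorm (hess Φ x) u) := by
  set d := z' - z with hd
  have hl : ∀ r ∈ Icc (0 : ℝ) 1, z + r • d ∈ interior C := fun r hr =>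
    hC.segment_mem_interior hz hz' hr
  have hle : ∀ r ∈ Icc (0 : ℝ) 1, ∀ w, opNorm (hess Φ (z + r • d)) w ≤
      τ⁻¹ * opNorm (hess Φ x) w := by
    intro r hr w
    refine hΦ.opNorm_le_of_smul_sub_mem hC hN (hl r hr) hx (inv_pos.2 hτ) ?_ w
    have h1 := hC.convex h h' (sub_nonneg.2 hr.2) hr.1 (by ring)
    have h2 := hC.smul_mem _ h1 τ⁻¹ (inv_nonneg.2 hτ.le)
    have e : (1 - r) • (z - τ • x) + r • (z' - τ • x) = (z + r • d) - τ • x := by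
      rw [hd]
      module
    rwa [e, smul_sub, smul_smul, inv_mul_cancel₀ hτ.ne', one_smul] at h2
  have := norm_image_sub_le_of_norm_deriv_le_segment_01'
    (f := fun r : ℝ => grad Φ (z + r • d) u) (f' := fun r => hess Φ (z + r • d) d u)
    (C := τ⁻¹ ^ 2 * (opNorm (hess Φ x) d * opNorm (hess Φ x) u))
    (fun r hr => (hΦ.hasDerivAt_grad_line u (hl r hr)).hasDerivWithinAt)
    (fun r hr => by
      have hr' : r ∈ Icc (0 : ℝ) 1 := Ico_subset_Icc_self hr
      rw [Real.norm_eq_abs]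
      refine ((hΦ.isPosDef_hess hC (hl r hr')).cauchy_schwarz d u).trans ?_
      refine (mul_le_mul (hle r hr' d) (hle r hr' u) (opNorm_nonneg _ _)
        (mul_nonneg (inv_nonneg.2 hτ.le) (opNorm_nonneg _ _))).trans_eq ?_
      ring)
  simpa [hd] using this

/-! ### The predictor direction and the maximal step. -/

namespace ConicProblem

variable {E H : Type*} [NormedAddCommGroup E] [NormedSpace ℝ E]
  [NormedAddCommGroup H] [NormedSpace ℝ H]

theorem slack_step (P : ConicProblem E H) (y : H) (α : ℝ) :
    P.slack (P.step y α) = P.slack y - α • P.adj (P.v y) := by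
  rw [step, slack_add, map_smul]

theorem κ_mul_div_two (P : ConicProblem E H) (γd σd μ β : ℝ) :
    P.κ γd σd μ β * μ / 2 = (σd + 6 * P.ν ^ 2 / μ * β) * (P.κ₁ β * μ / γd) := by
  rw [κ, κ₂]
  ring

/-- The assumptions under which one predictor step is analysed. -/
structure IsPredictorSetting (P : ConicProblem E H) (yStar : H) (γd σd μ β : ℝ) (y : H) :
    Prop where
  standard : P.IsStandard
  curvature : HasNegativeCurvature P.dualCone P.dualBarrier
  optimal : P.IsDualOptimal yStar
  sharp : P.IsSharp yStar γd
  bounded : P.IsHessBounded yStar σd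
  μ_pos : 0 < μ
  μ_le : μ ≤ 1
  β_nonneg : 0 ≤ β
  β_le : β ≤ 1 / 9
  mem_nbhd : y ∈ P.nbhd μ β
  κ_lt : P.κ γd σd μ β * μ < 1 - 2 * β

namespace IsPredictorSetting

variable {P : ConicProblem E H} {yStar y : H} {γd σd μ β : ℝ}
  (h : P.IsPredictorSetting yStar γd σd μ β y)
include h

theorem parameter_le_κ₁ : P.ν ≤ P.κ₁ β := by
  rw [κ₁]
  have h1 := h.β_nonneg
  have h2 := h.β_le
  have : 0 ≤ β * (β + √P.ν) / (1 - β) := div_nonneg (by positivity) (by linarith)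
  linarith

theorem mul_b_v_le {α : ℝ} (hα : P.step y α ∈ P.Q) :
    α * P.b (P.v y) ≤ P.b yStar - P.b y := by
  have := h.optimal.2 _ hα
  rw [step, map_add, map_smul, smul_eq_mul] at this
  linarith

theorem one_le_parameter [Nontrivial H] : 1 ≤ P.ν := by
  have : Nontrivial E := by
    obtain ⟨u, hu⟩ := exists_ne (0 : H)
    have h1 : P.adj u ≠ 0 := (map_ne_zero_iff P.adj h.standard.adj_injective).2 hu
    by_contra hE
    rw [not_nontrivial_iff_subsingleton] at hE
    apply h1
    ext x
    rw [Subsingleton.elim x 0, map_zero, map_zero]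
  exact h.standard.barrier.one_le_parameter h.standard.regular

variable [FiniteDimensional ℝ E]

theorem slack_mem : P.slack y ∈ interior P.dualCone :=
  h.standard.mem_interior_Q.1 h.mem_nbhd.1

theorem isPosDef : IsPosDef (hess P.f y) := h.standard.isPosDef_hess_f h.slack_mem

variable [FiniteDimensional ℝ H]

theorem hess_v : hess P.f y (P.v y) = grad P.f y := h.isPosDef.apply_inverse _

theorem opNorm_v : opNorm (hess P.f y) (P.v y) = opDualNorm (hess P.f y) (grad P.f y) := by
  rw [h.isPosDef.opDualNorm_eq, v]

theorem opNorm_v_le : opNorm (hess P.f y) (P.v y) ≤ √P.ν := by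
  rw [h.opNorm_v]
  exact h.standard.opDualNorm_grad_f_le h.slack_mem

theorem opNorm_G_le (k : H) :
    opNorm P.G k ≤ P.κ₁ β * μ / γd * opNorm (hess P.f y) k := by
  have h1 := h.standard.mul_opNorm_G_le h.sharp h.slack_mem k
  have h2 := h.standard.gap_le h.μ_pos h.β_nonneg (by linarith [h.β_le]) h.optimal.1 h.mem_nbhd
  rw [div_mul_eq_mul_div, le_div_iff₀ h.sharp.1, mul_comm]
  exact h1.trans (mul_le_mul_of_nonneg_right h2 (opNorm_nonneg _ _))

theorem le_b_v : μ * (opNorm (hess P.f y) (P.v y) * (opNorm (hess P.f y) (P.v y) - β)) ≤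
    P.b (P.v y) := by
  have h1 := (abs_le.1 (h.standard.abs_residual_apply_le h.mem_nbhd (P.v y))).2
  have h2 := h.isPosDef.sq_opNorm (P.v y)
  rw [h.hess_v] at h2
  rw [sub_apply, smul_apply, smul_eq_mul, ← h2, one_div] at h1
  set l := opNorm (hess P.f y) (P.v y)
  have h3 : l * (l - β) ≤ μ⁻¹ * P.b (P.v y) := by linarith
  have h4 := mul_le_mul_of_nonneg_left h3 h.μ_pos.le
  rwa [mul_inv_cancel_left₀ h.μ_pos.ne'] at h4

variable [Nontrivial H]

theorem opNorm_dualHess_le :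
    opNorm P.B (P.dualHess (P.slack y) (P.slack yStar)) ≤ σd + 6 * P.ν ^ 2 / μ * β :=
  h.standard.opNorm_B_dualHess_le h.curvature (by linarith [h.one_le_parameter]) h.optimal
    h.bounded h.μ_pos h.μ_le h.β_nonneg h.β_le h.mem_nbhd

theorem bound_nonneg : 0 ≤ σd + 6 * P.ν ^ 2 / μ * β :=
  (opNorm_nonneg _ _).trans h.opNorm_dualHess_le

theorem one_le_κ₁_div : 1 ≤ P.κ₁ β / γd := by
  rw [one_le_div h.sharp.1]
  exact (h.standard.sharpness_le_parameter h.optimal.1 h.sharp).trans h.parameter_le_κ₁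

theorem κ_mul_nonneg : 0 ≤ P.κ γd σd μ β * μ / 2 := by
  rw [κ_mul_div_two]
  have h1 := h.parameter_le_κ₁
  have h2 := h.one_le_parameter
  exact mul_nonneg h.bound_nonneg
    (div_nonneg (mul_nonneg (by linarith) h.μ_pos.le) h.sharp.1.le)

theorem opNorm_v_sub_le :
    opNorm (hess P.f y) (P.v y - (yStar - y)) ≤ P.κ γd σd μ β * μ / 2 := by
  set e := P.v y - (yStar - y) with he
  set w := P.dualHess (P.slack y) (P.slack yStar) with hw
  -- By homogeneity `∇f(y)` is the Hessian applied to `s`, and `A*(y_* - y) = s - s_*`; subtracting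
  -- leaves only `s_*`.
  have h1 : hess P.f y e e = P.adj e w := by
    rw [← hess_dualBarrier_eq]
    have e1 : hess P.f y e = grad P.f y - hess P.f y (yStar - y) := by
      rw [he, map_sub, h.hess_v]
    rw [e1, sub_apply, h.standard.grad_f_eq_hess h.slack_mem,
      h.standard.hess_f h.slack_mem, ← slack_sub_slack P y yStar,
      map_sub (hess P.dualBarrier (P.slack y)), sub_apply]
    ring
  have h2 := (le_abs_self _).trans (h.standard.abs_apply_le_opNorm_B (P.adj e) w)
  rw [← h1, ← h.standard.opNorm_G, ← h.isPosDef.sq_opNorm] at h2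
  have h3 := mul_le_mul h.opNorm_dualHess_le (h.opNorm_G_le e) (opNorm_nonneg _ _) h.bound_nonneg
  rw [← mul_assoc, ← κ_mul_div_two] at h3
  have h4 := h2.trans h3
  have h5 := opNorm_nonneg (hess P.f y) e
  rcases h5.eq_or_lt with h0 | hpos
  · rw [← h0]
    exact h.κ_mul_nonneg
  · nlinarith

theorem one_sub_le_opNorm_v : 1 - P.κ γd σd μ β * μ / 2 ≤ opNorm (hess P.f y) (P.v y) := by
  have h1 := h.standard.one_le_opNorm_sub h.sharp h.slack_mem
  have h2 := h.isPosDef.opNorm_add_le (P.v y) (-(P.v y - (yStar - y)))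
  rw [opNorm_neg, show P.v y + -(P.v y - (yStar - y)) = yStar - y by abel] at h2
  linarith [h.opNorm_v_sub_le]

/-- From `κμ < 1 - 2β`, the lower bound `1 - κμ/2` exceeds `1/2 + β`. Hence the objective strictly
increases along `v`, which bounds the step. -/
theorem lt_opNorm_v : β < opNorm (hess P.f y) (P.v y) := by
  have h1 := h.one_sub_le_opNorm_v
  have h2 := h.κ_lt
  have h3 := h.β_le
  linarith

theorem b_v_pos : 0 < P.b (P.v y) := by
  have h1 := h.lt_opNorm_v
  have h2 := h.β_nonneg
  have h3 : 0 < opNorm (hess P.f y) (P.v y) * (opNorm (hess P.f y) (P.v y) - β) :=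
    mul_pos (by linarith) (by linarith)
  exact (mul_pos h.μ_pos h3).trans_le h.le_b_v

theorem isGreatest_maxStep :
    IsGreatest {α : ℝ | 0 ≤ α ∧ P.step y α ∈ P.Q} (P.maxStep y) := by
  have hne : {α : ℝ | 0 ≤ α ∧ P.step y α ∈ P.Q}.Nonempty :=
    ⟨0, le_rfl, by simpa [step] using interior_subset h.mem_nbhd.1⟩
  have hbdd : BddAbove {α : ℝ | 0 ≤ α ∧ P.step y α ∈ P.Q} :=
    ⟨(P.b yStar - P.b y) / P.b (P.v y), fun α hα => by
      rw [le_div_iff₀ h.b_v_pos]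
      exact h.mul_b_v_le hα.2⟩
  have hclosed : IsClosed {α : ℝ | 0 ≤ α ∧ P.step y α ∈ P.Q} := by
    refine isClosed_Ici.inter (h.standard.isRegularCone_dualCone.isClosed.preimage
      (P.continuous_slack.comp ?_))
    unfold step
    fun_prop
  exact ⟨hclosed.csSup_mem hne hbdd, fun α hα => le_csSup hbdd hα⟩

theorem inv_one_add_le_maxStep : (1 + P.κ γd σd μ β * μ / 2)⁻¹ ≤ P.maxStep y := by
  set ε := P.κ γd σd μ β * μ / 2 with hε
  have hε0 : 0 ≤ ε := h.κ_mul_nonneg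
  set a := (1 + ε)⁻¹ with ha
  have ha0 : 0 < a := by positivity
  -- With `e = v - (y_* - y)`, the slack at step `a` is `((1 - a) s - a A* e) + a s_*`. The choice
  -- of `a` balances `1 - a` with the bound `aε` for `a e`, so the bracket stays in the dual cone.
  have ha1 : 1 - a = a * ε := by
    rw [ha]
    field_simp
    ring
  refine h.isGreatest_maxStep.2 ⟨ha0.le, ?_⟩
  have hC := h.standard.isRegularCone_dualCone
  have h1 : opNorm (hess P.dualBarrier (P.slack y)) (P.adj (a • (P.v y - (yStar - y)))) ≤
      1 - a := by
    rw [← h.standard.opNorm_hess_f h.slack_mem, opNorm_smul, abs_of_pos ha0, ha1]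
    exact mul_le_mul_of_nonneg_left h.opNorm_v_sub_le ha0.le
  have h2 := h.standard.dualBarrier.smul_sub_mem_of_opNorm_le hC h.slack_mem h1
  have h3 := hC.add_mem h2 (hC.smul_mem _ h.optimal.1 a ha0.le)
  change P.slack (P.step y a) ∈ P.dualCone
  convert h3 using 1
  rw [slack_step, map_smul, map_sub, ← slack_sub_slack]
  module

theorem maxStep_pos : 0 < P.maxStep y := by
  have h1 := h.κ_mul_nonneg
  exact (by positivity : 0 < (1 + P.κ γd σd μ β * μ / 2)⁻¹).trans_le h.inv_one_add_le_maxStep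

theorem abs_maxStep_sub_one_le :
    |P.maxStep y - 1| ≤ P.κ γd σd μ β * μ / (1 - P.κ γd σd μ β * μ - 2 * β) := by
  have hD : 0 < 1 - P.κ γd σd μ β * μ - 2 * β := by linarith [h.κ_lt]
  have hβ := h.β_nonneg
  rw [le_div_iff₀ hD, ← le_div_iff₀ hD]
  have hε0 := h.κ_mul_nonneg
  have hlow := h.inv_one_add_le_maxStep
  have hl := h.one_sub_le_opNorm_v
  have hlβ := h.lt_opNorm_v
  have hbv := h.le_b_v
  have hup := h.mul_b_v_le h.isGreatest_maxStep.1.2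
  have he := h.opNorm_v_sub_le
  set k := P.κ γd σd μ β * μ
  set l := opNorm (hess P.f y) (P.v y)
  set a := P.maxStep y
  rw [le_div_iff₀ hD]
  -- Optimality of `y_*` gives `(ᾱ - 1)⟨b, v⟩ ≤ -⟨b, e⟩`. The right side is bounded here using `b/μ
  -- = ∇f(y)` up to a residual of local norm `β`.
  have hbe : -P.b (P.v y - (yStar - y)) ≤ μ * ((l + β) * (k / 2)) := by
    set e := P.v y - (yStar - y)
    have h1 := (abs_le.1 (h.standard.abs_residual_apply_le h.mem_nbhd e)).2
    have h2 := (abs_le.1 (h.isPosDef.abs_apply_le (grad P.f y) e)).1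
    rw [← h.opNorm_v] at h2
    rw [sub_apply, smul_apply, smul_eq_mul, one_div] at h1
    have h3 : -(μ⁻¹ * P.b e) ≤ (l + β) * (k / 2) := by
      have : (l + β) * opNorm (hess P.f y) e ≤ (l + β) * (k / 2) :=
        mul_le_mul_of_nonneg_left he (by linarith)
      linarith
    have h4 := mul_le_mul_of_nonneg_left h3 h.μ_pos.le
    rwa [mul_neg, ← mul_assoc, mul_inv_cancel₀ h.μ_pos.ne', one_mul] at h4
  simp only [map_sub] at hbe
  rcases le_total a 1 with ha | ha
  · rw [abs_of_nonpos (by linarith)]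
    have h1 : (1 + k / 2) * (1 + k / 2)⁻¹ ≤ (1 + k / 2) * a :=
      mul_le_mul_of_nonneg_left hlow (by linarith)
    rw [mul_inv_cancel₀ (by linarith)] at h1
    have h2 : 1 - a ≤ k / 2 := by nlinarith
    nlinarith
  · rw [abs_of_nonneg (by linarith)]
    have h1 : (a - 1) * (l * (l - β)) ≤ (l + β) * (k / 2) := by
      have h2 : (a - 1) * (μ * (l * (l - β))) ≤ (a - 1) * P.b (P.v y) :=
        mul_le_mul_of_nonneg_left hbv (by linarith)
      have h3 : μ * ((a - 1) * (l * (l - β))) ≤ μ * ((l + β) * (k / 2)) := by linarith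
      exact le_of_mul_le_mul_left h3 h.μ_pos
    -- Uses `l ≥ 1 - k/2`, that is `1 - k ≤ 2l - 1`, together with `β ≤ 1/9`.
    have h4 : (l + β) * (1 - k - 2 * β) ≤ 2 * (l * (l - β)) := by
      have h5 : (l + β) * (1 - k - 2 * β) ≤ (l + β) * (2 * l - 1 - 2 * β) :=
        mul_le_mul_of_nonneg_left (by linarith) (by linarith)
      nlinarith
    have h6 : (a - 1) * ((l + β) * (1 - k - 2 * β)) ≤ (a - 1) * (2 * (l * (l - β))) :=
      mul_le_mul_of_nonneg_left h4 (by linarith)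
    have h7 : (l + β) * ((a - 1) * (1 - k - 2 * β)) ≤ (l + β) * k := by linarith
    exact le_of_mul_le_mul_left h7 (by linarith)

theorem slack_step_eq (α : ℝ) : P.slack (P.step y α) =
    (1 - α / P.maxStep y) • P.slack y +
      (α / P.maxStep y) • P.slack (P.step y (P.maxStep y)) := by
  rw [slack_step, slack_step, smul_sub, smul_smul, div_mul_cancel₀ _ h.maxStep_pos.ne']
  module

theorem slack_step_mem {α : ℝ} (hα : 0 < α) (hα' : α < P.maxStep y) :
    P.slack (P.step y α) ∈ interior P.dualCone := by
  rw [h.slack_step_eq]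
  have h1 : α / P.maxStep y < 1 := (div_lt_one h.maxStep_pos).2 hα'
  exact h.standard.isRegularCone_dualCone.convex.combo_interior_self_mem_interior h.slack_mem
    h.isGreatest_maxStep.1.2 (by linarith) (div_nonneg hα.le h.maxStep_pos.le) (by ring)

end IsPredictorSetting

end ConicProblem

theorem IsRegularCone.relMeasure_spec {V : Type*} [NormedAddCommGroup V] [NormedSpace ℝ V]
    {C : Set V} (hC : IsRegularCone C) {x : V} (hx : x ∈ interior C) (h : V) :
    0 ≤ relMeasure C x h ∧ relMeasure C x h • x - h ∈ C := by
  have hclosed : IsClosed {ρ : ℝ | 0 ≤ ρ ∧ ρ • x - h ∈ C} :=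
    isClosed_Ici.inter (hC.isClosed.preimage (by fun_prop))
  obtain ⟨c, hc, hmem⟩ := hC.exists_smul_sub_mem hx h
  exact hclosed.csInf_mem ⟨c, hc.le, hmem⟩ ⟨0, fun ρ hρ => hρ.1⟩

/-! ### Local norms after the step and the bound on the gradient error. -/

namespace ConicProblem

variable {E H : Type*} [NormedAddCommGroup E] [NormedSpace ℝ E] [FiniteDimensional ℝ E]
  [NormedAddCommGroup H] [NormedSpace ℝ H] [FiniteDimensional ℝ H]

/-- `(1 + ασ) s(y) - s(y(α)) = α(σ s(y) + A* v)` lies in the dual cone, so the Hessian shrinks by at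
most the factor `(1 + ασ)²`. Dual norms reverse the comparison. -/
theorem IsStandard.localNorm_step_le {P : ConicProblem E H} (hP : P.IsStandard)
    (hNC : HasNegativeCurvature P.dualCone P.dualBarrier) {y : H} {α : ℝ} (hα : 0 ≤ α)
    (hy : P.slack y ∈ interior P.dualCone)
    (hy' : P.slack (P.step y α) ∈ interior P.dualCone) (g : StrongDual ℝ H) :
    P.localNorm (P.step y α) g ≤
      (1 + α * relMeasure P.dualCone (P.slack y) (-(P.adj (P.v y)))) * P.localNorm y g := by
  have hC := hP.isRegularCone_dualCone
  obtain ⟨hσ0, hσ⟩ := hC.relMeasure_spec hy (-(P.adj (P.v y)))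
  set σ := relMeasure P.dualCone (P.slack y) (-(P.adj (P.v y)))
  have hασ := mul_nonneg hα hσ0
  have hmem : (1 + α * σ) • P.slack y - P.slack (P.step y α) ∈ P.dualCone := by
    convert hC.smul_mem _ hσ α hα using 1
    rw [slack_step]
    module
  refine (hP.isPosDef_hess_f hy').opDualNorm_le
    (mul_nonneg (by linarith) (opDualNorm_nonneg _ _)) fun u => ?_
  have h1 := (le_abs_self _).trans ((hP.isPosDef_hess_f hy).abs_apply_le g u)
  have h2 := hP.dualBarrier.opNorm_le_of_smul_sub_mem hC hNC hy hy' (by linarith) hmem (P.adj u)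
  rw [← hP.opNorm_hess_f hy, ← hP.opNorm_hess_f hy'] at h2
  have h3 := mul_le_mul_of_nonneg_left h2 (opDualNorm_nonneg (hess P.f y) g)
  rw [localNorm]
  linarith

theorem ξ_sub_inv {a α : ℝ} (ha : 0 < a) (hα : α < a) :
    ξ a α - (1 - α / a)⁻¹ = α / a * (a - 1) / (1 - α / a) := by
  have h1 : a - α ≠ 0 := by linarith
  have h2 : 1 - α / a = (a - α) / a := by field_simp
  rw [ξ, h2]
  field_simp
  ring

namespace IsPredictorSetting

variable {P : ConicProblem E H} {yStar y : H} {γd σd μ β : ℝ}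
  (h : P.IsPredictorSetting yStar γd σd μ β y) [Nontrivial H]
include h

/-- The change of the gradient of the dual barrier in the direction of the optimal slack. -/
theorem abs_grad_sub_slack_optimal_le {t : ℝ} (ht0 : 0 ≤ t) (ht1 : t < 1) (u : H) :
    |grad P.dualBarrier ((1 - t) • P.slack y + t • P.slack yStar) (P.adj u) -
        grad P.dualBarrier ((1 - t) • P.slack y) (P.adj u)| ≤
      t * (1 - t)⁻¹ ^ 2 * (√P.ν * (P.κ γd σd μ β * μ / 2)) * opNorm (hess P.f y) u := by
  have hP := h.standard
  have hC := hP.isRegularCone_dualCone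
  have hD := hP.dualBarrier
  have hτ : 0 < 1 - t := by linarith
  have hz := hC.smul_mem_interior h.slack_mem hτ
  have hts := hC.smul_mem _ h.optimal.1 t ht0
  have hz' := hC.add_mem_interior hz hts
  set z := (1 - t) • P.slack y
  set z' := z + t • P.slack yStar
  set x := gradInv (P.K : Set E) P.F z - gradInv (P.K : Set E) P.F z' with hx
  have hgrad : ∀ k : StrongDual ℝ E, grad P.dualBarrier z' k - grad P.dualBarrier z k = k x := by
    intro k
    have h1 := hP.barrier.grad_conjBarrier_apply hP.regular hz k
    have h2 := hP.barrier.grad_conjBarrier_apply hP.regular hz' k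
    change grad P.dualBarrier z k = _ at h1
    change grad P.dualBarrier z' k = _ at h2
    rw [h1, h2, hx, map_sub]
    ring
  -- The gradient change is represented by a vector of `K`, by monotonicity of the gradient and the
  -- bipolar theorem. For such vectors `‖x‖_B ≤ ⟨s₁, x⟩`, which reduces the estimate to the single
  -- direction `s₁`.
  have hxK : x ∈ (P.K : Set E) := by
    refine hP.regular.mem_of_forall_coneDual fun k hk => ?_
    rw [← hgrad k]
    linarith [hD.grad_le_grad_add hC h.curvature hz hts hk]
  have hs1 : P.sCentral 1 ∈ P.dualCone := interior_subset (hP.sCentral_mem_interior one_pos)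
  have h1 : P.sCentral 1 x ≤ t * (1 - t)⁻¹ ^ 2 * (√P.ν * (σd + 6 * P.ν ^ 2 / μ * β)) := by
    -- Concavity in the direction `s₁` replaces the gradient change by `t (1 - t)⁻² ⟨s₁, ∇²F_*(s)
    -- s_*⟩`; the power of `1 - t` is the homogeneity of the Hessian.
    have e1 := hD.grad_le_add_hess hC h.curvature hz hz' hs1
    rw [add_sub_cancel_left, hD.hess_smul hC h.slack_mem hτ, map_smul, smul_apply, smul_apply,
      smul_apply, smul_eq_mul, smul_eq_mul, hess_dualBarrier_eq] at e1
    have e2 := (le_abs_self _).trans (hP.abs_apply_le_opNorm_B (P.sCentral 1)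
      (P.dualHess (P.slack y) (P.slack yStar)))
    rw [hP.opNorm_sCentral_one, mul_comm] at e2
    have e3 := e2.trans (mul_le_mul_of_nonneg_left h.opNorm_dualHess_le (Real.sqrt_nonneg _))
    have e4 := mul_le_mul_of_nonneg_left e3
      (by positivity : (0 : ℝ) ≤ t * (1 - t)⁻¹ ^ 2)
    rw [← hgrad]
    linarith
  rw [hgrad]
  refine (hP.abs_apply_le_opNorm_B (P.adj u) x).trans ?_
  rw [← hP.opNorm_G]
  refine (mul_le_mul ((hP.opNorm_B_le_sCentral_one hxK).trans h1) (h.opNorm_G_le u)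
    (opNorm_nonneg _ _) ((opNorm_nonneg _ _).trans
      ((hP.opNorm_B_le_sCentral_one hxK).trans h1))).trans_eq ?_
  rw [κ_mul_div_two]
  ring

theorem γ₁_le_aux {α : ℝ} (hα : 0 < α) (hα' : α < P.maxStep y) :
    P.γ₁ y α ≤ α / P.maxStep y * (1 - α / P.maxStep y)⁻¹ ^ 2 *
      (2 * (|P.maxStep y - 1| * √P.ν) + P.κ γd σd μ β * μ / 2 * (1 + √P.ν)) := by
  have hP := h.standard
  have hC := hP.isRegularCone_dualCone
  have hD := hP.dualBarrier
  have ha := h.maxStep_pos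
  have hs2 := h.slack_step_mem hα hα'
  have hξ := ξ_sub_inv ha hα'
  have hs2eq := h.slack_step_eq α
  have hbar : P.slack (P.step y (P.maxStep y)) ∈ P.dualCone := h.isGreatest_maxStep.1.2
  have hdiff : P.slack (P.step y (P.maxStep y)) - P.slack yStar =
      P.adj ((1 - P.maxStep y) • P.v y - (P.v y - (yStar - y))) := by
    rw [slack_sub_slack, step]
    congr 1
    module
  rw [γ₁]
  set a := P.maxStep y
  set t := α / a with ht
  have ht0 : 0 < t := div_pos hα ha
  have ht1 : t < 1 := (div_lt_one ha).2 hα'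
  have hτ : 0 < 1 - t := by linarith
  set ε := P.κ γd σd μ β * μ / 2 with hε
  have hε0 : 0 ≤ ε := h.κ_mul_nonneg
  set q := t * (1 - t)⁻¹ ^ 2 with hq
  have hq0 : 0 ≤ q := by positivity
  refine h.isPosDef.opDualNorm_le (by positivity) fun u => ?_
  set N := opNorm (hess P.f y) u with hN
  have hN0 : 0 ≤ N := opNorm_nonneg _ _
  have hz := hC.smul_mem_interior h.slack_mem hτ
  have hz1 := hC.add_mem_interior hz (hC.smul_mem _ h.optimal.1 t ht0.le)
  -- Both slacks dominate `(1 - t) s` and differ by `t (s(ᾱ) - s_*)`.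
  have hI := hD.abs_grad_sub_le hC h.curvature h.slack_mem hz1 hs2 hτ
    (by simpa using hC.smul_mem _ h.optimal.1 t ht0.le)
    (by rw [hs2eq]; simpa using hC.smul_mem _ hbar t ht0.le) (P.adj u)
  have hII : |_ - _| ≤ q * (√P.ν * ε) * N := h.abs_grad_sub_slack_optimal_le ht0.le ht1 u
  have hgz : grad P.dualBarrier ((1 - t) • P.slack y) (P.adj u) =
      -((1 - t)⁻¹ * grad P.f y u) := by
    rw [hD.grad_smul hC h.slack_mem hτ, hP.grad_f h.slack_mem, smul_apply, smul_eq_mul]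
    ring
  have hdist : opNorm (hess P.dualBarrier (P.slack y))
      (P.slack (P.step y α) - ((1 - t) • P.slack y + t • P.slack yStar)) ≤
      t * (|a - 1| * √P.ν + ε) := by
    have e : t • P.slack (P.step y a) - t • P.slack yStar =
        t • (P.slack (P.step y a) - P.slack yStar) := by module
    rw [hs2eq, add_sub_add_left_eq_sub, e, hdiff, opNorm_smul, abs_of_pos ht0,
      ← hP.opNorm_hess_f h.slack_mem]
    refine mul_le_mul_of_nonneg_left ?_ ht0.le
    rw [sub_eq_add_neg]
    refine (h.isPosDef.opNorm_add_le _ _).trans ?_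
    rw [opNorm_neg, opNorm_smul, abs_sub_comm]
    exact add_le_add (mul_le_mul_of_nonneg_left h.opNorm_v_le (abs_nonneg _)) h.opNorm_v_sub_le
  have hgy : |grad P.f y u| ≤ √P.ν * N :=
    (h.isPosDef.abs_apply_le _ u).trans
      (mul_le_mul_of_nonneg_right (hP.opDualNorm_grad_f_le h.slack_mem) hN0)
  -- The mismatch of scalings carries only one factor `(1 - t)⁻¹`; it is weakened to the square to
  -- match the other two errors.
  have hIII : -((ξ a α - (1 - t)⁻¹) * grad P.f y u) ≤ q * (|a - 1| * √P.ν) * N := by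
    have e1 : |ξ a α - (1 - t)⁻¹| ≤ q * |a - 1| := by
      rw [hξ, abs_div, abs_mul, abs_of_pos ht0, abs_of_pos hτ, hq, div_eq_mul_inv]
      have e2 : (1 - t)⁻¹ ≤ (1 - t)⁻¹ ^ 2 := by
        have : 1 ≤ (1 - t)⁻¹ := (one_le_inv₀ hτ).2 (by linarith)
        nlinarith
      have e3 := mul_le_mul_of_nonneg_left e2 (mul_nonneg ht0.le (abs_nonneg (a - 1)))
      linarith
    refine (neg_le_abs _).trans ?_
    rw [abs_mul]
    refine (mul_le_mul e1 hgy (abs_nonneg _) (by positivity)).trans_eq ?_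
    ring
  have hI' : |grad P.dualBarrier (P.slack (P.step y α)) (P.adj u) -
      grad P.dualBarrier ((1 - t) • P.slack y + t • P.slack yStar) (P.adj u)| ≤
      q * (|a - 1| * √P.ν + ε) * N := by
    refine hI.trans ?_
    rw [← hP.opNorm_hess_f h.slack_mem u]
    refine (mul_le_mul_of_nonneg_left (mul_le_mul_of_nonneg_right hdist hN0)
      (by positivity)).trans_eq ?_
    rw [hq]
    ring
  rw [sub_apply, smul_apply, smul_eq_mul, hP.grad_f hs2]
  have f1 := (abs_le.1 hI').1
  have f2 := (abs_le.1 hII).1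
  rw [hgz] at f2
  clear_value q ε N
  linarith

/-- Pure bookkeeping from `γ₁_le_aux`. The factors `κ₁/γ_d`, `ν` and `(1 - β)/(1 - 2β)` are all at
least `1`, so the last summand of the bracket alone dominates; the other terms are needed only to be
nonnegative. -/
theorem γ₁_le {α : ℝ} (hα : 0 < α) (hα' : α < P.maxStep y) :
    P.γ₁ y α ≤
      α * P.maxStep y * μ / (P.maxStep y - α) ^ 2 *
        ((1 - α / P.maxStep y) * P.κ γd σd μ β * √P.ν +
          2 * P.κ₁ β / γd *
            (σd + 6 * P.ν ^ 2 * β / μ +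
              2 * P.κ γd σd μ β * P.ν *
                (1 + √P.ν / (1 - P.κ γd σd μ β * μ - 2 * β)) *
                ((1 - β) / (1 - 2 * β)))) := by
  refine (h.γ₁_le_aux hα hα').trans ?_
  have ha := h.maxStep_pos
  have hμ := h.μ_pos
  have hν := h.one_le_parameter
  have hβ0 := h.β_nonneg
  have hβ1 := h.β_le
  have hκ0 : 0 ≤ P.κ γd σd μ β := by
    have := h.κ_mul_nonneg
    by_contra! hneg
    nlinarith
  have hr := h.one_le_κ₁_div
  have hdist := h.abs_maxStep_sub_one_le
  have hsp := h.bound_nonneg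
  have hD : 0 < 1 - P.κ γd σd μ β * μ - 2 * β := by linarith [h.κ_lt]
  have hD1 : 1 - P.κ γd σd μ β * μ - 2 * β ≤ 1 := by nlinarith
  set a := P.maxStep y
  set κ := P.κ γd σd μ β
  set D := 1 - κ * μ - 2 * β
  set r := P.κ₁ β / γd
  have hsν : 0 ≤ √P.ν := Real.sqrt_nonneg _
  have hc : 1 ≤ (1 - β) / (1 - 2 * β) := by
    rw [one_le_div (by linarith)]
    linarith
  set c := (1 - β) / (1 - 2 * β)
  have hpre : α * a * μ / (a - α) ^ 2 = α / a * (1 - α / a)⁻¹ ^ 2 * μ := by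
    have h1 : a - α ≠ 0 := by linarith
    have h2 : 1 - α / a = (a - α) / a := by field_simp
    rw [h2]
    field_simp
  rw [hpre, mul_assoc (α / a * (1 - α / a)⁻¹ ^ 2)]
  have ht1 : 0 < 1 - α / a := by
    have := (div_lt_one ha).2 hα'
    linarith
  refine mul_le_mul_of_nonneg_left ?_ (by positivity)
  have hm : √P.ν ≤ √P.ν / D := (le_div_iff₀ hD).2 (by nlinarith)
  set m := √P.ν / D with hmdef
  have hm0 : 0 ≤ m := div_nonneg hsν hD.le
  have hL : 2 * (|a - 1| * √P.ν) ≤ 2 * (κ * μ * m) := by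
    have := mul_le_mul_of_nonneg_right hdist hsν
    have e : κ * μ / D * √P.ν = κ * μ * m := by
      rw [hmdef]
      ring
    linarith
  have hκμ : 0 ≤ κ * μ := mul_nonneg hκ0 hμ.le
  have hbig : 2 * (κ * μ) * (1 + m) ≤ 2 * κ * P.ν * (1 + m) * c * μ := by
    have e1 : 1 ≤ P.ν * c := by nlinarith
    have e2 : 0 ≤ 2 * (κ * μ) * (1 + m) := by positivity
    nlinarith
  have hsp' : 0 ≤ (σd + 6 * P.ν ^ 2 * β / μ) * μ := by
    have e : 6 * P.ν ^ 2 * β / μ = 6 * P.ν ^ 2 / μ * β := by ring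
    rw [e]
    exact mul_nonneg hsp hμ.le
  have hfirst : 0 ≤ (1 - α / a) * κ * √P.ν * μ := by positivity
  have hsum : 2 * (κ * μ) * (1 + m) ≤
      (σd + 6 * P.ν ^ 2 * β / μ + 2 * κ * P.ν * (1 + m) * c) * μ := by linarith
  have hsum0 : 0 ≤ 2 * (κ * μ) * (1 + m) := by positivity
  have hscaled : 2 * (2 * (κ * μ) * (1 + m)) ≤
      2 * P.κ₁ β / γd * (σd + 6 * P.ν ^ 2 * β / μ + 2 * κ * P.ν * (1 + m) * c) * μ := by
    have e : 2 * P.κ₁ β / γd * (σd + 6 * P.ν ^ 2 * β / μ + 2 * κ * P.ν * (1 + m) * c) * μ =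
        2 * (r * ((σd + 6 * P.ν ^ 2 * β / μ + 2 * κ * P.ν * (1 + m) * c) * μ)) := by
      simp only [r]
      ring
    rw [e]
    nlinarith
  have hmul := mul_le_mul_of_nonneg_left hm hκμ
  have hκm : 0 ≤ κ * μ * m := mul_nonneg hκμ hm0
  linarith

end IsPredictorSetting

end ConicProblem

end ConicIPM

/-! ### Assembly of the theorem. -/

theorem mainTheorem4
    {E H : Type*} [NormedAddCommGroup E] [NormedSpace ℝ E] [FiniteDimensional ℝ E]
    [NormedAddCommGroup H] [NormedSpace ℝ H] [FiniteDimensional ℝ H] [Nontrivial H]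
    (P : ConicIPM.ConicProblem E H)
    (hK : P.IsRegular)
    (hF : ConicIPM.IsNormalBarrier (P.K : Set E) P.F P.ν)
    (hA : Function.Surjective P.A)
    (hfeas : P.StrictlyFeasible)
    (yStar : H) (hopt : P.IsDualOptimal yStar)
    (γd : ℝ) (hsharp : P.IsSharp yStar γd)
    (σd : ℝ) (hbound : P.IsHessBounded yStar σd)
    (hNC : ConicIPM.HasNegativeCurvature P.dualCone P.dualBarrier)
    (μ β : ℝ) (hμ0 : 0 < μ) (hμ1 : μ ≤ 1) (hβ0 : 0 ≤ β) (hβ1 : β ≤ 1 / 9)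
    (y : H) (hy : y ∈ P.nbhd μ β)
    (hμ : P.κ γd σd μ β * μ < 1 - 2 * β) :
    IsGreatest {α : ℝ | 0 ≤ α ∧ P.step y α ∈ P.Q} (P.maxStep y) ∧
    ∀ α : ℝ, 0 < α → α < P.maxStep y →
      P.step y α ∈ interior P.Q ∧
      P.proximity (P.step y α) (μ / ConicIPM.ξ (P.maxStep y) α) ≤ P.Γ μ y α ∧
      P.Γ μ y α ≤
        (1 + α * ConicIPM.relMeasure P.dualCone (P.slack y) (-(P.adj (P.v y)))) *
          (P.γ₁ y α + β * (1 + α * P.maxStep y / (P.maxStep y - α))) ∧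
      P.γ₁ y α ≤
        α * P.maxStep y * μ / (P.maxStep y - α) ^ 2 *
          ((1 - α / P.maxStep y) * P.κ γd σd μ β * Real.sqrt P.ν +
            2 * P.κ₁ β / γd *
              (σd + 6 * P.ν ^ 2 * β / μ +
                2 * P.κ γd σd μ β * P.ν *
                  (1 + Real.sqrt P.ν / (1 - P.κ γd σd μ β * μ - 2 * β)) *
                  ((1 - β) / (1 - 2 * β)))) := by
  have h : P.IsPredictorSetting yStar γd σd μ β y :=
    ⟨⟨hK.isRegularCone, hF, hA, hfeas⟩, hNC, hopt, hsharp, hbound, hμ0, hμ1, hβ0, hβ1, hy, hμ⟩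
  refine ⟨h.isGreatest_maxStep, fun α hα hα' => ?_⟩
  have hs := h.slack_step_mem hα hα'
  refine ⟨h.standard.mem_interior_Q.2 hs, ?_, ?_, h.γ₁_le hα hα'⟩
  · rw [ConicIPM.ConicProblem.proximity, one_div_div]
    exact h.standard.localNorm_step_le hNC hα.le h.slack_mem hs _
  · have hσ := (h.standard.isRegularCone_dualCone.relMeasure_spec h.slack_mem
      (-(P.adj (P.v y)))).1
    refine mul_le_mul_of_nonneg_left ?_ (by linarith [mul_nonneg hα.le hσ])
    have hξ : 0 ≤ ConicIPM.ξ (P.maxStep y) α := by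
      have h1 : 0 ≤ α * P.maxStep y / (P.maxStep y - α) :=
        div_nonneg (mul_nonneg hα.le h.maxStep_pos.le) (by linarith)
      rw [ConicIPM.ξ]
      linarith
    -- Inserting `ξ ∇f(y)` separates `γ₁` from `ξ` times the proximity residual at `y`, whose local
    -- norm is at most `β`.
    have hsplit : ConicIPM.grad P.f (P.step y α) - (ConicIPM.ξ (P.maxStep y) α / μ) • P.b =
        (ConicIPM.grad P.f (P.step y α) -
          ConicIPM.ξ (P.maxStep y) α • ConicIPM.grad P.f y) +
        ConicIPM.ξ (P.maxStep y) α • (ConicIPM.grad P.f y - (1 / μ) • P.b) := by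
      rw [smul_sub, smul_smul, mul_one_div]
      abel
    rw [hsplit]
    refine (h.isPosDef.opDualNorm_add_le _ _).trans (add_le_add le_rfl ?_)
    rw [h.isPosDef.opDualNorm_smul, abs_of_nonneg hξ, mul_comm]
    exact mul_le_mul_of_nonneg_right hy.2 hξ
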